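/- Let $L^2[0,\infty[$ be the Hilbert space of square integrable complex functions on the half-line. For $\alpha\in\mathbb C$ let $L_\alpha=-\partial_x^2+\left(-\tfrac14+\alpha\right)\tfrac1{x^2}$; let $L_\alpha^{\min}$ be the closure of $L_\alpha$ on $C_{\mathrm c}^\infty]0,\infty[$, and let $L_\alpha^{\max}$ be $L_\alpha$ (in the sense of distributions on $]0,\infty[$) with domain $\{f\in L^2[0,\infty[\,:\,L_\alpha f\in L^2[0,\infty[\}$. Let $\xi\in C_{\mathrm c}^\infty(\mathbb R)$ be a real-valued cutoff equal to $1$ around $0$. For $m\in\mathbb C$ with $\operatorname{Re} m>-1$ let $H_m$ be the restriction of $L_{m^2}^{\max}$ to $\operatorname{Dom}L_{m^2}^{\min}+\mathbb C\,x^{\frac12+m}\xi$. Let $A=\frac1{2i}(x\partial_x+\partial_x x)$ be the self-adjoint generator of the group of dilations, $(e^{i\tau A}f)(x)=e^{\tau/2}f(e^\tau x)$, and put $$\Xi_m(t)=e^{i\ln(2)t}\,\frac{\Gamma\left(\frac{m+1+it}{2}\right)}{\Gamma\left(\frac{m+1-it}{2}\right)},\qquad t\in\mathbb R .$$ Let $\mathcal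 F_m$ be the Hankel transformation, that is, the bounded operator on $L^2[0,\infty[$ such that, for $f\in L^1\cap L^2$ and with $J_m$ the Bessel function, $$(\mathcal F_m f)(x)=\int_0^\infty J_m(kx)\sqrt{kx}\,f(k)\,dk .$$ **Theorem.** Let $m,k\in\mathbb C$ with $\operatorname{Re} m>-1$ and $\operatorname{Re} k>-1$. Then $iH_m$ and $iH_k$ generate strongly continuous one-parameter groups $e^{itH_m}$, $e^{itH_k}$ ($t\in\mathbb R$) of bounded operators, the Hankel transformations $\mathcal F_m$, $\mathcal F_k$ exist as bounded operators, $\Xi_m(A)$ and $\Xi_k(A)$ (in the sense of the functional calculus of $A$) are bounded operators with bounded inverses, and the Møller operators $$\Omega_{m,k}^\pm:=\lim_{t\to\pm\infty}e^{itH_m}e^{-itH_k}$$ exist as strong limits and satisfy $$\Omega_{m,k}^\pm=e^{\pm i(m-k)\pi/2}\,\mathcal F_m\mathcal F_k=e^{\pm i(m-k)\pi/2}\,\frac{\Xi_k(A)}{\Xi_m(A)},\qquad \frac{\Xi_k(A)}{\Xi_m(A)}:=\Xi_k(A)\,\Xi_m(A)^{-1}.$$ -/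

import Mathlib

open MeasureTheory Filter Topology
open scoped ContDiff

namespace Moller

/-! ### One-parameter groups, generators and functions of a self-adjoint operator -/

section Abstract

variable {E : Type*} [NormedAddCommGroup E] [NormedSpace ℂ E]

/-- The pairs `(f, g)` with `lim_{t → 0} t⁻¹ (U t f - f) = i g`. -/
def generatorGraph (U : ℝ → E →L[ℂ] E) : Submodule ℂ (E × E) where
  carrier := {p | Tendsto (fun t : ℝ => ((t : ℂ)⁻¹) • (U t p.1 - p.1)) (𝓝[≠] 0)
    (𝓝 (Complex.I • p.2))}
  add_mem' := by
    intro p q hp hq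
    have h := Tendsto.add hp hq
    simp only [Set.mem_ofPred_eq, Prod.fst_add, Prod.snd_add, smul_add, map_add]
    refine h.congr fun t => ?_
    rw [← smul_add]
    congr 1
    abel
  zero_mem' := by simp
  smul_mem' := by
    intro c p hp
    have h := Tendsto.const_smul hp c
    simp only [Set.mem_ofPred_eq, Prod.smul_fst, Prod.smul_snd, map_smul]
    rw [smul_comm Complex.I c]
    refine h.congr fun t => ?_
    rw [← smul_sub, smul_comm]

/-- The generator `A` of `U`, normalized so that `U t = e^{itA}`: the domain consists of the `f`
for which `lim_{t → 0} t⁻¹ (U t f - f)` exists, and `A f` is `-i` times this limit. -/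
noncomputable def generator (U : ℝ → E →L[ℂ] E) : E →ₗ.[ℂ] E :=
  (generatorGraph U).toLinearPMap

theorem generator_graph (U : ℝ → E →L[ℂ] E) : (generator U).graph = generatorGraph U := by
  apply Submodule.toLinearPMap_graph_eq
  rintro ⟨f, g⟩ h (rfl : f = 0)
  have h1 : Tendsto (fun _ : ℝ => (0 : E)) (𝓝[≠] 0) (𝓝 (Complex.I • g)) := by
    simpa [generatorGraph] using h
  have h2 := tendsto_nhds_unique h1 tendsto_const_nhds
  simpa using h2

/-- A strongly continuous one-parameter group of bounded operators. -/
structure IsOneParameterGroup (U : ℝ → E →L[ℂ] E) : Prop where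
  zero : U 0 = ContinuousLinearMap.id ℂ E
  add : ∀ s t : ℝ, U (s + t) = (U s).comp (U t)
  continuous : ∀ f : E, Continuous fun t => U t f

/-- `U` is the group `t ↦ e^{itH}` of bounded operators generated by the (in general unbounded, not
necessarily self-adjoint) operator `H`. -/
def IsExpGroup (H : E →ₗ.[ℂ] E) (U : ℝ → E →L[ℂ] E) : Prop :=
  IsOneParameterGroup U ∧ generator U = H

/-- `Ω` is the strong limit of `U t V(-t)` along the filter `l`. With `U t = e^{itH}`,
`V t = e^{itK}` and `l = atTop` or `l = atBot`, it is the Møller operator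
`lim_{t → ±∞} e^{itH} e^{-itK}`. -/
def IsMollerOperator (l : Filter ℝ) (U V : ℝ → E →L[ℂ] E) (Ω : E →L[ℂ] E) : Prop :=
  ∀ f : E, Tendsto (fun t => U t (V (-t) f)) l (𝓝 (Ω f))

/-- `T = φ(A)` in the functional calculus of the self-adjoint operator `A`: some unitary `W` onto an
`L²` space carries `A`, with its domain, to the (maximal) operator of multiplication by a real
measurable function `a`, and carries `T` to the multiplication by `φ ∘ a`. -/
def IsFunctionOf (A : E →ₗ.[ℂ] E) (φ : ℝ → ℂ) (T : E →L[ℂ] E) : Prop :=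
  ∃ (S : Type) (_ : MeasurableSpace S) (μ : Measure S) (a : S → ℝ)
    (W : E ≃ₗᵢ[ℂ] Lp ℂ 2 μ),
    Measurable a ∧
    (∀ f : E, f ∈ A.domain ↔ MemLp (fun s => (a s : ℂ) * W f s) 2 μ) ∧
    (∀ f : A.domain, W (A f) =ᵐ[μ] fun s => (a s : ℂ) * W (f : E) s) ∧
    ∀ f : E, W (T f) =ᵐ[μ] fun s => φ (a s) * W f s

end Abstract

/-- Lebesgue measure on the half-line. -/
noncomputable abbrev halfLine : Measure ℝ := volume.restrict (Set.Ioi (0 : ℝ))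

/-- The Hilbert space `L²[0,∞[` of complex functions. -/
abbrev L2 : Type := Lp ℂ 2 halfLine

/-! ### The generator of dilations -/

theorem map_mul_halfLine {c : ℝ} (hc : 0 < c) :
    Measure.map (fun x => c * x) halfLine = ENNReal.ofReal c⁻¹ • halfLine := by
  have h1 : (fun x : ℝ => c * x) ⁻¹' Set.Ioi 0 = Set.Ioi 0 := by
    ext x; simp [hc]
  have h2 := Measure.restrict_map (μ := (volume : Measure ℝ)) (measurable_const_mul c)
    (measurableSet_Ioi (a := (0 : ℝ)))
  rw [h1] at h2
  rw [halfLine, ← h2, Real.map_volume_mul_left hc.ne', Measure.restrict_smul,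
    abs_of_pos (inv_pos.2 hc)]

theorem quasiMeasurePreserving_mul {c : ℝ} (hc : 0 < c) :
    Measure.QuasiMeasurePreserving (fun x => c * x) halfLine halfLine := by
  refine ⟨measurable_const_mul c, ?_⟩
  rw [map_mul_halfLine hc]
  exact Measure.smul_absolutelyContinuous

theorem eLpNorm_comp_mul {c : ℝ} (hc : 0 < c) (f : L2) :
    eLpNorm (fun x => f (c * x)) 2 halfLine
      = (ENNReal.ofReal c⁻¹) ^ (1 / 2 : ℝ) * eLpNorm f 2 halfLine := by
  have h := eLpNorm_map_measure (p := 2) (μ := halfLine) (f := fun x : ℝ => c * x)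
    (g := (f : ℝ → ℂ))
    (by rw [map_mul_halfLine hc]; exact (Lp.aestronglyMeasurable f).smul_measure _)
    (measurable_const_mul c).aemeasurable
  have h' : eLpNorm (fun x => f (c * x)) 2 halfLine = eLpNorm ((f : ℝ → ℂ) ∘ fun x => c * x) 2
    halfLine := rfl
  rw [h', ← h, map_mul_halfLine hc, eLpNorm_smul_measure_of_ne_top (by norm_num)]
  simp

theorem memLp_dilation (τ : ℝ) (f : L2) :
    MemLp (fun x => (Real.exp (τ / 2) : ℂ) * f (Real.exp τ * x)) 2 halfLine := by
  apply MemLp.const_mul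
  refine ⟨(Lp.aestronglyMeasurable f).comp_quasiMeasurePreserving
    (quasiMeasurePreserving_mul (Real.exp_pos τ)), ?_⟩
  rw [eLpNorm_comp_mul (Real.exp_pos τ)]
  exact ENNReal.mul_lt_top (ENNReal.rpow_lt_top_of_nonneg (by norm_num) (by simp))
    (Lp.memLp f).2

/-- The dilation `(U_τ f)(x) = e^{τ/2} f(e^τ x)` on `L²[0,∞[`. -/
noncomputable def dilation (τ : ℝ) : L2 →L[ℂ] L2 :=
  LinearMap.mkContinuous
    { toFun := fun f => (memLp_dilation τ f).toLp
      map_add' := by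
        intro f g
        rw [← MemLp.toLp_add]
        apply MemLp.toLp_congr
        have h := (quasiMeasurePreserving_mul (Real.exp_pos τ)).ae (Lp.coeFn_add f g)
        filter_upwards [h] with x hx
        rw [hx]
        simp [mul_add]
      map_smul' := by
        intro c f
        rw [RingHom.id_apply, ← MemLp.toLp_const_smul]
        apply MemLp.toLp_congr
        have h := (quasiMeasurePreserving_mul (Real.exp_pos τ)).ae (Lp.coeFn_smul c f)
        filter_upwards [h] with x hx
        rw [hx]
        simp [mul_left_comm] }
    (Real.exp (τ / 2) * ((ENNReal.ofReal (Real.exp τ)⁻¹) ^ (1 / 2 : ℝ)).toReal) (by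
      intro f
      have h := eLpNorm_const_smul (Real.exp (τ / 2) : ℂ) (fun x => f (Real.exp τ * x)) 2 halfLine
      rw [eLpNorm_comp_mul (Real.exp_pos τ)] at h
      have h' : eLpNorm (fun x => (Real.exp (τ / 2) : ℂ) * f (Real.exp τ * x)) 2 halfLine = _ := h
      rw [LinearMap.coe_mk, AddHom.coe_mk, Lp.norm_toLp, h', Lp.norm_def]
      simp [ENNReal.toReal_mul, mul_assoc, -Complex.ofReal_exp])

/-- The self-adjoint generator of dilations `A = (1/2i)(x∂ₓ + ∂ₓx)`, so that `U_τ = e^{iτA}`. -/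
noncomputable def dilationGenerator : L2 →ₗ.[ℂ] L2 := generator dilation

/-! ### The homogeneous Schrödinger operators -/

/-- Test functions on the open half-line: the elements of `C_c^∞ ]0,∞[`. -/
def IsTest (φ : ℝ → ℂ) : Prop :=
  ContDiff ℝ ∞ φ ∧ HasCompactSupport φ ∧ tsupport φ ⊆ Set.Ioi 0

/-- The differential expression `L_α φ = -φ'' + (-1/4 + α) x⁻² φ`. -/
noncomputable def diffExpr (α : ℂ) (φ : ℝ → ℂ) (x : ℝ) : ℂ :=
  -deriv (deriv φ) x + (-1 / 4 + α) * ((x : ℂ) ^ 2)⁻¹ * φ x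

theorem IsTest.zero : IsTest 0 := by
  refine ⟨contDiff_const, HasCompactSupport.zero, ?_⟩
  simp [tsupport]

theorem IsTest.add {φ ψ : ℝ → ℂ} (hφ : IsTest φ) (hψ : IsTest ψ) : IsTest (φ + ψ) :=
  ⟨hφ.1.add hψ.1, hφ.2.1.add hψ.2.1,
    (tsupport_add φ ψ).trans (Set.union_subset hφ.2.2 hψ.2.2)⟩

theorem IsTest.smul {φ : ℝ → ℂ} (c : ℂ) (hφ : IsTest φ) : IsTest (c • φ) :=
  ⟨contDiff_const.smul hφ.1, hφ.2.1.smul_left (f := fun _ => c),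
    (tsupport_smul_subset_right (fun _ => c) φ).trans hφ.2.2⟩

theorem IsTest.deriv {φ : ℝ → ℂ} (hφ : IsTest φ) : IsTest (deriv φ) :=
  ⟨by
    have h : ContDiff ℝ (∞ + 1) φ := by simpa using hφ.1
    exact (contDiff_succ_iff_deriv.1 h).2.2,
    hφ.2.1.deriv, (tsupport_deriv_subset (f := φ) (𝕜 := ℝ)).trans hφ.2.2⟩

theorem IsTest.differentiable {φ : ℝ → ℂ} (hφ : IsTest φ) : Differentiable ℝ φ :=
  hφ.1.differentiable (by simp)

theorem diffExpr_zero (α : ℂ) : diffExpr α 0 = 0 := by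
  ext x
  have h : deriv (0 : ℝ → ℂ) = 0 := by ext y; simp
  simp [diffExpr, h]

theorem diffExpr_add (α : ℂ) {φ ψ : ℝ → ℂ} (hφ : IsTest φ) (hψ : IsTest ψ) :
    diffExpr α (φ + ψ) = diffExpr α φ + diffExpr α ψ := by
  ext x
  have h : deriv (φ + ψ) = deriv φ + deriv ψ := by
    ext y; exact deriv_add (hφ.differentiable y) (hψ.differentiable y)
  simp only [diffExpr, h, Pi.add_apply]
  rw [deriv_add (hφ.deriv.differentiable x) (hψ.deriv.differentiable x)]
  ring

theorem diffExpr_smul (α c : ℂ) {φ : ℝ → ℂ} (hφ : IsTest φ) :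
    diffExpr α (c • φ) = c • diffExpr α φ := by
  ext x
  have h : deriv (c • φ) = c • deriv φ := by
    ext y; exact deriv_const_smul c (hφ.differentiable y)
  simp only [diffExpr, h, Pi.smul_apply, smul_eq_mul]
  rw [deriv_const_smul c (hφ.deriv.differentiable x)]
  simp only [smul_eq_mul]
  ring

theorem continuous_diffExpr (α : ℂ) {φ : ℝ → ℂ} (hφ : IsTest φ) :
    Continuous (diffExpr α φ) := by
  rw [continuous_iff_continuousAt]
  intro x
  rcases lt_or_ge 0 x with hx | hx
  · refine (hφ.deriv.deriv.1.continuous.neg.continuousAt).add ?_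
    refine (continuousAt_const.mul ?_).mul hφ.1.continuous.continuousAt
    refine ContinuousAt.inv₀ (by fun_prop) ?_
    simpa using hx.ne'
  · have h0 : φ =ᶠ[𝓝 x] 0 :=
      notMem_tsupport_iff_eventuallyEq.1 fun h => absurd (hφ.2.2 h) (not_lt.2 hx)
    have h2 : Moller.diffExpr α φ =ᶠ[𝓝 x] fun _ => 0 := by
      filter_upwards [h0, h0.deriv.deriv] with y hy hy2
      simp only [diffExpr, hy, hy2]
      have h : deriv (0 : ℝ → ℂ) = 0 := by ext y; simp
      simp [h]
    exact continuousAt_const.congr h2.symm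

theorem hasCompactSupport_diffExpr (α : ℂ) {φ : ℝ → ℂ} (hφ : IsTest φ) :
    HasCompactSupport (diffExpr α φ) :=
  (hφ.deriv.deriv.2.1.neg).add (hφ.2.1.mul_left (f := fun x : ℝ => (-1 / 4 + α) * ((x : ℂ) ^ 2)⁻¹))

theorem integrable_mul {ψ : ℝ → ℂ} (hc : Continuous ψ) (hs : HasCompactSupport ψ) (f : L2) :
    Integrable (fun x => f x * ψ x) halfLine :=
  MemLp.integrable_mul (p := 2) (q := 2) (Lp.memLp f) (hc.memLp_of_hasCompactSupport hs)

/-- The pairs `(f, g)` in `L² × L²` with `L_α f = g` on `]0,∞[` in the sense of distributions. -/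
noncomputable def maxGraph (α : ℂ) : Submodule ℂ (L2 × L2) where
  carrier := {p | ∀ φ : ℝ → ℂ, IsTest φ →
    ∫ x in Set.Ioi (0 : ℝ), p.2 x * φ x = ∫ x in Set.Ioi (0 : ℝ), p.1 x * diffExpr α φ x}
  add_mem' := by
    intro p q hp hq φ hφ
    have e1 : ∫ x in Set.Ioi (0 : ℝ), (p + q).2 x * φ x
        = ∫ x in Set.Ioi (0 : ℝ), (p.2 x * φ x + q.2 x * φ x) := by
      apply integral_congr_ae
      filter_upwards [Lp.coeFn_add p.2 q.2] with x hx
      simp only [Prod.snd_add, hx, Pi.add_apply, add_mul]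
    have e2 : ∫ x in Set.Ioi (0 : ℝ), (p + q).1 x * diffExpr α φ x
        = ∫ x in Set.Ioi (0 : ℝ), (p.1 x * diffExpr α φ x + q.1 x * diffExpr α φ x) := by
      apply integral_congr_ae
      filter_upwards [Lp.coeFn_add p.1 q.1] with x hx
      simp only [Prod.fst_add, hx, Pi.add_apply, add_mul]
    have hc := continuous_diffExpr α hφ
    have hs := hasCompactSupport_diffExpr α hφ
    rw [e1, e2, integral_add (integrable_mul hφ.1.continuous hφ.2.1 _)
      (integrable_mul hφ.1.continuous hφ.2.1 _),
      integral_add (integrable_mul hc hs _) (integrable_mul hc hs _), hp φ hφ, hq φ hφ]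
  zero_mem' := by
    intro φ hφ
    have h : ((0 : L2) : ℝ → ℂ) =ᵐ[halfLine] 0 := Lp.coeFn_zero _ _ _
    have e (ψ : ℝ → ℂ) : ∫ x in Set.Ioi (0 : ℝ), (0 : L2) x * ψ x = 0 := by
      rw [integral_congr_ae (g := fun _ => 0)]
      · simp
      · filter_upwards [h] with x hx
        rw [hx, Pi.zero_apply, zero_mul]
    simp only [Prod.fst_zero, Prod.snd_zero, e]
  smul_mem' := by
    intro c p hp φ hφ
    have e (f : L2) (ψ : ℝ → ℂ) : ∫ x in Set.Ioi (0 : ℝ), (c • f) x * ψ x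
        = c * ∫ x in Set.Ioi (0 : ℝ), f x * ψ x := by
      rw [← integral_const_mul]
      apply integral_congr_ae
      filter_upwards [Lp.coeFn_smul c f] with x hx
      simp only [hx, Pi.smul_apply, smul_eq_mul, mul_assoc]
    simp only [Prod.smul_fst, Prod.smul_snd, e, hp φ hφ]

/-- The maximal operator `L_α^max`, with domain the `f ∈ L²` such that `L_α f ∈ L²`. -/
noncomputable def Lmax (α : ℂ) : L2 →ₗ.[ℂ] L2 := (maxGraph α).toLinearPMap

theorem Lmax_graph (α : ℂ) : (Lmax α).graph = maxGraph α := by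
  apply Submodule.toLinearPMap_graph_eq
  rintro ⟨f, g⟩ h (rfl : f = 0)
  change g = 0
  have h0 : ((0 : L2) : ℝ → ℂ) =ᵐ[halfLine] 0 := Lp.coeFn_zero _ _ _
  have hloc : LocallyIntegrableOn (g : ℝ → ℂ) (Set.Ioi 0) :=
    locallyIntegrableOn_of_locallyIntegrable_restrict
      ((Lp.memLp g).locallyIntegrable (by norm_num))
  have hz := isOpen_Ioi.ae_eq_zero_of_integral_contDiff_smul_eq_zero hloc (by
    intro φ h1 h2 h3
    have ht : IsTest (fun x => (φ x : ℂ)) :=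
      ⟨Complex.ofRealCLM.contDiff.comp h1, h2.comp_left (g := Complex.ofReal) (by simp),
        (tsupport_comp_subset (g := Complex.ofReal) (by simp) φ).trans h3⟩
    have e := h _ ht
    have e2 : ∫ x in Set.Ioi (0 : ℝ), (0 : L2) x * diffExpr α (fun x => (φ x : ℂ)) x = 0 := by
      rw [integral_congr_ae (g := fun _ => 0)]
      · simp
      · filter_upwards [h0] with x hx
        rw [hx, Pi.zero_apply, zero_mul]
    simp only [e2] at e
    rw [← setIntegral_eq_integral_of_forall_compl_eq_zero (s := Set.Ioi (0 : ℝ)), ← e]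
    · exact integral_congr_ae (ae_of_all _ fun x => by simp [mul_comm])
    · intro x hx
      rw [image_eq_zero_of_notMem_tsupport fun h => hx (h3 h), zero_smul])
  apply Lp.ext
  refine EventuallyEq.trans ?_ (Lp.coeFn_zero _ _ _).symm
  exact (ae_restrict_iff' measurableSet_Ioi).2 hz

/-- The graph of `L_α` on `C_c^∞ ]0,∞[`. -/
noncomputable def testGraph (α : ℂ) : Submodule ℂ (L2 × L2) where
  carrier := {p | ∃ φ : ℝ → ℂ, IsTest φ ∧
    p.1 =ᵐ[halfLine] φ ∧ p.2 =ᵐ[halfLine] diffExpr α φ}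
  add_mem' := by
    rintro p q ⟨φ, hφ, h1, h2⟩ ⟨ψ, hψ, h3, h4⟩
    refine ⟨φ + ψ, hφ.add hψ, (Lp.coeFn_add _ _).trans (h1.add h3), ?_⟩
    rw [diffExpr_add α hφ hψ]
    exact (Lp.coeFn_add _ _).trans (h2.add h4)
  zero_mem' := ⟨0, IsTest.zero, Lp.coeFn_zero _ _ _, by
    rw [diffExpr_zero]; exact Lp.coeFn_zero _ _ _⟩
  smul_mem' := by
    rintro c p ⟨φ, hφ, h1, h2⟩
    refine ⟨c • φ, hφ.smul c, (Lp.coeFn_smul _ _).trans (h1.const_smul c), ?_⟩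
    rw [diffExpr_smul α c hφ]
    exact (Lp.coeFn_smul _ _).trans (h2.const_smul c)

/-- The minimal operator `L_α^min`: the closure of `L_α` on `C_c^∞ ]0,∞[`. -/
noncomputable def Lmin (α : ℂ) : L2 →ₗ.[ℂ] L2 := (testGraph α).topologicalClosure.toLinearPMap

/-- A smooth compactly supported cutoff, equal to `1` around `0`. -/
structure IsCutoff (ξ : ℝ → ℝ) : Prop where
  smooth : ContDiff ℝ ∞ ξ
  compact : HasCompactSupport ξ
  one_near_zero : ∀ᶠ x in 𝓝 0, ξ x = 1

/-- The operator `H_m`: the restriction of `L_{m²}^max` to `Dom L_{m²}^min + ℂ x^{1/2+m} ξ`. -/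
noncomputable def schrodinger (ξ : ℝ → ℝ) (m : ℂ) : L2 →ₗ.[ℂ] L2 :=
  (Lmax (m ^ 2)).domRestrict ((Lmin (m ^ 2)).domain ⊔
    Submodule.span ℂ {f : L2 | f =ᵐ[halfLine] fun x => (x : ℂ) ^ (1 / 2 + m) * (ξ x : ℂ)})

/-! ### The Hankel transformation and the function `Ξ_m` -/

/-- The Bessel function `J_m(x)`, for `m ∈ ℂ` and `x > 0`. -/
noncomputable def besselJ (m : ℂ) (x : ℝ) : ℂ :=
  ∑' n : ℕ, (-1) ^ n / ((n.factorial : ℂ) * Complex.Gamma (m + n + 1)) *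
    ((x / 2 : ℝ) : ℂ) ^ (m + 2 * n)

/-- `F` is the Hankel transformation `ℱ_m`: the bounded operator on `L²[0,∞[` given by
`(ℱ_m f)(x) = ∫_0^∞ J_m(kx) √(kx) f(k) dk` for all `f ∈ L¹ ∩ L²` (which determines it). -/
def IsHankelTransform (m : ℂ) (F : L2 →L[ℂ] L2) : Prop :=
  ∀ f : L2, Integrable f halfLine → F f =ᵐ[halfLine] fun x =>
    ∫ k in Set.Ioi (0 : ℝ), besselJ m (k * x) * (Real.sqrt (k * x) : ℂ) * f k

/-- `Ξ_m(t) = e^{i ln(2) t} Γ((m+1+it)/2) / Γ((m+1-it)/2)`. -/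
noncomputable def Xi (m : ℂ) (t : ℝ) : ℂ :=
  Complex.exp (Complex.I * (Real.log 2 : ℂ) * t) *
    (Complex.Gamma ((m + 1 + Complex.I * t) / 2) / Complex.Gamma ((m + 1 - Complex.I * t) / 2))

end Moller

/-! The Mellin transformation `mellinL2` is unitary and carries `A` to multiplication by the real
variable `specVar`, so every bounded `φ(A)` becomes a multiplication operator. In this picture the
Hankel transformation is multiplication by `Ξ_m` followed by the reflection `τ ↦ -τ`. It is bounded
because `Ξ_m` is, and `Ξ_m(-τ) = Ξ_m(τ)⁻¹` makes it an involution, although not a unitary one for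
general complex `m`. In a product of two Hankel transformations the reflections cancel, which gives
`ℱ_m ℱ_k = (Ξ_k / Ξ_m)(A)` (`hankel_mul_hankel`).

Next, `H_m = ℱ_m x² ℱ_m`, hence `e^{itH_m} = ℱ_m e^{itx²} ℱ_m`, and with `φ = Ξ_k / Ξ_m` `e^{itH_m}
e^{-itH_k} = ℱ_m (e^{itx²} φ(A) e^{-itx²}) ℱ_k`. Formally `e^{itx²} A e^{-itx²} = A - 2tx²`. Since
`x² > 0`, only the limit of `φ` at `∓∞` should survive as `t → ±∞`, so the bracket converges
strongly to that constant. Gamma function asymptotics give `φ(∓∞) = e^{±i(m-k)π/2}`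
(`tendsto_Xi_div_Xi_atTop`, `tendsto_Xi_div_Xi_atBot`).

All of this is made rigorous on the Gaussians `x^{1/2+m} e^{-zx²/2}`. They are total in `L²` by
Weierstrass approximation in the variable `e^{-x²/2}` (`ae_eq_zero_of_integral_gaussian`), and their
Mellin transforms are explicit Gamma functions. Dilations and `ℱ_m` permute them up to scalars,
which identifies the generator of dilations (`dilation_eq_conjGroup`) and the transpose of `ℱ_m`
(`pairing_hankel`). Integrating the Bessel series against Gaussians then identifies the integral
kernel (`isHankelTransform_hankel`).

For the generator, `ℱ_m` exchanges multiplication by `x²` with the differential expression on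
Gaussians, and the Gaussians form a core (`hankelGroup_graph_le_closure`). A Gaussian is a graph
limit of functions exactly equal to `A x^{1/2+m}` near `0` and vanishing near `∞`; each of these is
a test function plus a multiple of the cutoff `x^{1/2+m} ξ`. Conversely such functions lie in the
domain, since the boundary term of the integration by parts vanishes at `0` for `Re m > -1`. This
yields `generator_hankelGroup`.

For the limit, `e^{-itx²}` replaces the Gaussian parameter `s` by `z = s + 2it`. The modulus of the
Mellin transform changes by a constant of size `|t|^{-1/2}` times `e^{-arg(z/2) τ/2}`, so the part
of the mass on any half-line bounded away from `∓∞` is negligible as `t → ±∞`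
(`tendsto_norm_funcA_expMul`). -/

namespace Moller

/-! ### Bounded multiplication operators on `L²` -/

section Mul

variable {S : Type*} [MeasurableSpace S] {μ : Measure S}

/-- Bounded measurable functions. -/
def BddMeas (φ : S → ℂ) : Prop := Measurable φ ∧ ∃ C : ℝ, ∀ s, ‖φ s‖ ≤ C

theorem BddMeas.mul {φ ψ : S → ℂ} (hφ : BddMeas φ) (hψ : BddMeas ψ) :
    BddMeas (fun s => φ s * ψ s) := by
  obtain ⟨h1, C, hC⟩ := hφ
  obtain ⟨h2, D, hD⟩ := hψ
  refine ⟨h1.mul h2, C * D, fun s => ?_⟩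
  rw [norm_mul]
  exact mul_le_mul (hC s) (hD s) (norm_nonneg _) ((norm_nonneg _).trans (hC s))

theorem BddMeas.const (c : ℂ) : BddMeas (fun _ : S => c) := ⟨measurable_const, ‖c‖, fun _ => le_rfl⟩

theorem BddMeas.sub {φ ψ : S → ℂ} (hφ : BddMeas φ) (hψ : BddMeas ψ) :
    BddMeas (fun s => φ s - ψ s) := by
  obtain ⟨h1, C, hC⟩ := hφ
  obtain ⟨h2, D, hD⟩ := hψ
  exact ⟨h1.sub h2, C + D, fun s => (norm_sub_le _ _).trans (add_le_add (hC s) (hD s))⟩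

theorem BddMeas.memLp {φ : S → ℂ} (hφ : BddMeas φ) {f : S → ℂ} (hf : MemLp f 2 μ) :
    MemLp (fun s => φ s * f s) 2 μ := by
  obtain ⟨h1, C, hC⟩ := hφ
  exact MemLp.mul hf (memLp_top_of_bound h1.aestronglyMeasurable C (ae_of_all _ hC))
    (p := ⊤) (q := 2)

/-- Multiplication by the bounded measurable function `φ` as an operator on `L²`. -/
noncomputable def mulL (μ : Measure S) (φ : S → ℂ) : Lp ℂ 2 μ →L[ℂ] Lp ℂ 2 μ :=
  open Classical in
  if h : BddMeas φ then
    LinearMap.mkContinuousOfExistsBound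
      { toFun := fun f => (h.memLp (Lp.memLp f)).toLp
        map_add' := by
          intro f g
          rw [← MemLp.toLp_add]
          apply MemLp.toLp_congr
          filter_upwards [Lp.coeFn_add f g] with x hx
          simp only [hx, Pi.add_apply, mul_add]
        map_smul' := by
          intro c f
          rw [RingHom.id_apply, ← MemLp.toLp_const_smul]
          apply MemLp.toLp_congr
          filter_upwards [Lp.coeFn_smul c f] with x hx
          simp only [hx, Pi.smul_apply, smul_eq_mul, mul_left_comm] }
      (by
        obtain ⟨C, hC⟩ := h.2
        refine ⟨C, fun f => ?_⟩
        apply Lp.norm_le_mul_norm_of_ae_le_mul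
        filter_upwards [(h.memLp (Lp.memLp f)).coeFn_toLp] with x hx
        simp only [LinearMap.coe_mk, AddHom.coe_mk, hx, norm_mul]
        exact mul_le_mul_of_nonneg_right (hC x) (norm_nonneg _))
  else 0

theorem coeFn_mulL {φ : S → ℂ} (h : BddMeas φ) (f : Lp ℂ 2 μ) :
    mulL μ φ f =ᵐ[μ] fun s => φ s * f s := by
  rw [mulL, dif_pos h]
  exact (h.memLp (Lp.memLp f)).coeFn_toLp

theorem mulL_one : mulL μ (fun _ => 1) = ContinuousLinearMap.id ℂ (Lp ℂ 2 μ) := by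
  ext1 f
  apply Lp.ext
  filter_upwards [coeFn_mulL (μ := μ) (BddMeas.const 1) f] with s hs
  simp [hs]

theorem mulL_mul {φ ψ : S → ℂ} (hφ : BddMeas φ) (hψ : BddMeas ψ) :
    mulL μ (fun s => φ s * ψ s) = (mulL μ φ).comp (mulL μ ψ) := by
  ext1 f
  apply Lp.ext
  filter_upwards [coeFn_mulL (μ := μ) (hφ.mul hψ) f, coeFn_mulL (μ := μ) hφ (mulL μ ψ f),
    coeFn_mulL (μ := μ) hψ f] with s h1 h2 h3
  rw [h1, ContinuousLinearMap.comp_apply, h2, h3, mul_assoc]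

theorem mulL_sub {φ ψ : S → ℂ} (hφ : BddMeas φ) (hψ : BddMeas ψ) :
    mulL μ (fun s => φ s - ψ s) = mulL μ φ - mulL μ ψ := by
  ext1 f
  apply Lp.ext
  filter_upwards [coeFn_mulL (μ := μ) (hφ.sub hψ) f, coeFn_mulL (μ := μ) hφ f,
    coeFn_mulL (μ := μ) hψ f, Lp.coeFn_sub (mulL μ φ f) (mulL μ ψ f)] with s h1 h2 h3 h4
  rw [h1, sub_apply, h4, Pi.sub_apply, h2, h3, sub_mul]

theorem mulL_const (c : ℂ) (f : Lp ℂ 2 μ) : mulL μ (fun _ => c) f = c • f := by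
  apply Lp.ext
  filter_upwards [coeFn_mulL (μ := μ) (BddMeas.const c) f, Lp.coeFn_smul c f] with s h1 h2
  rw [h1, h2, Pi.smul_apply, smul_eq_mul]

/-- Dominated convergence in `L²`. -/
theorem tendsto_L2_of_dominated {ι : Type*} {l : Filter ι} [l.IsCountablyGenerated]
    {F : ι → Lp ℂ 2 μ} {f : Lp ℂ 2 μ} {F' : ι → S → ℂ} {f' : S → ℂ} {g : S → ℝ}
    (hF : ∀ i, F i =ᵐ[μ] F' i) (hf : f =ᵐ[μ] f') (hg : MemLp g 2 μ)
    (hb : ∀ᶠ i in l, ∀ᵐ s ∂μ, ‖F' i s - f' s‖ ≤ g s)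
    (hlim : ∀ᵐ s ∂μ, Tendsto (fun i => F' i s) l (𝓝 (f' s))) :
    Tendsto F l (𝓝 f) := by
  rw [Lp.tendsto_Lp_iff_tendsto_eLpNorm']
  have hd (i) : (F i : S → ℂ) - (f : S → ℂ) =ᵐ[μ] fun s => F' i s - f' s := by
    filter_upwards [hF i, hf] with s h1 h2
    simp [h1, h2]
  have hint : ∫⁻ s, ‖g s‖ₑ ^ (2 : ℝ) ∂μ ≠ ⊤ := by
    have := lintegral_rpow_enorm_lt_top_of_eLpNorm_lt_top (p := 2) (by norm_num) (by norm_num) hg.2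
    simpa using this.ne
  have h0 : Tendsto (fun i => ∫⁻ s, ‖F' i s - f' s‖ₑ ^ (2 : ℝ) ∂μ) l (𝓝 (∫⁻ _, 0 ∂μ)) := by
    refine tendsto_lintegral_filter_of_dominated_convergence' (fun s => ‖g s‖ₑ ^ (2 : ℝ)) ?_ ?_
      hint ?_
    · refine Eventually.of_forall fun i => ?_
      have h1 : AEStronglyMeasurable (fun s => F' i s - f' s) μ :=
        (((Lp.aestronglyMeasurable (F i)).sub (Lp.aestronglyMeasurable f))).congr (hd i)
      exact (h1.enorm).pow_const _
    · filter_upwards [hb] with i hi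
      filter_upwards [hi] with s hs
      gcongr
      rw [enorm_le_iff_norm_le]
      exact hs.trans (le_abs_self _)
    · filter_upwards [hlim] with s hs
      have h1 : Tendsto (fun i => ‖F' i s - f' s‖ₑ ^ (2 : ℝ)) l (𝓝 (‖f' s - f' s‖ₑ ^ (2 : ℝ))) :=
        ((continuous_enorm.tendsto _).comp (hs.sub_const _)).ennrpow_const 2
      simpa using h1
  have e (i) : eLpNorm ((F i : S → ℂ) - (f : S → ℂ)) 2 μ
      = (∫⁻ s, ‖F' i s - f' s‖ₑ ^ (2 : ℝ) ∂μ) ^ (1 / 2 : ℝ) := by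
    rw [eLpNorm_congr_ae (hd i), eLpNorm_eq_lintegral_rpow_enorm_toReal (by norm_num) (by norm_num)]
    simp
  simp_rw [e]
  have := h0.ennrpow_const (1 / 2)
  simpa using this

/-! ### One-parameter groups of multiplication operators -/

/-- Multiplication by `e^{ita}`. -/
noncomputable def expMul (μ : Measure S) (a : S → ℝ) (t : ℝ) : Lp ℂ 2 μ →L[ℂ] Lp ℂ 2 μ :=
  mulL μ fun s => Complex.exp (Complex.I * t * a s)

theorem norm_exp_I_mul (t x : ℝ) : ‖Complex.exp (Complex.I * t * x)‖ = 1 := by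
  rw [mul_assoc, mul_comm, ← Complex.ofReal_mul, Complex.norm_exp_ofReal_mul_I]

theorem bddMeas_exp {a : S → ℝ} (ha : Measurable a) (t : ℝ) :
    BddMeas fun s => Complex.exp (Complex.I * t * a s) :=
  ⟨by fun_prop, 1, fun s => (norm_exp_I_mul t (a s)).le⟩

theorem isOneParameterGroup_expMul {a : S → ℝ} (ha : Measurable a) :
    IsOneParameterGroup (expMul μ a) where
  zero := by
    rw [expMul, ← mulL_one]
    congr 1
    ext s
    simp
  add s t := by
    rw [expMul, expMul, expMul, ← mulL_mul (bddMeas_exp ha s) (bddMeas_exp ha t)]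
    congr 1
    ext x
    rw [← Complex.exp_add]
    congr 1
    push_cast
    ring
  continuous f := by
    rw [continuous_iff_continuousAt]
    intro t
    refine tendsto_L2_of_dominated (F' := fun t s => Complex.exp (Complex.I * t * a s) * f s)
      (f' := fun s => Complex.exp (Complex.I * t * a s) * f s) (g := fun s => 2 * ‖f s‖)
      (fun t => coeFn_mulL (bddMeas_exp ha t) f) (coeFn_mulL (bddMeas_exp ha t) f)
      ((Lp.memLp f).norm.const_mul 2) (Eventually.of_forall fun u => ae_of_all _ fun s => ?_)
      (ae_of_all _ fun s => ?_)
    · refine (norm_sub_le _ _).trans ?_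
      rw [norm_mul, norm_mul, norm_exp_I_mul, norm_exp_I_mul]
      linarith
    · have : Continuous fun u : ℝ => Complex.exp (Complex.I * u * a s) * f s := by fun_prop
      exact this.tendsto t

theorem norm_exp_I_sub_one_le (t x : ℝ) : ‖Complex.exp (Complex.I * t * x) - 1‖ ≤ |t| * |x| := by
  have h := Real.norm_exp_I_mul_ofReal_sub_one_le (x := t * x)
  rw [Real.norm_eq_abs, abs_mul] at h
  convert h using 4
  push_cast
  ring

/-- An `L²` limit of the difference quotients has a subsequence converging almost everywhere, and
the pointwise limit is `i a f`. Conversely `|e^{ita} - 1| ≤ |t| |a|` dominates the quotients by `|a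
f| = |g|`, so the maximal multiplication operator is obtained with no further domain condition. -/
theorem mem_generatorGraph_expMul {a : S → ℝ} (ha : Measurable a) (f g : Lp ℂ 2 μ) :
    (f, g) ∈ generatorGraph (expMul μ a) ↔ g =ᵐ[μ] fun s => (a s : ℂ) * f s := by
  have hq (t : ℝ) : ((t : ℂ)⁻¹ • (expMul μ a t f - f) : Lp ℂ 2 μ) =ᵐ[μ]
      fun s => (t : ℂ)⁻¹ * (Complex.exp (Complex.I * t * a s) - 1) * f s := by
    filter_upwards [Lp.coeFn_smul (t : ℂ)⁻¹ (expMul μ a t f - f),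
      Lp.coeFn_sub (expMul μ a t f) f, coeFn_mulL (bddMeas_exp ha t) f] with s h1 h2 h3
    rw [h1, Pi.smul_apply, h2, Pi.sub_apply, expMul, h3, smul_eq_mul]
    ring
  have hI : (Complex.I • g : Lp ℂ 2 μ) =ᵐ[μ] fun s => Complex.I * g s := Lp.coeFn_smul _ _
  have hlim (s : S) : Tendsto (fun t : ℝ => (t : ℂ)⁻¹ * (Complex.exp (Complex.I * t * a s) - 1)
      * f s) (𝓝[≠] 0) (𝓝 (Complex.I * (a s * f s))) := by
    have h1 : HasDerivAt (fun t : ℝ => Complex.exp (Complex.I * t * a s))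
        (Complex.exp (Complex.I * (0 : ℝ) * a s) * (Complex.I * 1 * a s)) 0 := by
      apply HasDerivAt.cexp
      exact ((HasDerivAt.ofReal_comp (hasDerivAt_id (0 : ℝ))).const_mul _).mul_const _
    have h2 := h1.tendsto_slope_zero
    simp only [zero_add, Complex.ofReal_zero, mul_zero, zero_mul, Complex.exp_zero, one_mul,
      mul_one] at h2
    rw [← mul_assoc]
    refine (h2.mul_const (f s)).congr fun t => ?_
    simp
  constructor
  · intro h
    have h1 := (tendstoInMeasure_of_tendsto_Lp h).exists_seq_tendsto_ae'
    obtain ⟨ns, hns, hae⟩ := h1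
    have h2 : ∀ᵐ s ∂μ, ∀ n, ((((ns n : ℝ) : ℂ)⁻¹ • (expMul μ a (ns n) f - f) : Lp ℂ 2 μ)) s
        = ((ns n : ℝ) : ℂ)⁻¹ * (Complex.exp (Complex.I * (ns n : ℝ) * a s) - 1) * f s :=
      ae_all_iff.2 fun n => hq (ns n)
    filter_upwards [h2, hae, hI] with s h3 h4 h5
    have h6 := ((hlim s).comp hns).congr fun n => (h3 n).symm
    have h7 := tendsto_nhds_unique h4 h6
    rw [h5] at h7
    exact mul_left_cancel₀ Complex.I_ne_zero h7
  · intro h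
    have hI' : (Complex.I • g : Lp ℂ 2 μ) =ᵐ[μ] fun s => Complex.I * (a s * f s) := by
      filter_upwards [hI, h] with s h1 h2
      rw [h1, h2]
    refine tendsto_L2_of_dominated (g := fun s => 2 * ‖g s‖) hq hI' ((Lp.memLp g).norm.const_mul 2)
      ?_ (ae_of_all _ hlim)
    filter_upwards [self_mem_nhdsWithin] with t ht
    filter_upwards [h] with s hs
    refine (norm_sub_le _ _).trans ?_
    rw [hs]
    have h1 : ‖(t : ℂ)⁻¹ * (Complex.exp (Complex.I * t * a s) - 1) * f s‖ ≤ ‖(a s : ℂ) * f s‖ := by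
      rw [norm_mul, norm_mul, norm_mul]
      refine mul_le_mul_of_nonneg_right ?_ (norm_nonneg _)
      rw [norm_inv, inv_mul_le_iff₀ (by simpa using ht)]
      simpa using norm_exp_I_sub_one_le t (a s)
    have h2 : ‖Complex.I * (a s * f s)‖ = ‖(a s : ℂ) * f s‖ := by simp
    linarith

end Mul

/-! ### Conjugation of one-parameter groups -/

section Conj

variable {E F : Type*} [NormedAddCommGroup E] [NormedSpace ℂ E] [NormedAddCommGroup F]
  [NormedSpace ℂ F]

/-- The group `e⁻¹ U e`. -/
noncomputable def conjGroup (e : E ≃L[ℂ] F) (U : ℝ → F →L[ℂ] F) (t : ℝ) : E →L[ℂ] E :=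
  (e.symm : F →L[ℂ] E).comp ((U t).comp (e : E →L[ℂ] F))

theorem conjGroup_apply (e : E ≃L[ℂ] F) (U : ℝ → F →L[ℂ] F) (t : ℝ) (f : E) :
    conjGroup e U t f = e.symm (U t (e f)) := rfl

theorem IsOneParameterGroup.conj {U : ℝ → F →L[ℂ] F} (hU : IsOneParameterGroup U) (e : E ≃L[ℂ] F) :
    IsOneParameterGroup (conjGroup e U) where
  zero := by
    ext1 f
    simp [conjGroup_apply, hU.zero]
  add s t := by
    ext1 f
    simp [conjGroup_apply, hU.add]
  continuous f := e.symm.continuous.comp (hU.continuous (e f))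

theorem mem_generatorGraph_conjGroup (e : E ≃L[ℂ] F) (U : ℝ → F →L[ℂ] F) (f g : E) :
    (f, g) ∈ generatorGraph (conjGroup e U) ↔ (e f, e g) ∈ generatorGraph U := by
  have h1 (t : ℝ) : e ((t : ℂ)⁻¹ • (conjGroup e U t f - f)) = (t : ℂ)⁻¹ • (U t (e f) - e f) := by
    simp [conjGroup_apply]
  constructor
  · intro h
    have h2 := (e.continuous.tendsto _).comp h
    rw [map_smul] at h2
    exact h2.congr h1
  · intro h
    have h2 := (e.symm.continuous.tendsto _).comp h
    rw [map_smul, e.symm_apply_apply] at h2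
    refine h2.congr fun t => ?_
    simp only [Function.comp_apply]
    rw [← h1, e.symm_apply_apply]

end Conj

/-! ### Asymptotics of quotients of Gamma functions -/

section Gamma

/-- Both arguments lie in `]-π/2, π/2[`, so their difference stays inside the principal branch. This
lets the logarithms in `gammaTerm` telescope exactly, without multiples of `2πi`. -/
theorem log_one_add_inv {z : ℂ} (hz : 0 < z.re) :
    Complex.log (1 + 1 / z) = Complex.log (z + 1) - Complex.log z := by
  have hz0 : z ≠ 0 := by rintro rfl; simp at hz
  have hz1 : z + 1 ≠ 0 := by
    intro h
    have := congrArg Complex.re h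
    simp at this
    linarith
  have h1 : |z.arg| < Real.pi / 2 := Complex.abs_arg_lt_pi_div_two_iff.2 (Or.inl hz)
  have h2 : |(z + 1).arg| < Real.pi / 2 :=
    Complex.abs_arg_lt_pi_div_two_iff.2 (Or.inl (by simp; linarith))
  have h3 : z.arg ≠ Real.pi := by
    intro h
    rw [h, abs_of_pos Real.pi_pos] at h1
    linarith [Real.pi_pos]
  have e : 1 + 1 / z = (z + 1) * z⁻¹ := by field_simp
  rw [e, (Complex.log_mul_eq_add_log_iff hz1 (inv_ne_zero hz0)).2, Complex.log_inv _ h3,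
    sub_eq_add_neg]
  rw [Complex.arg_inv, if_neg h3]
  rw [abs_lt] at h1 h2
  constructor <;> linarith

theorem sq_add_sq_le_norm_add_natCast_sq {z : ℂ} (hz : 0 < z.re) (j : ℕ) :
    ‖z‖ ^ 2 + (j : ℝ) ^ 2 ≤ ‖z + j‖ ^ 2 := by
  rw [← Complex.normSq_eq_norm_sq, ← Complex.normSq_eq_norm_sq, Complex.normSq_apply,
    Complex.normSq_apply]
  simp only [Complex.add_re, Complex.natCast_re, Complex.add_im, Complex.natCast_im, add_zero]
  nlinarith [mul_nonneg hz.le (Nat.cast_nonneg (α := ℝ) j)]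

/-- The logarithm of the `j`-th factor of the product for `Γ(z + c) / (Γ(z) z^c)`. -/
noncomputable def gammaTerm (c z : ℂ) (j : ℕ) : ℂ :=
  c * Complex.log (1 + 1 / (z + j)) - Complex.log (1 + c / (z + j))

theorem norm_le_norm_add_natCast {z : ℂ} (hz : 0 < z.re) (j : ℕ) : ‖z‖ ≤ ‖z + j‖ := by
  have := sq_add_sq_le_norm_add_natCast_sq hz j
  exact le_of_sq_le_sq (by nlinarith [sq_nonneg (j : ℝ)]) (norm_nonneg _)

theorem norm_log_one_add_sub_le {w : ℂ} (hw : ‖w‖ ≤ 1 / 2) :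
    ‖Complex.log (1 + w) - w‖ ≤ ‖w‖ ^ 2 := by
  refine (Complex.norm_log_one_add_sub_self_le (by linarith)).trans ?_
  have h : (1 - ‖w‖)⁻¹ ≤ 2 := by
    rw [inv_le_comm₀ (by linarith) (by norm_num)]
    linarith
  nlinarith [mul_le_mul_of_nonneg_left h (sq_nonneg ‖w‖)]

/-- The linear parts of the two logarithms cancel and leave an error of second order in `1/(z + j)`.
The hypotheses on `‖z‖` keep both arguments in the disc of radius `1/2`. Keeping `‖z‖²` in the bound
provides both the summability in `j` and the decay as `‖z‖ → ∞`. -/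
theorem norm_gammaTerm_le {c z : ℂ} (hz : 0 < z.re) (h1 : 2 ≤ ‖z‖) (hc : 2 * ‖c‖ ≤ ‖z‖) (j : ℕ) :
    ‖gammaTerm c z j‖ ≤ (‖c‖ + ‖c‖ ^ 2) * (‖z‖ ^ 2 + (j : ℝ) ^ 2)⁻¹ := by
  have hj := norm_le_norm_add_natCast hz j
  have hpos : 0 < ‖z + j‖ := by linarith
  have hw : ‖1 / (z + j)‖ ≤ 1 / 2 := by
    rw [norm_div, norm_one]
    exact one_div_le_one_div_of_le (by norm_num) (h1.trans hj)
  have hw2 : ‖c / (z + j)‖ ≤ 1 / 2 := by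
    rw [norm_div, div_le_iff₀ hpos]
    linarith
  have e : gammaTerm c z j = c * (Complex.log (1 + 1 / (z + j)) - 1 / (z + j))
      - (Complex.log (1 + c / (z + j)) - c / (z + j)) := by
    rw [gammaTerm]
    ring
  have hsq := sq_add_sq_le_norm_add_natCast_sq hz j
  have hpos2 : 0 < ‖z‖ ^ 2 + (j : ℝ) ^ 2 := by positivity
  calc ‖gammaTerm c z j‖ ≤ ‖c‖ * ‖1 / (z + j)‖ ^ 2 + ‖c / (z + j)‖ ^ 2 := by
        rw [e]
        refine (norm_sub_le _ _).trans (add_le_add ?_ (norm_log_one_add_sub_le hw2))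
        rw [norm_mul]
        exact mul_le_mul_of_nonneg_left (norm_log_one_add_sub_le hw) (norm_nonneg _)
    _ = (‖c‖ + ‖c‖ ^ 2) * (‖z + j‖ ^ 2)⁻¹ := by
        rw [norm_div, norm_div, norm_one]
        field_simp
    _ ≤ _ := by gcongr

theorem summable_inv_sq_add_sq {r : ℝ} (hr : 1 ≤ r) :
    Summable fun j : ℕ => (r ^ 2 + (j : ℝ) ^ 2)⁻¹ := by
  have h : Summable fun j : ℕ => (((j + 1 : ℕ) : ℝ) ^ 2)⁻¹ :=
    (summable_nat_add_iff 1).2 (Real.summable_nat_pow_inv.2 one_lt_two)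
  refine Summable.of_nonneg_of_le (fun j => by positivity) (fun j => ?_) (h.mul_left 2)
  rw [← div_eq_mul_inv, inv_eq_one_div, div_le_div_iff₀ (by positivity) (by positivity)]
  push_cast
  nlinarith [sq_nonneg ((j : ℝ) - 1)]

/-- Quotient of two of Euler's limit formulas: the factors become `(1 + c/(z+j))⁻¹`, and the
telescoping sum of the terms `c log(1 + 1/(z+j))` supplies the power that makes the product converge
absolutely. -/
theorem Gamma_add_div_Gamma_mul_exp {c z : ℂ} (hz : 0 < z.re) (h1 : 2 ≤ ‖z‖)
    (hc : 2 * ‖c‖ ≤ ‖z‖) :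
    Complex.Gamma (z + c) / Complex.Gamma z * Complex.exp (-(c * Complex.log z))
      = Complex.exp (∑' j, gammaTerm c z j) := by
  have hsum : Summable (gammaTerm c z) :=
    Summable.of_norm_bounded ((summable_inv_sq_add_sq (by linarith)).mul_left _)
      (norm_gammaTerm_le hz h1 hc)
  have hne (j : ℕ) : z + j ≠ 0 := by
    have := norm_le_norm_add_natCast hz j
    intro h
    rw [h, norm_zero] at this
    linarith
  have hne2 (j : ℕ) : 1 + c / (z + j) ≠ 0 := by
    have h2 := norm_le_norm_add_natCast hz j
    intro h
    have h3 : c / (z + j) = -1 := by linear_combination h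
    have h4 : ‖c / (z + j)‖ = 1 := by rw [h3]; simp
    rw [norm_div, div_eq_one_iff_eq (by linarith)] at h4
    linarith
  have htel (n : ℕ) : ∑ j ∈ Finset.range n, Complex.log (1 + 1 / (z + j))
      = Complex.log (z + n) - Complex.log z := by
    induction n with
    | zero => simp
    | succ n ih =>
      rw [Finset.sum_range_succ, ih, log_one_add_inv (by simp; positivity)]
      push_cast
      rw [← add_assoc]
      ring
  have hexp (n : ℕ) : Complex.exp (∑ j ∈ Finset.range n, gammaTerm c z j)
      = Complex.exp (c * (Complex.log (z + n) - Complex.log z)) *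
        ∏ j ∈ Finset.range n, (1 + c / (z + j))⁻¹ := by
    simp only [gammaTerm]
    rw [Finset.sum_sub_distrib, ← Finset.mul_sum, htel, Complex.exp_sub, Complex.exp_sum,
      div_eq_mul_inv, ← Finset.prod_inv_distrib]
    congr 1
    exact Finset.prod_congr rfl fun j _ => by rw [Complex.exp_log (hne2 j)]
  have hseq (n : ℕ) (hn : n ≠ 0) : Complex.GammaSeq (z + c) n / Complex.GammaSeq z n
      = (n : ℂ) ^ c * ∏ j ∈ Finset.range (n + 1), (1 + c / (z + j))⁻¹ := by
    have hn' : (n : ℂ) ≠ 0 := Nat.cast_ne_zero.2 hn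
    have e : ∏ j ∈ Finset.range (n + 1), (z + c + j)
        = (∏ j ∈ Finset.range (n + 1), (z + j)) * ∏ j ∈ Finset.range (n + 1), (1 + c / (z + j)) := by
      rw [← Finset.prod_mul_distrib]
      refine Finset.prod_congr rfl fun j _ => ?_
      have := hne j
      field_simp
      ring
    have hp1 : ∏ j ∈ Finset.range (n + 1), (z + j) ≠ 0 := Finset.prod_ne_zero_iff.2 fun j _ => hne j
    have hp2 : ∏ j ∈ Finset.range (n + 1), (1 + c / (z + j)) ≠ 0 :=
      Finset.prod_ne_zero_iff.2 fun j _ => hne2 j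
    have hf : (n.factorial : ℂ) ≠ 0 := Nat.cast_ne_zero.2 n.factorial_ne_zero
    have hz' : (n : ℂ) ^ z ≠ 0 := by rw [Complex.cpow_def_of_ne_zero hn']; exact Complex.exp_ne_zero _
    rw [Complex.GammaSeq, Complex.GammaSeq, e, Complex.cpow_add _ _ hn', Finset.prod_inv_distrib]
    field_simp
  -- Euler's formula contributes `n^c`, while the telescoping sum ends at `(z + n + 1)^c`. The ratio
  -- tends to `1`.
  have hbr : Tendsto (fun n : ℕ => (n : ℂ) ^ c * Complex.exp (-(c * Complex.log (z + (n + 1 : ℕ)))))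
      atTop (𝓝 1) := by
    have hl : Tendsto (fun n : ℕ => Complex.log (1 + (z + 1) * (n : ℂ)⁻¹)) atTop (𝓝 0) := by
      have h3 : Tendsto (fun n : ℕ => 1 + (z + 1) * (n : ℂ)⁻¹) atTop (𝓝 1) := by
        have h4 := (tendsto_inv_atTop_nhds_zero_nat (𝕜 := ℂ)).const_mul (z + 1)
        simpa using h4.const_add 1
      have := h3.clog (by simp)
      simpa using this
    have h5 : Tendsto (fun n : ℕ => Complex.exp (-(c * Complex.log (1 + (z + 1) * (n : ℂ)⁻¹))))
        atTop (𝓝 1) := by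
      have := ((hl.const_mul c).neg).cexp
      simpa using this
    refine h5.congr' ?_
    filter_upwards [eventually_ne_atTop 0] with n hn
    have hn' : (n : ℂ) ≠ 0 := Nat.cast_ne_zero.2 hn
    have e : z + (n + 1 : ℕ) = ((n : ℝ) : ℂ) * (1 + (z + 1) * (n : ℂ)⁻¹) := by
      push_cast
      field_simp
      ring
    have hne3 : 1 + (z + 1) * (n : ℂ)⁻¹ ≠ 0 := by
      intro h
      rw [h, mul_zero] at e
      exact hne (n + 1) e
    rw [e, Complex.log_ofReal_mul (by positivity) hne3, Complex.cpow_def_of_ne_zero hn',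
      ← Complex.exp_add]
    congr 1
    rw [Complex.ofReal_log (by positivity)]
    push_cast
    ring
  have hl1 : Tendsto (fun n : ℕ => Complex.exp (∑ j ∈ Finset.range (n + 1), gammaTerm c z j) *
      ((n : ℂ) ^ c * Complex.exp (-(c * Complex.log (z + (n + 1 : ℕ)))))) atTop
      (𝓝 (Complex.exp (∑' j, gammaTerm c z j))) := by
    have h3 := (hsum.hasSum.tendsto_sum_nat.comp (tendsto_add_atTop_nat 1)).cexp.mul hbr
    simpa using h3
  have hl2 : Tendsto (fun n : ℕ => Complex.GammaSeq (z + c) n / Complex.GammaSeq z n *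
      Complex.exp (-(c * Complex.log z))) atTop (𝓝 (Complex.Gamma (z + c) / Complex.Gamma z *
      Complex.exp (-(c * Complex.log z)))) :=
    ((Complex.GammaSeq_tendsto_Gamma _).div (Complex.GammaSeq_tendsto_Gamma _)
      (Complex.Gamma_ne_zero_of_re_pos hz)).mul_const _
  refine tendsto_nhds_unique hl2 (hl1.congr' ?_)
  filter_upwards [eventually_ne_atTop 0] with n hn
  rw [hseq n hn, hexp]
  have e1 : Complex.exp (c * (Complex.log (z + (n + 1 : ℕ)) - Complex.log z)) *
      Complex.exp (-(c * Complex.log (z + (n + 1 : ℕ)))) = Complex.exp (-(c * Complex.log z)) := by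
    rw [← Complex.exp_add]
    congr 1
    ring
  linear_combination (n : ℂ) ^ c * (∏ j ∈ Finset.range (n + 1), (1 + c / (z + j))⁻¹) * e1

/-- This is `Γ(z + c) ~ Γ(z) z^c` as `|z| → ∞` in the open right half-plane. Every term of the
exponent tends to `0` under a common summable bound. No distance from the imaginary directions is
required, so vertical lines are allowed. -/
theorem tendsto_Gamma_add_div_Gamma {ι : Type*} {l : Filter ι} {z : ι → ℂ}
    (hre : ∀ᶠ i in l, 0 < (z i).re) (hn : Tendsto (fun i => ‖z i‖) l atTop) (c : ℂ) :
    Tendsto (fun i => Complex.Gamma (z i + c) / Complex.Gamma (z i) *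
      Complex.exp (-(c * Complex.log (z i)))) l (𝓝 1) := by
  have hb : Tendsto (fun i => ∑' j, gammaTerm c (z i) j) l (𝓝 (∑' _ : ℕ, (0 : ℂ))) := by
    refine tendsto_tsum_of_dominated_convergence
      (bound := fun j : ℕ => (‖c‖ + ‖c‖ ^ 2) * ((1 : ℝ) ^ 2 + (j : ℝ) ^ 2)⁻¹)
      ((summable_inv_sq_add_sq le_rfl).mul_left _) (fun j => ?_) ?_
    · have h2 : Tendsto (fun i => (‖c‖ + ‖c‖ ^ 2) * (‖z i‖ ^ 2 + (j : ℝ) ^ 2)⁻¹) l (𝓝 0) := by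
        have h3 : Tendsto (fun i => ‖z i‖ ^ 2 + (j : ℝ) ^ 2) l atTop :=
          tendsto_atTop_add_const_right _ _ ((tendsto_pow_atTop two_ne_zero).comp hn)
        simpa using h3.inv_tendsto_atTop.const_mul (‖c‖ + ‖c‖ ^ 2)
      refine squeeze_zero_norm' ?_ h2
      filter_upwards [hre, hn.eventually_ge_atTop 2, hn.eventually_ge_atTop (2 * ‖c‖)] with i h4 h5 h6
      exact norm_gammaTerm_le h4 h5 h6 j
    · filter_upwards [hre, hn.eventually_ge_atTop 2, hn.eventually_ge_atTop (2 * ‖c‖)]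
        with i h4 h5 h6 j
      refine (norm_gammaTerm_le h4 h5 h6 j).trans ?_
      gcongr
      linarith
  rw [tsum_zero] at hb
  have h7 := hb.cexp
  rw [Complex.exp_zero] at h7
  refine h7.congr' ?_
  filter_upwards [hre, hn.eventually_ge_atTop 2, hn.eventually_ge_atTop (2 * ‖c‖)] with i h4 h5 h6
  rw [Gamma_add_div_Gamma_mul_exp h4 h5 h6]

end Gamma

/-! ### The function `Ξ_m` -/

section Xi

theorem add_one_add_I_mul_re (m : ℂ) (t : ℝ) : ((m + 1 + Complex.I * t) / 2).re = (m.re + 1) / 2 := by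
  simp

theorem add_one_sub_I_mul_re (m : ℂ) (t : ℝ) : ((m + 1 - Complex.I * t) / 2).re = (m.re + 1) / 2 := by
  simp

theorem Gamma_add_ne_zero {m : ℂ} (hm : -1 < m.re) (t : ℝ) :
    Complex.Gamma ((m + 1 + Complex.I * t) / 2) ≠ 0 :=
  Complex.Gamma_ne_zero_of_re_pos (by rw [add_one_add_I_mul_re]; linarith)

theorem Gamma_sub_ne_zero {m : ℂ} (hm : -1 < m.re) (t : ℝ) :
    Complex.Gamma ((m + 1 - Complex.I * t) / 2) ≠ 0 :=
  Complex.Gamma_ne_zero_of_re_pos (by rw [add_one_sub_I_mul_re]; linarith)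

theorem Xi_ne_zero {m : ℂ} (hm : -1 < m.re) (t : ℝ) : Xi m t ≠ 0 :=
  mul_ne_zero (Complex.exp_ne_zero _) (div_ne_zero (Gamma_add_ne_zero hm t) (Gamma_sub_ne_zero hm t))

/-- Reflection swaps the two Gamma factors. Hence the Hankel transformation is an involution, and
bounds and limits at `+∞` transfer to the inverse at `-∞`. -/
theorem Xi_neg {m : ℂ} (t : ℝ) : Xi m (-t) = (Xi m t)⁻¹ := by
  rw [Xi, Xi, mul_inv, ← Complex.exp_neg, inv_div]
  congr 2
  · push_cast; ring
  · push_cast; ring_nf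
  · push_cast; ring_nf

theorem continuous_Gamma_comp {z : ℝ → ℂ} (hz : Continuous z) (h : ∀ t, 0 < (z t).re) :
    Continuous fun t => Complex.Gamma (z t) := by
  rw [continuous_iff_continuousAt]
  intro t
  refine ContinuousAt.comp (g := Complex.Gamma)
    (Complex.differentiableAt_Gamma _ fun n hn => ?_).continuousAt hz.continuousAt
  have := h t
  rw [hn] at this
  simp at this
  linarith [Nat.cast_nonneg (α := ℝ) n]

theorem continuous_Xi {m : ℂ} (hm : -1 < m.re) : Continuous (Xi m) := by
  unfold Xi
  refine Continuous.mul (by fun_prop) (Continuous.div ?_ ?_ (Gamma_sub_ne_zero hm))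
  · exact continuous_Gamma_comp (by fun_prop) fun t => by rw [add_one_add_I_mul_re]; linarith
  · exact continuous_Gamma_comp (by fun_prop) fun t => by rw [add_one_sub_I_mul_re]; linarith

theorem norm_Xi_ofReal {r : ℝ} (hr : -1 < r) (t : ℝ) : ‖Xi r t‖ = 1 := by
  have h1 : Complex.Gamma (((r : ℂ) + 1 - Complex.I * t) / 2)
      = (starRingEnd ℂ) (Complex.Gamma (((r : ℂ) + 1 + Complex.I * t) / 2)) := by
    rw [← Complex.Gamma_conj]
    congr 1
    simp [sub_eq_add_neg, map_ofNat]
  have h2 := Gamma_add_ne_zero (m := r) (by simpa using hr) t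
  rw [Xi, h1, norm_mul, norm_div, RCLike.norm_conj, div_self (by simpa using h2), mul_one,
    mul_assoc, mul_comm, ← Complex.ofReal_mul, Complex.norm_exp_ofReal_mul_I]

/-- Dividing out the common positive factor `t/2` leaves arguments tending to `i` and `-i`, both off
the branch cut; their logarithms are `±iπ/2`. -/
theorem tendsto_log_sub_log (p q : ℂ) :
    Tendsto (fun t : ℝ => Complex.log ((p + 1 + Complex.I * t) / 2)
      - Complex.log ((q + 1 - Complex.I * t) / 2)) atTop (𝓝 (Complex.I * Real.pi)) := by
  have hz : Tendsto (fun t : ℝ => ((t⁻¹ : ℝ) : ℂ)) atTop (𝓝 ((0 : ℝ) : ℂ)) :=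
    (Complex.continuous_ofReal.tendsto 0).comp tendsto_inv_atTop_zero
  have h1 : Tendsto (fun t : ℝ => Complex.log (Complex.I + (p + 1) * ((t⁻¹ : ℝ) : ℂ))) atTop
      (𝓝 (Complex.log Complex.I)) := by
    have := ((hz.const_mul (p + 1)).const_add Complex.I)
    rw [Complex.ofReal_zero, mul_zero, add_zero] at this
    exact this.clog (by simp [Complex.mem_slitPlane_iff])
  have h2 : Tendsto (fun t : ℝ => Complex.log (-Complex.I + (q + 1) * ((t⁻¹ : ℝ) : ℂ))) atTop
      (𝓝 (Complex.log (-Complex.I))) := by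
    have := ((hz.const_mul (q + 1)).const_add (-Complex.I))
    rw [Complex.ofReal_zero, mul_zero, add_zero] at this
    exact this.clog (by simp [Complex.mem_slitPlane_iff])
  have h3 := h1.sub h2
  rw [Complex.log_I, Complex.log_neg_I] at h3
  rw [show (Real.pi : ℂ) / 2 * Complex.I - -(Real.pi / 2 : ℂ) * Complex.I
      = Complex.I * Real.pi by ring] at h3
  refine h3.congr' ?_
  have a1 : ∀ᶠ t : ℝ in atTop, Complex.I + (p + 1) * ((t⁻¹ : ℝ) : ℂ) ≠ 0 := by
    have := ((hz.const_mul (p + 1)).const_add Complex.I)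
    exact this.eventually_ne (by simp)
  have a2 : ∀ᶠ t : ℝ in atTop, -Complex.I + (q + 1) * ((t⁻¹ : ℝ) : ℂ) ≠ 0 := by
    have := ((hz.const_mul (q + 1)).const_add (-Complex.I))
    exact this.eventually_ne (by simp)
  filter_upwards [a1, a2, eventually_gt_atTop 0] with t h4 h5 ht
  have ht' : (t : ℂ) ≠ 0 := by exact_mod_cast ht.ne'
  have e1 : (p + 1 + Complex.I * t) / 2
      = ((t / 2 : ℝ) : ℂ) * (Complex.I + (p + 1) * ((t⁻¹ : ℝ) : ℂ)) := by
    push_cast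
    field_simp
    ring
  have e2 : (q + 1 - Complex.I * t) / 2
      = ((t / 2 : ℝ) : ℂ) * (-Complex.I + (q + 1) * ((t⁻¹ : ℝ) : ℂ)) := by
    push_cast
    field_simp
    ring
  rw [e1, e2, Complex.log_ofReal_mul (by positivity) h4, Complex.log_ofReal_mul (by positivity) h5]
  ring

theorem tendsto_norm_atTop_of_im {z : ℝ → ℂ} (h : Tendsto (fun t => |(z t).im|) atTop atTop) :
    Tendsto (fun t => ‖z t‖) atTop atTop :=
  tendsto_atTop_mono (fun t => Complex.abs_im_le_norm (z t)) h

/-- With `c = (k-m)/2`, `z = (m+1+it)/2` and `w = (k+1-it)/2`, the quotient is `Γ(z+c)/Γ(z) ·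
Γ(w-c)/Γ(w) ~ z^c w^{-c}`. Numerators and denominators are paired so that only the difference of
arguments of `z` and `w`, which tends to `π`, survives. -/
theorem tendsto_Xi_div_Xi_atTop {m k : ℂ} (hm : -1 < m.re) (hk : -1 < k.re) :
    Tendsto (fun t => Xi k t / Xi m t) atTop
      (𝓝 (Complex.exp ((k - m) / 2 * (Complex.I * Real.pi)))) := by
  have him (p : ℝ) (s : ℝ) (hs : |s| = 1) : Tendsto (fun t : ℝ => |(p + s * t) / 2|) atTop atTop := by
    have h1 : Tendsto (fun t : ℝ => (t - |p|) / 2) atTop atTop :=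
      (tendsto_atTop_add_const_right _ _ tendsto_id).atTop_div_const two_pos
    refine tendsto_atTop_mono' _ ?_ h1
    filter_upwards [eventually_ge_atTop 0] with t ht
    rw [abs_div, abs_two]
    have h2 := abs_sub_abs_le_abs_sub (s * t) (-p)
    rw [abs_mul, hs, one_mul, abs_of_nonneg ht, abs_neg, sub_neg_eq_add, add_comm (s * t)] at h2
    linarith
  have h1 := tendsto_Gamma_add_div_Gamma (l := atTop) (z := fun t : ℝ => (m + 1 + Complex.I * t) / 2)
    (Eventually.of_forall fun t => by rw [add_one_add_I_mul_re]; linarith)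
    (tendsto_norm_atTop_of_im (by simpa using him m.im 1 (by simp))) ((k - m) / 2)
  have h2 := tendsto_Gamma_add_div_Gamma (l := atTop) (z := fun t : ℝ => (k + 1 - Complex.I * t) / 2)
    (Eventually.of_forall fun t => by rw [add_one_sub_I_mul_re]; linarith)
    (tendsto_norm_atTop_of_im (by simpa [sub_eq_add_neg] using him k.im (-1) (by simp)))
    (-((k - m) / 2))
  have h3 := ((tendsto_log_sub_log m k).const_mul ((k - m) / 2)).cexp
  have h4 := (h1.mul h2).mul h3
  rw [one_mul, one_mul] at h4
  refine h4.congr fun t => ?_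
  have e1 : (m + 1 + Complex.I * t) / 2 + (k - m) / 2 = (k + 1 + Complex.I * t) / 2 := by ring
  have e2 : (k + 1 - Complex.I * t) / 2 + -((k - m) / 2) = (m + 1 - Complex.I * t) / 2 := by ring
  rw [e1, e2, Xi, Xi]
  have e3 : Complex.exp (-((k - m) / 2 * Complex.log ((m + 1 + Complex.I * t) / 2))) *
      Complex.exp (-(-((k - m) / 2) * Complex.log ((k + 1 - Complex.I * t) / 2))) *
      Complex.exp ((k - m) / 2 * (Complex.log ((m + 1 + Complex.I * t) / 2)
      - Complex.log ((k + 1 - Complex.I * t) / 2))) = 1 := by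
    rw [← Complex.exp_add, ← Complex.exp_add, Complex.exp_eq_one_iff]
    exact ⟨0, by push_cast; ring⟩
  have g1 := Gamma_add_ne_zero hm t
  have g2 := Gamma_sub_ne_zero hm t
  have g3 := Gamma_sub_ne_zero hk t
  have g4 := Complex.exp_ne_zero (Complex.I * (Real.log 2 : ℂ) * t)
  rw [mul_div_mul_left _ _ g4, div_div_div_eq]
  calc _ = (Complex.Gamma ((k + 1 + Complex.I * t) / 2) / Complex.Gamma ((m + 1 + Complex.I * t) / 2))
      * (Complex.Gamma ((m + 1 - Complex.I * t) / 2) / Complex.Gamma ((k + 1 - Complex.I * t) / 2))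
      * (Complex.exp (-((k - m) / 2 * Complex.log ((m + 1 + Complex.I * t) / 2))) *
      Complex.exp (-(-((k - m) / 2) * Complex.log ((k + 1 - Complex.I * t) / 2))) *
      Complex.exp ((k - m) / 2 * (Complex.log ((m + 1 + Complex.I * t) / 2)
      - Complex.log ((k + 1 - Complex.I * t) / 2)))) := by ring
    _ = _ := by
      rw [e3]
      field_simp

theorem tendsto_Xi_div_Xi_atBot {m k : ℂ} (hm : -1 < m.re) (hk : -1 < k.re) :
    Tendsto (fun t => Xi k t / Xi m t) atBot
      (𝓝 (Complex.exp (-((k - m) / 2 * (Complex.I * Real.pi))))) := by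
  have h := ((tendsto_Xi_div_Xi_atTop hm hk).inv₀ (Complex.exp_ne_zero _)).comp
    tendsto_neg_atBot_atTop
  rw [← Complex.exp_neg] at h
  refine h.congr fun t => ?_
  simp only [Function.comp_apply]
  rw [Xi_neg, Xi_neg, inv_div_inv, inv_div]

theorem exists_norm_le_of_tendsto {φ : ℝ → ℂ} (hφ : Continuous φ) {a b : ℂ}
    (h1 : Tendsto φ atTop (𝓝 a)) (h2 : Tendsto φ atBot (𝓝 b)) : ∃ C : ℝ, ∀ t, ‖φ t‖ ≤ C := by
  obtain ⟨T, hT⟩ := eventually_atTop.1 (h1.norm.eventually_lt_const (lt_add_one ‖a‖))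
  obtain ⟨T', hT'⟩ := eventually_atBot.1 (h2.norm.eventually_lt_const (lt_add_one ‖b‖))
  obtain ⟨C, hC⟩ := (isCompact_Icc (a := T') (b := T)).exists_bound_of_continuousOn
    hφ.continuousOn
  refine ⟨max C (max (‖a‖ + 1) (‖b‖ + 1)), fun t => ?_⟩
  rcases le_total t T' with h | h
  · exact (hT' t h).le.trans ((le_max_right _ _).trans (le_max_right _ _))
  rcases le_total T t with h' | h'
  · exact (hT t h').le.trans ((le_max_left _ _).trans (le_max_right _ _))
  · exact (hC t ⟨h, h'⟩).trans (le_max_left _ _)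

theorem bddMeas_Xi_div_Xi {m k : ℂ} (hm : -1 < m.re) (hk : -1 < k.re) :
    BddMeas fun t => Xi k t / Xi m t := by
  have hc := (continuous_Xi hk).div (continuous_Xi hm) (Xi_ne_zero hm)
  exact ⟨hc.measurable, exists_norm_le_of_tendsto hc (tendsto_Xi_div_Xi_atTop hm hk)
    (tendsto_Xi_div_Xi_atBot hm hk)⟩

/-- Comparison with `Ξ_{Re m}`, which has modulus one: the ratio is continuous and has limits at
both ends. -/
theorem bddMeas_Xi {m : ℂ} (hm : -1 < m.re) : BddMeas (Xi m) := by
  have hr : -1 < (m.re : ℂ).re := by simpa using hm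
  have h1 : BddMeas (Xi m.re) :=
    ⟨(continuous_Xi hr).measurable, 1, fun t => (norm_Xi_ofReal hm t).le⟩
  convert (bddMeas_Xi_div_Xi hr hm).mul h1 using 2 with t
  rw [div_mul_cancel₀ _ (Xi_ne_zero hr t)]

theorem bddMeas_Xi_inv {m : ℂ} (hm : -1 < m.re) : BddMeas fun t => (Xi m t)⁻¹ := by
  obtain ⟨h1, C, hC⟩ := bddMeas_Xi hm
  exact ⟨h1.inv, C, fun t => by simpa only [Xi_neg] using hC (-t)⟩

end Xi

/-! ### The logarithmic change of variables -/

section LogChange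

theorem quasiMeasurePreserving_exp :
    Measure.QuasiMeasurePreserving Real.exp volume halfLine := by
  refine ⟨Real.measurable_exp, ?_⟩
  refine Measure.AbsolutelyContinuous.mk fun s hs h0 => ?_
  rw [Measure.map_apply Real.measurable_exp hs]
  rw [halfLine, Measure.restrict_apply hs] at h0
  have h1 : Real.exp ⁻¹' s ⊆ Real.log '' (s ∩ Set.Ioi 0) := fun x hx =>
    ⟨Real.exp x, ⟨hx, Real.exp_pos x⟩, Real.log_exp x⟩
  refine measure_mono_null h1 (addHaar_image_eq_zero_of_differentiableOn_of_addHaar_eq_zero _ ?_ h0)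
  intro x hx
  exact (Real.differentiableAt_log (ne_of_gt hx.2)).differentiableWithinAt

theorem quasiMeasurePreserving_log :
    Measure.QuasiMeasurePreserving Real.log halfLine volume := by
  refine ⟨Real.measurable_log, ?_⟩
  refine Measure.AbsolutelyContinuous.mk fun s hs h0 => ?_
  rw [Measure.map_apply Real.measurable_log hs, halfLine,
    Measure.restrict_apply (Real.measurable_log hs)]
  have h1 : Real.log ⁻¹' s ∩ Set.Ioi 0 ⊆ Real.exp '' s := fun x hx =>
    ⟨Real.log x, hx.1, Real.exp_log hx.2⟩
  exact measure_mono_null h1 (addHaar_image_eq_zero_of_differentiableOn_of_addHaar_eq_zero _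
    Real.differentiable_exp.differentiableOn h0)

theorem lintegral_halfLine_eq (F : ℝ → ENNReal) :
    ∫⁻ x, F x ∂halfLine = ∫⁻ u, ENNReal.ofReal (Real.exp u) * F (Real.exp u) := by
  have h := lintegral_image_eq_lintegral_abs_deriv_mul (f := Real.exp) (f' := Real.exp)
    MeasurableSet.univ (fun x _ => (Real.hasDerivAt_exp x).hasDerivWithinAt)
    Real.exp_injective.injOn F
  rw [Set.image_univ, Real.range_exp, Measure.restrict_univ] at h
  simpa only [Real.abs_exp] using h

theorem integral_halfLine_eq (F : ℝ → ℂ) :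
    ∫ x, F x ∂halfLine = ∫ u, (Real.exp u : ℂ) * F (Real.exp u) := by
  have h := integral_image_eq_integral_abs_deriv_smul (f := Real.exp) (f' := Real.exp)
    MeasurableSet.univ (fun x _ => (Real.hasDerivAt_exp x).hasDerivWithinAt)
    Real.exp_injective.injOn F
  rw [Set.image_univ, Real.range_exp, Measure.restrict_univ] at h
  simpa only [Real.abs_exp, Complex.real_smul] using h

/-- `u ↦ e^{u/2} f(e^u)`. -/
noncomputable def logPull (f : ℝ → ℂ) (u : ℝ) : ℂ := (Real.exp (u / 2) : ℂ) * f (Real.exp u)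

theorem eLpNorm_logPull (f : ℝ → ℂ) : eLpNorm (logPull f) 2 volume = eLpNorm f 2 halfLine := by
  rw [eLpNorm_eq_lintegral_rpow_enorm_toReal (by norm_num) (by norm_num),
    eLpNorm_eq_lintegral_rpow_enorm_toReal (by norm_num) (by norm_num), lintegral_halfLine_eq]
  congr 2
  ext u
  have h : ‖(Real.exp (u / 2) : ℂ)‖ₑ = ENNReal.ofReal (Real.exp (u / 2)) := by
    rw [← ofReal_norm, Complex.norm_real, Real.norm_eq_abs, Real.abs_exp]
  rw [logPull, enorm_mul, h, ENNReal.mul_rpow_of_nonneg _ _ (by simp),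
    ENNReal.ofReal_rpow_of_pos (Real.exp_pos _), ← Real.exp_mul]
  simp

theorem memLp_logPull {f : ℝ → ℂ} (hf : MemLp f 2 halfLine) : MemLp (logPull f) 2 volume := by
  refine ⟨?_, by rw [eLpNorm_logPull]; exact hf.2⟩
  refine AEStronglyMeasurable.mul (Continuous.aestronglyMeasurable (by fun_prop)) ?_
  exact hf.1.comp_quasiMeasurePreserving quasiMeasurePreserving_exp

theorem logPull_congr {f g : ℝ → ℂ} (h : f =ᵐ[halfLine] g) : logPull f =ᵐ[volume] logPull g := by
  filter_upwards [quasiMeasurePreserving_exp.ae h] with u hu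
  rw [logPull, logPull, hu]

/-- The unitary `L²[0,∞[ → L²(ℝ)`, `f ↦ e^{u/2} f(e^u)`, as an isometry. -/
noncomputable def logIsometry : L2 →ₗᵢ[ℂ] Lp ℂ 2 (volume : Measure ℝ) where
  toFun f := (memLp_logPull (Lp.memLp f)).toLp
  map_add' f g := by
    rw [← MemLp.toLp_add]
    apply MemLp.toLp_congr
    refine (logPull_congr (Lp.coeFn_add f g)).trans (ae_of_all _ fun u => ?_)
    simp [logPull, mul_add]
  map_smul' c f := by
    rw [RingHom.id_apply, ← MemLp.toLp_const_smul]
    apply MemLp.toLp_congr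
    refine (logPull_congr (Lp.coeFn_smul c f)).trans (ae_of_all _ fun u => ?_)
    simp [logPull, mul_left_comm]
  norm_map' f := by
    rw [LinearMap.coe_mk, AddHom.coe_mk, Lp.norm_toLp, eLpNorm_logPull, Lp.norm_def]

theorem coeFn_logIsometry {f : L2} {f' : ℝ → ℂ} (h : f =ᵐ[halfLine] f') :
    logIsometry f =ᵐ[volume] logPull f' :=
  ((memLp_logPull (Lp.memLp f)).coeFn_toLp).trans (logPull_congr h)

theorem logIsometry_surjective : Function.Surjective logIsometry := by
  intro g
  set f : ℝ → ℂ := fun x => (Real.exp (-(Real.log x / 2)) : ℂ) * g (Real.log x) with hf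
  have e (u : ℝ) : logPull f u = g u := by
    rw [logPull, hf]
    simp only [Real.log_exp]
    rw [← mul_assoc, ← Complex.ofReal_mul, ← Real.exp_add]
    simp
  have hm : MemLp f 2 halfLine := by
    refine ⟨?_, ?_⟩
    · refine AEStronglyMeasurable.mul ?_ ?_
      · exact (by fun_prop : Measurable fun x => (Real.exp (-(Real.log x / 2)) : ℂ)).aestronglyMeasurable
      · exact (Lp.aestronglyMeasurable g).comp_quasiMeasurePreserving quasiMeasurePreserving_log
    · rw [← eLpNorm_logPull, funext e]
      exact (Lp.memLp g).2
  refine ⟨hm.toLp, Lp.ext ?_⟩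
  refine (coeFn_logIsometry hm.coeFn_toLp).trans (ae_of_all _ e)

/-- The Mellin transformation: the unitary `L²[0,∞[ → L²(ℝ)` given by
`(W f)(ξ) = ∫ x^{-1/2-2πiξ} f(x) dx`. -/
noncomputable def mellinL2 : L2 ≃ₗᵢ[ℂ] Lp ℂ 2 (volume : Measure ℝ) :=
  (LinearIsometryEquiv.ofSurjective logIsometry logIsometry_surjective).trans
    (Lp.fourierTransformₗᵢ ℝ ℂ)

end LogChange

/-! ### The `L²` Fourier transform of integrable functions -/

section Fourier

open FourierTransform SchwartzMap

/-- Both transforms satisfy the same transfer formula against Schwartz functions, one as a tempered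
distribution and the other by Fubini. Testing with smooth compactly supported functions gives
equality almost everywhere. -/
theorem fourier_coeFn_of_integrable (f : Lp ℂ 2 (volume : Measure ℝ)) (hf : Integrable f) :
    (𝓕 f : Lp ℂ 2 (volume : Measure ℝ)) =ᵐ[volume] 𝓕 (f : ℝ → ℂ) := by
  have hc : Continuous (𝓕 (f : ℝ → ℂ)) :=
    VectorFourier.fourierIntegral_continuous Real.continuous_fourierChar continuous_inner hf
  have h1 : LocallyIntegrable (fun x => (𝓕 f : Lp ℂ 2 (volume : Measure ℝ)) x - 𝓕 (f : ℝ → ℂ) x) :=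
    ((Lp.memLp _).locallyIntegrable (by norm_num)).sub hc.locallyIntegrable
  have h2 := ae_eq_zero_of_integral_contDiff_smul_eq_zero h1 (by
    intro g hg hgc
    have hgc' : HasCompactSupport fun x => (g x : ℂ) :=
      hgc.comp_left (g := Complex.ofReal) (by simp)
    set G : 𝓢(ℝ, ℂ) := hgc'.toSchwartzMap (Complex.ofRealCLM.contDiff.comp hg) with hG
    have hGx (x : ℝ) : G x = (g x : ℂ) := rfl
    have e1 : ∫ x, G x * (𝓕 f : Lp ℂ 2 (volume : Measure ℝ)) x = ∫ x, (𝓕 G) x * f x := by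
      have h := congrArg (fun T : 𝓢'(ℝ, ℂ) => T G) (Lp.fourier_toTemperedDistribution_eq f)
      simp only [TemperedDistribution.fourier_apply, Lp.toTemperedDistribution_apply,
        smul_eq_mul] at h
      exact h.symm
    have e2 : ∫ x, 𝓕 (f : ℝ → ℂ) x * G x = ∫ x, f x * (𝓕 G) x := by
      have h := VectorFourier.integral_fourierIntegral_smul_eq_flip (μ := volume) (ν := volume)
        (L := innerₗ ℝ) Real.continuous_fourierChar continuous_inner hf G.integrable
      rw [flip_innerₗ] at h
      simp only [smul_eq_mul] at h
      rw [SchwartzMap.fourier_coe]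
      exact h
    have i1 : Integrable fun x => G x * (𝓕 f : Lp ℂ 2 (volume : Measure ℝ)) x :=
      MemLp.integrable_mul (p := 2) (q := 2) (G.memLp 2) (Lp.memLp _)
    have i2 : Integrable fun x => 𝓕 (f : ℝ → ℂ) x * G x := by
      have h : Integrable fun x => G x * 𝓕 (f : ℝ → ℂ) x :=
        G.integrable.mul_bdd (c := ∫ v, ‖f v‖) hc.aestronglyMeasurable (ae_of_all _ fun x =>
          VectorFourier.norm_fourierIntegral_le_integral_norm _ _ _ _ _)
      exact h.congr (ae_of_all _ fun x => mul_comm _ _)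
    calc _ = ∫ x, (G x * (𝓕 f : Lp ℂ 2 (volume : Measure ℝ)) x - 𝓕 (f : ℝ → ℂ) x * G x) := by
          refine integral_congr_ae (ae_of_all _ fun x => ?_)
          simp only [Complex.real_smul, hGx]
          ring
      _ = 0 := by
          rw [integral_sub i1 i2, e1, e2]
          simp only [mul_comm, sub_self])
  filter_upwards [h2] with x hx using sub_eq_zero.1 hx

theorem coeFn_mellinL2 {f : L2} {f' : ℝ → ℂ} (h : f =ᵐ[halfLine] f')
    (hi : Integrable (logPull f') volume) :
    mellinL2 f =ᵐ[volume] 𝓕 (logPull f') := by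
  have h1 := coeFn_logIsometry h
  have h2 := fourier_coeFn_of_integrable (logIsometry f) (hi.congr h1.symm)
  refine EventuallyEq.trans h2 (ae_of_all _ fun ξ => ?_)
  simp only [Real.fourier_eq]
  refine integral_congr_ae ?_
  filter_upwards [h1] with u hu
  rw [hu]

end Fourier

/-! ### Uniqueness for Gaussian moments -/

section Laplace

/-- The substitution `y = e^{-x²/2}` inverts to `x = √(-2 log y)`. As `y → 0` the new argument
leaves the support of `φ`, so the composite extends continuously to `y = 0` and Weierstrass
approximation applies on `[0, 1]`. -/
theorem continuousOn_comp_sqrt_log {φ : ℝ → ℝ} (hφ : Continuous φ) (hs : HasCompactSupport φ)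
    (h0 : φ 0 = 0) : Continuous fun y => φ (√(-2 * Real.log y)) := by
  rw [continuous_iff_continuousAt]
  intro y
  rcases eq_or_ne y 0 with rfl | hy
  · have h1 : Tendsto (fun y : ℝ => √(-2 * Real.log y)) (𝓝[≠] 0) atTop :=
      Real.tendsto_sqrt_atTop.comp
        (Real.tendsto_log_nhdsNE_zero.const_mul_atBot_of_neg (by norm_num))
    have h2 : ∀ᶠ x in atTop, φ x = 0 := by
      have h := hasCompactSupport_iff_eventuallyEq.1 hs
      rw [coclosedCompact_eq_cocompact] at h
      exact atTop_le_cocompact h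
    have h3 : ∀ᶠ y in 𝓝[≠] (0 : ℝ), φ (√(-2 * Real.log y)) = 0 := h1.eventually h2
    rw [eventually_nhdsWithin_iff] at h3
    refine (continuousAt_const (y := (0 : ℝ))).congr ?_
    filter_upwards [h3] with y hy
    rcases eq_or_ne y 0 with rfl | h
    -- At `y = 0` the convention `log 0 = 0` gives the value `φ 0`, which must agree with the limit
    -- `0`.
    · simp [h0]
    · exact (hy h).symm
  · exact hφ.continuousAt.comp (Real.continuous_sqrt.continuousAt.comp
      (continuousAt_const.mul (Real.continuousAt_log hy)))

/-- A function all of whose Gaussian moments vanish is zero. -/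
theorem ae_eq_zero_of_integral_gaussian {h : ℝ → ℂ}
    (hi : ∀ s : ℝ, 0 < s → Integrable (fun x => h x * Complex.exp (-(s * x ^ 2 / 2))) halfLine)
    (h0 : ∀ s : ℝ, 0 < s → ∫ x, h x * Complex.exp (-(s * x ^ 2 / 2)) ∂halfLine = 0) :
    h =ᵐ[halfLine] 0 := by
  -- One Gaussian factor is set aside to have an integrable weight. The moments with `s = n + 1` are
  -- then moments of `p` against powers of `e^{-x²/2}`, so only integer parameters are needed.
  set p : ℝ → ℂ := fun x => h x * Complex.exp (-((1 : ℝ) * x ^ 2 / 2)) with hp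
  have hpi : Integrable p halfLine := hi 1 one_pos
  have hE (x : ℝ) : Real.exp (-(x ^ 2 / 2)) ∈ Set.Icc (0 : ℝ) 1 :=
    ⟨(Real.exp_pos _).le, Real.exp_le_one_iff.2 (by nlinarith [sq_nonneg x])⟩
  have hmono (n : ℕ) (x : ℝ) : p x * ((Real.exp (-(x ^ 2 / 2)) ^ n : ℝ) : ℂ)
      = h x * Complex.exp (-(((n + 1 : ℝ) : ℝ) * x ^ 2 / 2)) := by
    rw [hp]
    simp only
    rw [← Real.exp_nat_mul, mul_assoc, Complex.ofReal_exp, ← Complex.exp_add]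
    congr 2
    push_cast
    ring
  have hpoly (q : Polynomial ℝ) :
      Integrable (fun x => p x * ((q.eval (Real.exp (-(x ^ 2 / 2))) : ℝ) : ℂ)) halfLine ∧
      ∫ x, p x * ((q.eval (Real.exp (-(x ^ 2 / 2))) : ℝ) : ℂ) ∂halfLine = 0 := by
    induction q using Polynomial.induction_on' with
    | add q r hq hr =>
      simp only [Polynomial.eval_add, Complex.ofReal_add, mul_add]
      exact ⟨hq.1.add hr.1, by rw [integral_add hq.1 hr.1, hq.2, hr.2, add_zero]⟩
    | monomial n a =>
      have e (x : ℝ) : p x * (((Polynomial.monomial n a).eval (Real.exp (-(x ^ 2 / 2))) : ℝ) : ℂ)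
          = a * (h x * Complex.exp (-(((n + 1 : ℝ) : ℝ) * x ^ 2 / 2))) := by
        rw [← hmono, Polynomial.eval_monomial]
        push_cast
        ring
      simp only [e]
      exact ⟨(hi _ (by positivity)).const_mul _, by
        rw [integral_const_mul, h0 _ (by positivity), mul_zero]⟩
  have hloc : LocallyIntegrableOn p (Set.Ioi 0) :=
    locallyIntegrableOn_of_locallyIntegrable_restrict hpi.locallyIntegrable
  have hz := isOpen_Ioi.ae_eq_zero_of_integral_contDiff_smul_eq_zero hloc (by
    intro φ h1 h2 h3
    have hφ0 : φ 0 = 0 := image_eq_zero_of_notMem_tsupport fun h => lt_irrefl (0 : ℝ) (h3 h)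
    have hcont := continuousOn_comp_sqrt_log h1.continuous h2 hφ0
    have hrec (x : ℝ) (hx : 0 < x) : φ (√(-2 * Real.log (Real.exp (-(x ^ 2 / 2))))) = φ x := by
      rw [Real.log_exp]
      congr 1
      rw [show -2 * -(x ^ 2 / 2) = x ^ 2 by ring, Real.sqrt_sq hx.le]
    have hint : Integrable (fun x => p x * (φ x : ℂ)) halfLine := by
      obtain ⟨C, hC⟩ := h2.exists_bound_of_continuous h1.continuous
      refine hpi.mul_bdd (c := C) (by
        have := h1.continuous
        fun_prop) (ae_of_all _ fun x => ?_)
      simpa using hC x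
    have key : ∫ x, p x * (φ x : ℂ) ∂halfLine = 0 := by
      by_contra hne
      have hpos : 0 < ‖∫ x, p x * (φ x : ℂ) ∂halfLine‖ := norm_pos_iff.2 hne
      set M := ∫ x, ‖p x‖ ∂halfLine with hM
      have hM0 : 0 ≤ M := integral_nonneg fun _ => norm_nonneg _
      -- With this tolerance the integral `I` satisfies `‖I‖ ≤ M ‖I‖ / (M + 1)`, which is impossible
      -- for `I ≠ 0`.
      obtain ⟨q, hq⟩ := exists_polynomial_near_of_continuousOn 0 1 _ hcont.continuousOn
        (‖∫ x, p x * (φ x : ℂ) ∂halfLine‖ / (M + 1)) (by positivity)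
      have e : ∫ x, p x * (φ x : ℂ) ∂halfLine = ∫ x, (p x * (φ x : ℂ)
          - p x * ((q.eval (Real.exp (-(x ^ 2 / 2))) : ℝ) : ℂ)) ∂halfLine := by
        rw [integral_sub hint (hpoly q).1, (hpoly q).2, sub_zero]
      have hle : ‖∫ x, p x * (φ x : ℂ) ∂halfLine‖ ≤
          ∫ x, ‖p x‖ * (‖∫ x, p x * (φ x : ℂ) ∂halfLine‖ / (M + 1)) ∂halfLine := by
        conv_lhs => rw [e]
        refine norm_integral_le_of_norm_le (hpi.norm.mul_const _) ?_
        filter_upwards [ae_restrict_mem measurableSet_Ioi] with x hx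
        rw [← mul_sub, norm_mul]
        refine mul_le_mul_of_nonneg_left ?_ (norm_nonneg _)
        have h5 := hq _ (hE x)
        rw [hrec x hx, abs_sub_comm] at h5
        rw [← Complex.ofReal_sub, Complex.norm_real, Real.norm_eq_abs]
        exact h5.le
      rw [integral_mul_const, ← hM, mul_div_assoc', le_div_iff₀ (by positivity)] at hle
      nlinarith
    rw [← setIntegral_eq_integral_of_forall_compl_eq_zero (s := Set.Ioi (0 : ℝ)), ← key]
    · exact integral_congr_ae (ae_of_all _ fun x => by simp [mul_comm])
    · intro x hx
      rw [image_eq_zero_of_notMem_tsupport fun h => hx (h3 h), zero_smul])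
  have hz' := (ae_restrict_iff' measurableSet_Ioi).2 hz
  filter_upwards [hz'] with x hx
  exact (mul_eq_zero.1 hx).resolve_right (Complex.exp_ne_zero _)

/-- A vector `h` orthogonal to the family has `h · conj q` with vanishing Gaussian moments, hence `h
= 0` as `q` has no zeros. The free weight `q` allows the reuse for `(x² + i) x^{1/2+m}` in the core
argument. -/
theorem dense_span_gaussian {F : ℝ → L2} {q : ℝ → ℂ} (hq : ∀ x, 0 < x → q x ≠ 0)
    (hF : ∀ s, 0 < s → F s =ᵐ[halfLine] fun x => q x * Complex.exp (-(s * x ^ 2 / 2))) :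
    Dense (Submodule.span ℂ (F '' Set.Ioi 0) : Set L2) := by
  rw [Submodule.dense_iff_topologicalClosure_eq_top, Submodule.topologicalClosure_eq_top_iff,
    Submodule.eq_bot_iff]
  intro h hh
  have e (s : ℝ) (hs : 0 < s) : (fun x => h x * (starRingEnd ℂ) (F s x)) =ᵐ[halfLine]
      fun x => (h x * (starRingEnd ℂ) (q x)) * Complex.exp (-(s * x ^ 2 / 2)) := by
    filter_upwards [hF s hs] with x hx
    rw [hx, map_mul, ← Complex.exp_conj, mul_assoc]
    simp [map_ofNat]
  have hz := ae_eq_zero_of_integral_gaussian (h := fun x => h x * (starRingEnd ℂ) (q x))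
    (fun s hs => by
      refine (L2.integrable_inner (𝕜 := ℂ) (F s) h).congr ?_
      filter_upwards [e s hs] with x hx
      rw [← hx, RCLike.inner_apply]) (fun s hs => by
      have h1 := (Submodule.mem_orthogonal _ _).1 hh (F s)
        (Submodule.subset_span ⟨s, hs, rfl⟩)
      rw [L2.inner_def] at h1
      rw [← h1]
      refine integral_congr_ae ?_
      filter_upwards [e s hs] with x hx
      rw [← hx, RCLike.inner_apply])
  apply Lp.ext
  filter_upwards [hz, Lp.coeFn_zero ℂ 2 halfLine, ae_restrict_mem measurableSet_Ioi] with x h1 h2 h3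
  rw [h2]
  exact (mul_eq_zero.1 h1).resolve_right (by simpa using hq x h3)

end Laplace

/-! ### The Gamma integral with a complex rate -/

section GammaIntegral

theorem norm_cpow_mul_exp (a r : ℂ) {t : ℝ} (ht : 0 < t) :
    ‖(t : ℂ) ^ a * Complex.exp (-(r * t))‖ = t ^ a.re * Real.exp (-(r.re * t)) := by
  rw [norm_mul, Complex.norm_cpow_eq_rpow_re_of_pos ht, Complex.norm_exp]
  simp

theorem measurable_cpow_mul_exp (a r : ℂ) :
    Measurable fun t : ℝ => (t : ℂ) ^ a * Complex.exp (-(r * t)) :=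
  (Complex.measurable_ofReal.pow_const a).mul (by fun_prop)

theorem integrable_cpow_mul_exp {a r : ℂ} (ha : -1 < a.re) (hr : 0 < r.re) :
    Integrable (fun t : ℝ => (t : ℂ) ^ a * Complex.exp (-(r * t))) halfLine := by
  have h := integrableOn_rpow_mul_exp_neg_mul_rpow (p := 1) (s := a.re) (b := r.re) ha one_pos hr
  refine Integrable.mono' h (measurable_cpow_mul_exp a r).aestronglyMeasurable ?_
  filter_upwards [ae_restrict_mem measurableSet_Ioi] with t ht
  rw [norm_cpow_mul_exp a r ht, Real.rpow_one, neg_mul]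

theorem integral_halfLine_eq_zero_of_hasDerivAt {f f' : ℝ → ℂ}
    (hd : ∀ x, 0 < x → HasDerivAt f (f' x) x) (hi : Integrable f' halfLine)
    (h0 : Tendsto f (𝓝[>] 0) (𝓝 0)) (h1 : Tendsto f atTop (𝓝 0)) :
    ∫ x, f' x ∂halfLine = 0 := by
  -- The value `f 0` carries no information, only the limit from the right is known. Redefining it
  -- as `0` gives the continuity required by the fundamental theorem of calculus.
  have hne (x : ℝ) (hx : 0 < x) : Function.update f 0 0 =ᶠ[𝓝 x] f := by
    filter_upwards [isOpen_ne.mem_nhds hx.ne'] with y hy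
    rw [Function.update_of_ne hy]
  have h := integral_Ioi_of_hasDerivAt_of_tendsto (f := Function.update f 0 0) (f' := f')
    (a := (0 : ℝ)) (m := 0) ?_ (fun x hx => (hd x hx).congr_of_eventuallyEq (hne x hx)) hi ?_
  · simpa using h
  · rw [← continuousWithinAt_Ioi_iff_Ici, ContinuousWithinAt, Function.update_self]
    refine h0.congr' ?_
    filter_upwards [self_mem_nhdsWithin] with y hy
    rw [Function.update_of_ne (ne_of_gt hy)]
  · refine h1.congr' ?_
    filter_upwards [eventually_gt_atTop 0] with y hy
    rw [Function.update_of_ne hy.ne']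

theorem hasDerivAt_ofReal_cpow (a : ℂ) {t : ℝ} (ht : 0 < t) :
    HasDerivAt (fun t : ℝ => (t : ℂ) ^ a) (a * (t : ℂ) ^ (a - 1)) t := by
  have := (hasDerivAt_id (t : ℂ)).cpow_const (c := a) (Or.inl (by simpa using ht))
  simpa using this.comp_ofReal

/-- Integration by parts; the boundary terms vanish since `Re a > 0` and `Re r > 0`. -/
theorem mul_integral_cpow_mul_exp {a r : ℂ} (ha : 0 < a.re) (hr : 0 < r.re) :
    a * ∫ t : ℝ in Set.Ioi 0, (t : ℂ) ^ (a - 1) * Complex.exp (-(r * t))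
      = r * ∫ t : ℝ in Set.Ioi 0, (t : ℂ) ^ a * Complex.exp (-(r * t)) := by
  have h1 := integrable_cpow_mul_exp (a := a - 1) (r := r) (by simpa using ha) hr
  have h2 := integrable_cpow_mul_exp (a := a) (r := r) (by linarith) hr
  have hd (t : ℝ) (ht : t ∈ Set.Ioi (0 : ℝ)) :
      HasDerivAt (fun t : ℝ => (t : ℂ) ^ a * Complex.exp (-(r * t)))
        (a * ((t : ℂ) ^ (a - 1) * Complex.exp (-(r * t)))
          - r * ((t : ℂ) ^ a * Complex.exp (-(r * t)))) t := by
    have e2 : HasDerivAt (fun t : ℝ => Complex.exp (-(r * t))) (Complex.exp (-(r * t)) * -(r * 1)) t :=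
      ((((hasDerivAt_id t).ofReal_comp).const_mul r).neg).cexp
    exact ((hasDerivAt_ofReal_cpow a ht).mul e2).congr_deriv (by ring)
  have hnorm : (fun t : ℝ => t ^ a.re * Real.exp (-(r.re * t))) =ᶠ[𝓝[>] 0]
      fun t : ℝ => ‖(t : ℂ) ^ a * Complex.exp (-(r * t))‖ := by
    filter_upwards [self_mem_nhdsWithin] with t ht
    rw [norm_cpow_mul_exp a r ht]
  have l0 : Tendsto (fun t : ℝ => (t : ℂ) ^ a * Complex.exp (-(r * t))) (𝓝[>] 0) (𝓝 0) := by
    rw [tendsto_zero_iff_norm_tendsto_zero]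
    refine Tendsto.congr' hnorm ?_
    have h3 : ContinuousAt (fun t : ℝ => t ^ a.re * Real.exp (-(r.re * t))) 0 :=
      (Real.continuousAt_rpow_const _ _ (Or.inr ha.le)).mul (by fun_prop)
    have h4 := h3.tendsto.mono_left (nhdsWithin_le_nhds (s := Set.Ioi 0))
    simpa [Real.zero_rpow ha.ne'] using h4
  have l1 : Tendsto (fun t : ℝ => (t : ℂ) ^ a * Complex.exp (-(r * t))) atTop (𝓝 0) := by
    rw [tendsto_zero_iff_norm_tendsto_zero]
    refine (tendsto_rpow_mul_exp_neg_mul_atTop_nhds_zero a.re r.re hr).congr' ?_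
    filter_upwards [eventually_gt_atTop 0] with t ht
    rw [norm_cpow_mul_exp a r ht, neg_mul]
  have h := integral_halfLine_eq_zero_of_hasDerivAt hd ((h1.const_mul a).sub (h2.const_mul r)) l0 l1
  rw [integral_sub (h1.const_mul a) (h2.const_mul r), integral_const_mul, integral_const_mul] at h
  exact sub_eq_zero.1 h

theorem hasDerivAt_integral_cpow_mul_exp {a r : ℂ} (ha : 0 < a.re) (hr : 0 < r.re) :
    HasDerivAt (fun r : ℂ => ∫ t : ℝ in Set.Ioi 0, (t : ℂ) ^ (a - 1) * Complex.exp (-(r * t)))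
      (∫ t : ℝ in Set.Ioi 0, -((t : ℂ) ^ a * Complex.exp (-(r * t)))) r := by
  have hb := (integrable_cpow_mul_exp (a := a) (r := ((r.re / 2 : ℝ) : ℂ)) (by linarith)
    (by simpa using hr)).norm
  refine (hasDerivAt_integral_of_dominated_loc_of_deriv_le (𝕜 := ℂ)
    (F := fun (r : ℂ) (t : ℝ) => (t : ℂ) ^ (a - 1) * Complex.exp (-(r * t)))
    (F' := fun (r : ℂ) (t : ℝ) => -((t : ℂ) ^ a * Complex.exp (-(r * t))))
    (s := {z : ℂ | r.re / 2 < z.re})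
    ((isOpen_lt continuous_const Complex.continuous_re).mem_nhds (by simpa using hr))
    (Eventually.of_forall fun r => (measurable_cpow_mul_exp _ r).aestronglyMeasurable)
    (integrable_cpow_mul_exp (by simpa using ha) hr)
    (measurable_cpow_mul_exp _ r).neg.aestronglyMeasurable ?_ hb ?_).2
  · filter_upwards [ae_restrict_mem measurableSet_Ioi] with t ht z hz
    rw [norm_neg, norm_cpow_mul_exp _ _ ht, norm_cpow_mul_exp _ _ ht, Complex.ofReal_re]
    have ht' : 0 < t := ht
    have hz' : r.re / 2 < z.re := hz
    gcongr
  · filter_upwards [ae_restrict_mem measurableSet_Ioi] with t ht z hz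
    have ht0 : (t : ℂ) ≠ 0 := by exact_mod_cast ne_of_gt ht
    have e2 : HasDerivAt (fun z : ℂ => Complex.exp (-(z * t))) (Complex.exp (-(z * t)) * -(1 * t)) z :=
      ((((hasDerivAt_id z)).mul_const (t : ℂ)).neg).cexp
    refine (e2.const_mul ((t : ℂ) ^ (a - 1))).congr_deriv ?_
    have e3 : (t : ℂ) ^ a = (t : ℂ) ^ (a - 1) * t := by
      rw [Complex.cpow_sub _ _ ht0, Complex.cpow_one, div_mul_cancel₀ _ ht0]
    rw [e3]
    ring

/-- By `mul_integral_cpow_mul_exp` the function `r^a G(r)` has derivative zero on the right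
half-plane, so it equals its value `Γ(a)` at `r = 1`. Complex rates are what the oscillating
Gaussians `e^{-itx²} e^{-sx²/2}` require. -/
theorem integral_cpow_mul_exp {a r : ℂ} (ha : 0 < a.re) (hr : 0 < r.re) :
    ∫ t : ℝ in Set.Ioi 0, (t : ℂ) ^ (a - 1) * Complex.exp (-(r * t))
      = r ^ (-a) * Complex.Gamma a := by
  set G : ℂ → ℂ := fun r => ∫ t : ℝ in Set.Ioi 0, (t : ℂ) ^ (a - 1) * Complex.exp (-(r * t)) with hG
  have hd (z : ℂ) (hz : 0 < z.re) : HasDerivAt (fun z => z ^ a * G z) 0 z := by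
    have hz0 : z ≠ 0 := by rintro rfl; simp at hz
    have e1 : HasDerivAt (fun z : ℂ => z ^ a) (a * z ^ (a - 1)) z := by
      have := (hasDerivAt_id z).cpow_const (c := a) (Or.inl hz)
      simpa using this
    refine (e1.mul (hasDerivAt_integral_cpow_mul_exp ha hz)).congr_deriv ?_
    have h := mul_integral_cpow_mul_exp ha hz
    rw [integral_neg, Complex.cpow_sub _ _ hz0, Complex.cpow_one]
    field_simp
    linear_combination z ^ a * h
  have hconst : r ^ a * G r = (1 : ℂ) ^ a * G 1 := by
    refine (isOpen_lt continuous_const Complex.continuous_re).is_const_of_deriv_eq_zero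
      (s := {z : ℂ | 0 < z.re}) (convex_halfSpace_re_gt 0).isPreconnected
      (fun z hz => (hd z hz).differentiableAt.differentiableWithinAt)
      (fun z hz => (hd z hz).deriv) hr (by simp)
  have h1 : G 1 = Complex.Gamma a := by
    have h := Complex.integral_cpow_mul_exp_neg_mul_Ioi ha one_pos
    rw [Complex.ofReal_one, div_one, Complex.one_cpow, one_mul] at h
    exact h
  have hr0 : r ≠ 0 := by rintro rfl; simp at hr
  rw [Complex.one_cpow, one_mul, h1] at hconst
  rw [Complex.cpow_neg, ← hconst, inv_mul_cancel_left₀]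
  rw [Complex.cpow_def_of_ne_zero hr0]
  exact Complex.exp_ne_zero _

/-- The Mellin transform of a Gaussian. -/
theorem integral_cpow_mul_gaussian {a z : ℂ} (ha : -1 < a.re) (hz : 0 < z.re) :
    ∫ x : ℝ in Set.Ioi 0, (x : ℂ) ^ a * Complex.exp (-(z * x ^ 2 / 2))
      = 1 / 2 * (z / 2) ^ (-((a + 1) / 2)) * Complex.Gamma ((a + 1) / 2) := by
  have ha' : 0 < ((a + 1) / 2).re := by simp; linarith
  have h := integral_cpow_mul_exp ha' (r := z / 2) (by simpa using hz)
  -- Substitution `t = x²`, which turns the exponent `(a+1)/2 - 1` into `a` after the Jacobian `2x`.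
  rw [← integral_comp_rpow_Ioi _ two_ne_zero] at h
  rw [mul_assoc, ← h, ← integral_const_mul]
  refine setIntegral_congr_fun measurableSet_Ioi fun x hx => ?_
  have hx' : (0 : ℝ) < x := hx
  have hx0 : (x : ℂ) ≠ 0 := by exact_mod_cast hx'.ne'
  have e : ((x ^ (2 : ℝ) : ℝ) : ℂ) ^ ((a + 1) / 2 - 1) = (x : ℂ) ^ (a - 1) := by
    have h2 : ((x ^ (2 : ℝ) : ℝ) : ℂ) ≠ 0 := by exact_mod_cast (Real.rpow_pos_of_pos hx' 2).ne'
    rw [Complex.cpow_def_of_ne_zero h2, Complex.cpow_def_of_ne_zero hx0,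
      ← Complex.ofReal_log (by positivity), ← Complex.ofReal_log hx'.le, Real.log_rpow hx']
    congr 1
    push_cast
    ring
  have e2 : ((x ^ (2 : ℝ) : ℝ) : ℂ) = (x : ℂ) ^ 2 := by norm_cast
  have e3 : x ^ ((2 : ℝ) - 1) = x := by norm_num
  rw [e, e2, e3, Complex.real_smul, Complex.cpow_sub _ _ hx0, Complex.cpow_one]
  push_cast
  rw [abs_two]
  rw [Complex.ofReal_ofNat]
  field_simp

end GammaIntegral

/-! ### Gaussians -/

section Gauss

/-- `x^{1/2+m} e^{-z x²/2}`. -/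
noncomputable def gauss (m z : ℂ) (x : ℝ) : ℂ :=
  (x : ℂ) ^ (1 / 2 + m) * Complex.exp (-(z * x ^ 2 / 2))

theorem norm_cpow_mul_gaussian (a z : ℂ) {x : ℝ} (hx : 0 < x) :
    ‖(x : ℂ) ^ a * Complex.exp (-(z * x ^ 2 / 2))‖ = x ^ a.re * Real.exp (-(z.re * x ^ 2 / 2)) := by
  rw [norm_mul, Complex.norm_cpow_eq_rpow_re_of_pos hx, Complex.norm_exp]
  have : (z * (x : ℂ) ^ 2 / 2).re = z.re * x ^ 2 / 2 := by
    rw [← Complex.ofReal_pow, mul_div_assoc, ← Complex.ofReal_ofNat, ← Complex.ofReal_div,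
      Complex.re_mul_ofReal, mul_div_assoc]
  rw [Complex.neg_re, this]

theorem measurable_cpow_mul_gaussian (a z : ℂ) :
    Measurable fun x : ℝ => (x : ℂ) ^ a * Complex.exp (-(z * x ^ 2 / 2)) :=
  (Complex.measurable_ofReal.pow_const a).mul (by fun_prop)

theorem integrable_rpow_mul_gaussian {a b : ℝ} (ha : -1 < a) (hb : 0 < b) :
    Integrable (fun x : ℝ => x ^ a * Real.exp (-(b * x ^ 2 / 2))) halfLine := by
  have h := integrableOn_rpow_mul_exp_neg_mul_sq (b := b / 2) (s := a) (by positivity) ha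
  refine h.congr (ae_of_all _ fun x => ?_)
  simp only
  congr 2
  ring

theorem integrable_cpow_mul_gaussian {a z : ℂ} (ha : -1 < a.re) (hz : 0 < z.re) :
    Integrable (fun x : ℝ => (x : ℂ) ^ a * Complex.exp (-(z * x ^ 2 / 2))) halfLine := by
  refine Integrable.mono' (integrable_rpow_mul_gaussian ha hz)
    (measurable_cpow_mul_gaussian a z).aestronglyMeasurable ?_
  filter_upwards [ae_restrict_mem measurableSet_Ioi] with t ht
  rw [norm_cpow_mul_gaussian a z ht]

theorem memLp_rpow_mul_gaussian {a b : ℝ} (ha : -1 / 2 < a) (hb : 0 < b) :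
    MemLp (fun x : ℝ => x ^ a * Real.exp (-(b * x ^ 2 / 2))) 2 halfLine := by
  have hmeas : Measurable fun x : ℝ => x ^ a * Real.exp (-(b * x ^ 2 / 2)) :=
    (measurable_id.pow_const a).mul (by fun_prop)
  rw [memLp_two_iff_integrable_sq hmeas.aestronglyMeasurable]
  refine (integrable_rpow_mul_gaussian (a := 2 * a) (b := 2 * b) (by linarith)
    (by positivity)).congr ?_
  filter_upwards [ae_restrict_mem measurableSet_Ioi] with x hx
  rw [mul_pow, ← Real.exp_nat_mul, mul_comm 2 a, Real.rpow_mul (le_of_lt hx), Real.rpow_two]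
  congr 2
  push_cast
  ring

theorem memLp_cpow_mul_gaussian {a z : ℂ} (ha : -1 / 2 < a.re) (hz : 0 < z.re) :
    MemLp (fun x : ℝ => (x : ℂ) ^ a * Complex.exp (-(z * x ^ 2 / 2))) 2 halfLine := by
  refine (memLp_rpow_mul_gaussian ha hz).mono
    (measurable_cpow_mul_gaussian a z).aestronglyMeasurable ?_
  filter_upwards [ae_restrict_mem measurableSet_Ioi] with t ht
  rw [norm_cpow_mul_gaussian a z ht]
  exact le_abs_self _

theorem memLp_gauss {m z : ℂ} (hm : -1 < m.re) (hz : 0 < z.re) : MemLp (gauss m z) 2 halfLine :=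
  memLp_cpow_mul_gaussian (by simp; linarith) hz

/-- The Gaussian `x^{1/2+m} e^{-z x²/2}` as an element of `L²`. -/
noncomputable def gaussL2 (m z : ℂ) : L2 :=
  open Classical in if h : MemLp (gauss m z) 2 halfLine then h.toLp else 0

theorem coeFn_gaussL2 {m z : ℂ} (hm : -1 < m.re) (hz : 0 < z.re) :
    gaussL2 m z =ᵐ[halfLine] gauss m z := by
  rw [gaussL2, dif_pos (memLp_gauss hm hz)]
  exact MemLp.coeFn_toLp _

theorem dense_span_gaussL2 {m : ℂ} (hm : -1 < m.re) :
    Dense (Submodule.span ℂ ((fun s : ℝ => gaussL2 m s) '' Set.Ioi 0) : Set L2) := by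
  refine dense_span_gaussian (q := fun x => (x : ℂ) ^ (1 / 2 + m)) (fun x hx => ?_) fun s hs =>
    coeFn_gaussL2 hm (by simpa using hs)
  rw [Complex.cpow_def_of_ne_zero (by exact_mod_cast hx.ne')]
  exact Complex.exp_ne_zero _

/-- A bounded operator on `L²` is determined by its values on Gaussians. -/
theorem ext_gaussL2 {E : Type*} [NormedAddCommGroup E] [NormedSpace ℂ E] {m : ℂ} (hm : -1 < m.re)
    {T T' : L2 →L[ℂ] E} (h : ∀ s : ℝ, 0 < s → T (gaussL2 m s) = T' (gaussL2 m s)) : T = T' :=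
  ContinuousLinearMap.ext_on (dense_span_gaussL2 hm) (by
    rintro _ ⟨s, hs, rfl⟩
    exact h s hs)

/-- The Mellin transform of `x^{1/2+m} e^{-z x²/2}`. -/
noncomputable def gaussHat (m z : ℂ) (τ : ℝ) : ℂ :=
  1 / 2 * (z / 2) ^ (-((m + 1 - Complex.I * τ) / 2)) * Complex.Gamma ((m + 1 - Complex.I * τ) / 2)

theorem logPull_gauss (m z : ℂ) (u : ℝ) : logPull (gauss m z) u
    = Complex.exp ((1 + m) * u) * Complex.exp (-(z * (Real.exp u : ℂ) ^ 2 / 2)) := by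
  have h0 : (Real.exp u : ℂ) ≠ 0 := by exact_mod_cast (Real.exp_pos u).ne'
  rw [logPull, gauss, Complex.cpow_def_of_ne_zero h0, ← Complex.ofReal_log (Real.exp_pos u).le,
    Real.log_exp, ← mul_assoc, Complex.ofReal_exp (u / 2), ← Complex.exp_add]
  congr 2
  push_cast
  ring

theorem integrable_logPull_gauss {m z : ℂ} (hm : -1 < m.re) (hz : 0 < z.re) :
    Integrable (logPull (gauss m z)) volume := by
  have h := integrable_cpow_mul_gaussian (a := m) (z := z) hm hz
  have h2 := integrableOn_image_iff_integrableOn_abs_deriv_smul (f := Real.exp) (f' := Real.exp)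
    MeasurableSet.univ (fun x _ => (Real.hasDerivAt_exp x).hasDerivWithinAt)
    Real.exp_injective.injOn (fun x : ℝ => (x : ℂ) ^ m * Complex.exp (-(z * x ^ 2 / 2)))
  rw [Set.image_univ, Real.range_exp, integrableOn_univ] at h2
  refine (h2.1 h).congr (ae_of_all _ fun u => ?_)
  have h0 : (Real.exp u : ℂ) ≠ 0 := by exact_mod_cast (Real.exp_pos u).ne'
  simp only
  rw [logPull_gauss, Complex.cpow_def_of_ne_zero h0, ← Complex.ofReal_log (Real.exp_pos u).le,
    Real.log_exp, Real.abs_exp, Complex.real_smul, ← mul_assoc, Complex.ofReal_exp u,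
    ← Complex.exp_add]
  congr 2
  ring

open FourierTransform in
theorem mellinL2_gaussL2 {m z : ℂ} (hm : -1 < m.re) (hz : 0 < z.re) :
    mellinL2 (gaussL2 m z) =ᵐ[volume] fun ξ => gaussHat m z (2 * Real.pi * ξ) := by
  refine (coeFn_mellinL2 (coeFn_gaussL2 hm hz) (integrable_logPull_gauss hm hz)).trans
    (ae_of_all _ fun ξ => ?_)
  have h := integral_cpow_mul_gaussian (a := m - Complex.I * (2 * Real.pi * ξ : ℝ)) (z := z)
    (by simpa using hm) hz
  change _ = gaussHat m z (2 * Real.pi * ξ)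
  rw [gaussHat, show m + 1 - Complex.I * (2 * Real.pi * ξ : ℝ)
    = m - Complex.I * (2 * Real.pi * ξ : ℝ) + 1 by ring, ← h, integral_halfLine_eq]
  rw [Real.fourier_real_eq_integral_exp_smul]
  refine integral_congr_ae (ae_of_all _ fun u => ?_)
  have h0 : (Real.exp u : ℂ) ≠ 0 := by exact_mod_cast (Real.exp_pos u).ne'
  simp only
  rw [logPull_gauss, Complex.cpow_def_of_ne_zero h0, ← Complex.ofReal_log (Real.exp_pos u).le,
    Real.log_exp, smul_eq_mul, Complex.ofReal_exp u]
  simp only [← Complex.exp_add]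
  congr 1
  push_cast
  ring

end Gauss

/-! ### Functions of the generator of dilations -/

section Dilation

/-- The spectral variable `2πξ` of the generator of dilations. -/
noncomputable def specVar (ξ : ℝ) : ℝ := 2 * Real.pi * ξ

theorem measurable_specVar : Measurable specVar := by
  unfold specVar
  fun_prop

theorem specVar_neg (ξ : ℝ) : specVar (-ξ) = -specVar ξ := by
  rw [specVar, specVar]
  ring

theorem BddMeas.comp_specVar {φ : ℝ → ℂ} (hφ : BddMeas φ) : BddMeas fun ξ => φ (specVar ξ) :=
  ⟨hφ.1.comp measurable_specVar, hφ.2.imp fun _ hC _ => hC _⟩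

theorem cpow_half_ofReal {s : ℝ} (hs : 0 < s) (b : ℂ) :
    ((s : ℂ) / 2) ^ b = Complex.exp (((Real.log s : ℂ) - Real.log 2) * b) := by
  have h : (s : ℂ) / 2 = ((s / 2 : ℝ) : ℂ) := by push_cast; rfl
  have h0 : ((s / 2 : ℝ) : ℂ) ≠ 0 := by exact_mod_cast (half_pos hs).ne'
  rw [h, Complex.cpow_def_of_ne_zero h0, ← Complex.ofReal_log (half_pos hs).le,
    Real.log_div hs.ne' two_ne_zero, Complex.ofReal_sub]

theorem cpow_ofReal_pos {s : ℝ} (hs : 0 < s) (b : ℂ) :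
    (s : ℂ) ^ b = Complex.exp ((Real.log s : ℂ) * b) := by
  rw [Complex.cpow_def_of_ne_zero (by exact_mod_cast hs.ne'), ← Complex.ofReal_log hs.le]

theorem gaussHat_ofReal (m : ℂ) {s : ℝ} (hs : 0 < s) (τ : ℝ) :
    gaussHat m s τ = 1 / 2 * Complex.exp (((Real.log s : ℂ) - Real.log 2) *
      (-((m + 1 - Complex.I * τ) / 2))) * Complex.Gamma ((m + 1 - Complex.I * τ) / 2) := by
  rw [gaussHat, cpow_half_ofReal hs]

theorem coeFn_dilation (τ : ℝ) {f : L2} {f' : ℝ → ℂ} (h : f =ᵐ[halfLine] f') :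
    dilation τ f =ᵐ[halfLine] fun x => (Real.exp (τ / 2) : ℂ) * f' (Real.exp τ * x) := by
  refine ((memLp_dilation τ f).coeFn_toLp).trans ?_
  filter_upwards [(quasiMeasurePreserving_mul (Real.exp_pos τ)).ae h] with x hx
  rw [hx]

theorem dilation_gaussL2 {m : ℂ} (hm : -1 < m.re) {s : ℝ} (hs : 0 < s) (τ : ℝ) :
    dilation τ (gaussL2 m s)
      = Complex.exp ((1 + m) * τ) • gaussL2 m (s * Real.exp (2 * τ) : ℝ) := by
  have hs' : 0 < s * Real.exp (2 * τ) := by positivity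
  apply Lp.ext
  filter_upwards [coeFn_dilation τ (coeFn_gaussL2 hm (z := s) (by simpa using hs)),
    Lp.coeFn_smul (Complex.exp ((1 + m) * τ)) (gaussL2 m (s * Real.exp (2 * τ) : ℝ)),
    coeFn_gaussL2 hm (z := (s * Real.exp (2 * τ) : ℝ)) (by rwa [Complex.ofReal_re]),
    ae_restrict_mem measurableSet_Ioi] with x h1 h2 h3 hx
  have hx' : 0 < x := hx
  rw [h1, h2, Pi.smul_apply, h3, gauss, gauss, smul_eq_mul, cpow_ofReal_pos (by positivity),
    cpow_ofReal_pos hx', Real.log_mul (Real.exp_pos τ).ne' hx'.ne', Real.log_exp,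
    Complex.ofReal_exp (τ / 2)]
  simp only [← Complex.exp_add]
  have : Complex.exp (2 * τ) = Complex.exp τ ^ 2 := by
    rw [← Complex.exp_nat_mul]
    norm_num
  congr 1
  push_cast
  rw [this]
  ring

theorem gaussHat_mul_exp (m : ℂ) {s : ℝ} (hs : 0 < s) (τ t : ℝ) :
    Complex.exp ((1 + m) * τ) * gaussHat m (s * Real.exp (2 * τ) : ℝ) t
      = Complex.exp (Complex.I * τ * t) * gaussHat m s t := by
  rw [gaussHat_ofReal m (by positivity), gaussHat_ofReal m hs,
    Real.log_mul hs.ne' (Real.exp_pos _).ne', Real.log_exp]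
  have e : Complex.exp ((1 + m) * τ) * Complex.exp ((((Real.log s + 2 * τ : ℝ) : ℂ) - Real.log 2) *
      (-((m + 1 - Complex.I * t) / 2))) = Complex.exp (Complex.I * τ * t) *
      Complex.exp (((Real.log s : ℂ) - Real.log 2) * (-((m + 1 - Complex.I * t) / 2))) := by
    rw [← Complex.exp_add, ← Complex.exp_add]
    congr 1
    push_cast
    ring
  linear_combination (1 / 2 * Complex.Gamma ((m + 1 - Complex.I * t) / 2)) * e

/-- `mellinL2` as a continuous linear equivalence. -/
noncomputable def mellinEquiv : L2 ≃L[ℂ] Lp ℂ 2 (volume : Measure ℝ) :=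
  mellinL2.toContinuousLinearEquiv

theorem mellinEquiv_gaussL2 {m z : ℂ} (hm : -1 < m.re) (hz : 0 < z.re) :
    mellinEquiv (gaussL2 m z) =ᵐ[volume] fun ξ => gaussHat m z (specVar ξ) :=
  mellinL2_gaussL2 hm hz

theorem mellinEquiv_gaussL2_ofReal {m : ℂ} (hm : -1 < m.re) {s : ℝ} (hs : 0 < s) :
    mellinEquiv (gaussL2 m s) =ᵐ[volume] fun ξ => gaussHat m s (specVar ξ) :=
  mellinL2_gaussL2 hm (by simpa using hs)

/-- Both sides are bounded, so Gaussians of order `0` suffice: a dilation rescales the parameter to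
`s e^{2τ}`, and the power of the parameter in the Mellin transform turns this into the phase
`e^{iτt}`. -/
theorem dilation_eq_conjGroup :
    dilation = conjGroup mellinEquiv (expMul volume specVar) := by
  ext1 τ
  refine ext_gaussL2 (m := 0) (by simp) fun s hs => ?_
  rw [conjGroup_apply, eq_comm, ContinuousLinearEquiv.symm_apply_eq,
    dilation_gaussL2 (by simp) hs, map_smul]
  apply Lp.ext
  have hs' : 0 < s * Real.exp (2 * τ) := by positivity
  filter_upwards [coeFn_mulL (bddMeas_exp measurable_specVar τ) (mellinEquiv (gaussL2 0 s)),
    mellinEquiv_gaussL2_ofReal (m := 0) (by simp) hs,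
    mellinEquiv_gaussL2_ofReal (m := 0) (by simp) hs',
    Lp.coeFn_smul (Complex.exp ((1 + 0) * τ)) (mellinEquiv (gaussL2 0 (s * Real.exp (2 * τ) : ℝ)))]
    with ξ h1 h2 h3 h4
  rw [expMul, h1, h2, h4, Pi.smul_apply, h3, smul_eq_mul, gaussHat_mul_exp 0 hs]

theorem mem_dilationGenerator_graph (f g : L2) :
    (f, g) ∈ dilationGenerator.graph ↔
      mellinEquiv g =ᵐ[volume] fun ξ => (specVar ξ : ℂ) * mellinEquiv f ξ := by
  rw [dilationGenerator, generator_graph, dilation_eq_conjGroup, mem_generatorGraph_conjGroup,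
    mem_generatorGraph_expMul measurable_specVar]

/-- The function `φ(A)` of the generator of dilations. -/
noncomputable def funcA (φ : ℝ → ℂ) : L2 →L[ℂ] L2 :=
  (mellinEquiv.symm : Lp ℂ 2 (volume : Measure ℝ) →L[ℂ] L2).comp
    ((mulL volume fun ξ => φ (specVar ξ)).comp (mellinEquiv : L2 →L[ℂ] Lp ℂ 2 (volume : Measure ℝ)))

theorem mellinEquiv_funcA (φ : ℝ → ℂ) (f : L2) :
    mellinEquiv (funcA φ f) = mulL volume (fun ξ => φ (specVar ξ)) (mellinEquiv f) := by
  simp [funcA]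

theorem coeFn_mellinEquiv_funcA {φ : ℝ → ℂ} (hφ : BddMeas φ) (f : L2) :
    mellinEquiv (funcA φ f) =ᵐ[volume] fun ξ => φ (specVar ξ) * mellinEquiv f ξ := by
  rw [mellinEquiv_funcA]
  exact coeFn_mulL hφ.comp_specVar _

theorem isFunctionOf_funcA {φ : ℝ → ℂ} (hφ : BddMeas φ) :
    IsFunctionOf dilationGenerator φ (funcA φ) := by
  refine ⟨ℝ, inferInstance, volume, specVar, mellinL2, measurable_specVar, fun f => ?_, fun f => ?_,
    fun f => coeFn_mellinEquiv_funcA hφ f⟩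
  · rw [LinearPMap.mem_domain_iff]
    constructor
    · rintro ⟨g, hg⟩
      rw [mem_dilationGenerator_graph] at hg
      exact (memLp_congr_ae hg).1 (Lp.memLp _)
    · intro h
      refine ⟨mellinEquiv.symm h.toLp, ?_⟩
      rw [mem_dilationGenerator_graph, ContinuousLinearEquiv.apply_symm_apply]
      exact h.coeFn_toLp
  · exact (mem_dilationGenerator_graph _ _).1 (dilationGenerator.mem_graph f)

theorem funcA_mul {φ ψ : ℝ → ℂ} (hφ : BddMeas φ) (hψ : BddMeas ψ) :
    funcA (fun t => φ t * ψ t) = funcA φ * funcA ψ := by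
  ext1 f
  apply mellinEquiv.injective
  rw [mellinEquiv_funcA, mulL_mul hφ.comp_specVar hψ.comp_specVar]
  simp [mellinEquiv_funcA]

theorem funcA_one : funcA (fun _ => 1) = 1 := by
  ext1 f
  apply mellinEquiv.injective
  rw [mellinEquiv_funcA, mulL_one]
  simp

end Dilation

/-! ### The Hankel transformation in the Mellin representation -/

section Hankel

/-- The reflection `g ↦ g(-·)` of `L²(ℝ)`. -/
noncomputable def reflectL2 : Lp ℂ 2 (volume : Measure ℝ) →L[ℂ] Lp ℂ 2 (volume : Measure ℝ) :=
  (Lp.compMeasurePreservingₗᵢ ℂ (fun x : ℝ => -x)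
    (Measure.measurePreserving_neg volume)).toContinuousLinearMap

theorem coeFn_reflectL2 (g : Lp ℂ 2 (volume : Measure ℝ)) :
    reflectL2 g =ᵐ[volume] fun ξ => g (-ξ) :=
  Lp.coeFn_compMeasurePreserving g (Measure.measurePreserving_neg volume)

theorem ae_neg {p : ℝ → Prop} (h : ∀ᵐ ξ ∂(volume : Measure ℝ), p ξ) : ∀ᵐ ξ : ℝ, p (-ξ) :=
  (Measure.measurePreserving_neg (volume : Measure ℝ)).quasiMeasurePreserving.ae h

/-- The Hankel transformation, defined through the Mellin transformation. -/
noncomputable def hankel (m : ℂ) : L2 →L[ℂ] L2 :=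
  (mellinEquiv.symm : Lp ℂ 2 (volume : Measure ℝ) →L[ℂ] L2).comp
    (reflectL2.comp ((mulL volume fun ξ => Xi m (specVar ξ)).comp
      (mellinEquiv : L2 →L[ℂ] Lp ℂ 2 (volume : Measure ℝ))))

theorem mellinEquiv_hankel {m : ℂ} (hm : -1 < m.re) {f : L2} {f' : ℝ → ℂ}
    (h : mellinEquiv f =ᵐ[volume] f') :
    mellinEquiv (hankel m f) =ᵐ[volume] fun ξ => Xi m (-specVar ξ) * f' (-ξ) := by
  have e : mellinEquiv (hankel m f)
      = reflectL2 (mulL volume (fun ξ => Xi m (specVar ξ)) (mellinEquiv f)) := by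
    simp [hankel]
  rw [e]
  filter_upwards [coeFn_reflectL2 (mulL volume (fun ξ => Xi m (specVar ξ)) (mellinEquiv f)),
    ae_neg (coeFn_mulL (bddMeas_Xi hm).comp_specVar (mellinEquiv f)), ae_neg h] with ξ h1 h2 h3
  rw [h1, h2, h3, specVar_neg]

/-- The two reflections cancel. The outer symbol is evaluated at `-τ`, where `Ξ_m(-τ) = Ξ_m(τ)⁻¹`,
while the inner one returns to `τ`. -/
theorem hankel_mul_hankel {m k : ℂ} (hm : -1 < m.re) (hk : -1 < k.re) :
    hankel m * hankel k = funcA fun t => Xi k t / Xi m t := by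
  ext1 f
  apply mellinEquiv.injective
  apply Lp.ext
  filter_upwards [mellinEquiv_hankel hm (f := hankel k f) (mellinEquiv_hankel hk EventuallyEq.rfl),
    coeFn_mellinEquiv_funcA (bddMeas_Xi_div_Xi hm hk) f] with ξ h1 h2
  rw [mul_apply_eq_comp, h1, h2, specVar_neg, neg_neg, neg_neg, Xi_neg]
  ring

theorem hankel_hankel {m : ℂ} (hm : -1 < m.re) (f : L2) : hankel m (hankel m f) = f := by
  have h := hankel_mul_hankel hm hm
  have e : (fun t => Xi m t / Xi m t) = fun _ => 1 := by
    ext t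
    rw [div_self (Xi_ne_zero hm t)]
  rw [e, funcA_one] at h
  exact congrArg (fun T : L2 →L[ℂ] L2 => T f) h

/-- The Hankel transformation as a continuous linear equivalence. -/
noncomputable def hankelEquiv (m : ℂ) (hm : -1 < m.re) : L2 ≃L[ℂ] L2 :=
  ContinuousLinearEquiv.equivOfInverse (hankel m) (hankel m) (hankel_hankel hm) (hankel_hankel hm)

theorem Xi_mul_Gamma {m : ℂ} (hm : -1 < m.re) (t : ℝ) :
    Xi m (-t) * Complex.Gamma ((m + 1 + Complex.I * t) / 2)
      = Complex.exp (-(Complex.I * Real.log 2 * t)) * Complex.Gamma ((m + 1 - Complex.I * t) / 2) := by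
  have h := Gamma_add_ne_zero hm t
  rw [Xi]
  have e1 : m + 1 + Complex.I * (-t : ℝ) = m + 1 - Complex.I * t := by push_cast; ring
  have e2 : m + 1 - Complex.I * (-t : ℝ) = m + 1 + Complex.I * t := by push_cast; ring
  have e3 : Complex.I * (Real.log 2 : ℂ) * (-t : ℝ) = -(Complex.I * Real.log 2 * t) := by
    push_cast; ring
  rw [e1, e2, e3]
  field_simp

/-- The Gamma quotient in `Ξ_m` exchanges `Γ((m+1+it)/2)` for `Γ((m+1-it)/2)`, and the phase `e^{i
ln(2) t}` compensates the powers of `2` from the Gaussian integral. This is the Mellin form of the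
fact that `ℱ_m` maps the Gaussian with parameter `s` to a multiple of the one with parameter `1/s`.
-/
theorem Xi_mul_gaussHat {m : ℂ} (hm : -1 < m.re) {s : ℝ} (hs : 0 < s) (t : ℝ) :
    Xi m (-t) * gaussHat m s (-t)
      = (s : ℂ) ^ (-(m + 1)) * gaussHat m (s⁻¹ : ℝ) t := by
  rw [gaussHat_ofReal m hs, gaussHat_ofReal m (inv_pos.2 hs), cpow_ofReal_pos hs, Real.log_inv]
  have e2 : m + 1 - Complex.I * (-t : ℝ) = m + 1 + Complex.I * t := by push_cast; ring
  rw [e2]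
  have h := Xi_mul_Gamma hm t
  have e : Complex.exp (((Real.log s : ℂ) - Real.log 2) * (-((m + 1 + Complex.I * t) / 2))) *
      Complex.exp (-(Complex.I * Real.log 2 * t)) = Complex.exp ((Real.log s : ℂ) * (-(m + 1))) *
      Complex.exp ((((-Real.log s : ℝ) : ℂ) - Real.log 2) * (-((m + 1 - Complex.I * t) / 2))) := by
    rw [← Complex.exp_add, ← Complex.exp_add]
    congr 1
    push_cast
    ring
  linear_combination (1 / 2 * Complex.exp (((Real.log s : ℂ) - Real.log 2) *
    (-((m + 1 + Complex.I * t) / 2)))) * h +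
    (1 / 2 * Complex.Gamma ((m + 1 - Complex.I * t) / 2)) * e

/-- Raising the order by two is multiplication by `x²`, and the functional equation of Gamma turns
it into a linear factor in the spectral variable. -/
theorem gaussHat_add_two {m : ℂ} (hm : -1 < m.re) {s : ℝ} (hs : 0 < s) (t : ℝ) :
    gaussHat (m + 2) s t = (s : ℂ)⁻¹ * (m + 1 - Complex.I * t) * gaussHat m s t := by
  rw [gaussHat_ofReal _ hs, gaussHat_ofReal _ hs]
  have h0 : (m + 1 - Complex.I * t) / 2 ≠ 0 := by
    intro h
    have := add_one_sub_I_mul_re m t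
    rw [h, Complex.zero_re] at this
    linarith
  have e1 : (m + 2 + 1 - Complex.I * t) / 2 = (m + 1 - Complex.I * t) / 2 + 1 := by ring
  have hexp : Complex.exp ((Real.log s : ℂ) - Real.log 2) = s / 2 := by
    rw [Complex.exp_sub, ← Complex.ofReal_exp, ← Complex.ofReal_exp, Real.exp_log hs,
      Real.exp_log two_pos]
    norm_num
  rw [e1, Complex.Gamma_add_one _ h0, neg_add, mul_add, mul_neg_one, Complex.exp_add,
    Complex.exp_neg ((Real.log s : ℂ) - Real.log 2), hexp]
  have hs' : (s : ℂ) ≠ 0 := by exact_mod_cast hs.ne'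
  field_simp

theorem hankel_gaussL2 {m : ℂ} (hm : -1 < m.re) {s : ℝ} (hs : 0 < s) :
    hankel m (gaussL2 m s) = (s : ℂ) ^ (-(m + 1)) • gaussL2 m (s⁻¹ : ℝ) := by
  apply mellinEquiv.injective
  rw [map_smul]
  apply Lp.ext
  filter_upwards [mellinEquiv_hankel hm (mellinEquiv_gaussL2_ofReal hm hs),
    Lp.coeFn_smul ((s : ℂ) ^ (-(m + 1))) (mellinEquiv (gaussL2 m (s⁻¹ : ℝ))),
    mellinEquiv_gaussL2_ofReal hm (inv_pos.2 hs)] with ξ h1 h2 h3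
  rw [h1, h2, Pi.smul_apply, h3, smul_eq_mul, specVar_neg, Xi_mul_gaussHat hm hs]

theorem re_add_two {m : ℂ} (hm : -1 < m.re) : -1 < (m + 2).re := by
  simp; linarith

/-- The linear factor `m + 1 + it` left by reflection is `2(m+1) - (m+1-it)`, whence the two
Gaussians. Their combination is the differential expression applied to the Gaussian with parameter
`1/s`, so this is the intertwining `ℱ_m x² = L_{m²} ℱ_m` on Gaussians. -/
theorem hankel_gaussL2_add_two {m : ℂ} (hm : -1 < m.re) {s : ℝ} (hs : 0 < s) :
    hankel m (gaussL2 (m + 2) s) = (s : ℂ) ^ (-(m + 1)) • ((2 * (m + 1) * (s : ℂ)⁻¹) •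
      gaussL2 m (s⁻¹ : ℝ) - ((s : ℂ)⁻¹ ^ 2) • gaussL2 (m + 2) (s⁻¹ : ℝ)) := by
  apply mellinEquiv.injective
  rw [map_smul, map_sub, map_smul, map_smul]
  apply Lp.ext
  have hs' : (s : ℂ) ≠ 0 := by exact_mod_cast hs.ne'
  have e2 (t : ℝ) : m + 1 - Complex.I * (-t : ℝ) = m + 1 + Complex.I * t := by push_cast; ring
  set A := mellinEquiv (gaussL2 m (s⁻¹ : ℝ)) with hA
  set B := mellinEquiv (gaussL2 (m + 2) (s⁻¹ : ℝ)) with hB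
  filter_upwards [mellinEquiv_hankel hm (mellinEquiv_gaussL2_ofReal (re_add_two hm) hs),
    Lp.coeFn_smul ((s : ℂ) ^ (-(m + 1))) ((2 * (m + 1) * (s : ℂ)⁻¹) • A - ((s : ℂ)⁻¹ ^ 2) • B),
    Lp.coeFn_sub ((2 * (m + 1) * (s : ℂ)⁻¹) • A) (((s : ℂ)⁻¹ ^ 2) • B),
    Lp.coeFn_smul (2 * (m + 1) * (s : ℂ)⁻¹) A, Lp.coeFn_smul ((s : ℂ)⁻¹ ^ 2) B,
    mellinEquiv_gaussL2_ofReal hm (inv_pos.2 hs),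
    mellinEquiv_gaussL2_ofReal (re_add_two hm) (inv_pos.2 hs)] with ξ h1 h2 h3 h4 h5 h6 h7
  rw [h1, h2, Pi.smul_apply, h3, Pi.sub_apply, h4, h5, Pi.smul_apply, Pi.smul_apply, h6, h7,
    gaussHat_add_two hm hs, gaussHat_add_two hm (inv_pos.2 hs), specVar_neg, e2]
  have h := Xi_mul_gaussHat hm hs (specVar ξ)
  simp only [smul_eq_mul, Complex.ofReal_inv, inv_inv] at h ⊢
  have e3 : (s : ℂ)⁻¹ ^ 2 * s = (s : ℂ)⁻¹ := by field_simp
  linear_combination ((s : ℂ)⁻¹ * (m + 1 + Complex.I * (specVar ξ))) * h +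
    ((s : ℂ) ^ (-(m + 1)) * (m + 1 - Complex.I * (specVar ξ)) * gaussHat m (s : ℂ)⁻¹ (specVar ξ)) * e3

/-- The bilinear pairing `∫ f g`. -/
noncomputable def pairing : L2 →L[ℂ] L2 →L[ℂ] ℂ :=
  (ContinuousLinearMap.mul ℂ ℂ).lpPairing halfLine 2 2

theorem pairing_apply (f g : L2) : pairing f g = ∫ x, f x * g x ∂halfLine := by
  rw [pairing, ContinuousLinearMap.lpPairing_eq_integral]
  rfl

theorem pairing_eq_integral {f g : L2} {f' g' : ℝ → ℂ} (hf : f =ᵐ[halfLine] f')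
    (hg : g =ᵐ[halfLine] g') : pairing f g = ∫ x, f' x * g' x ∂halfLine := by
  rw [pairing_apply]
  refine integral_congr_ae ?_
  filter_upwards [hf, hg] with x h1 h2
  rw [h1, h2]

theorem pairing_gaussL2 {m : ℂ} (hm : -1 < m.re) {s s' : ℝ} (hs : 0 < s) (hs' : 0 < s') :
    pairing (gaussL2 m s) (gaussL2 m s') = 1 / 2 * Complex.exp (((Real.log (s + s') : ℂ) -
      Real.log 2) * (-(m + 1))) * Complex.Gamma (m + 1) := by
  have ha : -1 < (1 + 2 * m).re := by simp; linarith
  have h := integral_cpow_mul_gaussian (a := 1 + 2 * m) (z := ((s + s' : ℝ) : ℂ)) ha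
    (by rw [Complex.ofReal_re]; positivity)
  rw [cpow_half_ofReal (by positivity), show (1 + 2 * m + 1) / 2 = m + 1 by ring] at h
  rw [pairing_eq_integral (coeFn_gaussL2 hm (by simpa using hs))
    (coeFn_gaussL2 hm (by simpa using hs')), ← h]
  refine setIntegral_congr_fun measurableSet_Ioi fun x hx => ?_
  have hx' : 0 < x := hx
  simp only [gauss]
  rw [cpow_ofReal_pos hx', cpow_ofReal_pos hx']
  simp only [← Complex.exp_add]
  congr 1
  push_cast
  ring

/-- On two Gaussians both sides equal, up to a common constant, `(1 + s s')^{-(m+1)}`, which is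
symmetric in `s` and `s'`. The pairing is bilinear because for complex `m` the transformation is its
own transpose but in general not its own adjoint. -/
theorem pairing_hankel {m : ℂ} (hm : -1 < m.re) (f g : L2) :
    pairing (hankel m f) g = pairing f (hankel m g) := by
  have key : pairing.comp (hankel m) = ((pairing.flip).comp (hankel m)).flip := by
    refine ext_gaussL2 hm fun s hs => ?_
    refine ext_gaussL2 hm fun s' hs' => ?_
    simp only [ContinuousLinearMap.comp_apply, ContinuousLinearMap.flip_apply]
    rw [hankel_gaussL2 hm hs, hankel_gaussL2 hm hs', map_smul, map_smul, smul_apply,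
      pairing_gaussL2 hm (inv_pos.2 hs) hs', pairing_gaussL2 hm hs (inv_pos.2 hs'),
      cpow_ofReal_pos hs, cpow_ofReal_pos hs']
    have e1 : s⁻¹ + s' = (1 + s * s') * s⁻¹ := by field_simp
    have e2 : s + s'⁻¹ = (1 + s * s') * s'⁻¹ := by field_simp; ring
    have hp : 1 + s * s' ≠ 0 := by positivity
    rw [e1, e2, Real.log_mul hp (inv_ne_zero hs.ne'), Real.log_mul hp (inv_ne_zero hs'.ne'),
      Real.log_inv, Real.log_inv, smul_eq_mul, smul_eq_mul, ← mul_assoc, ← mul_assoc, ← mul_assoc,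
      ← mul_assoc]
    congr 1
    rw [mul_right_comm, mul_right_comm (Complex.exp ((Real.log s' : ℂ) * _)), ← Complex.exp_add,
      ← Complex.exp_add]
    congr 2
    push_cast
    ring
  have h := congrArg (fun T : L2 →L[ℂ] L2 →L[ℂ] ℂ => T f g) key
  simpa using h

end Hankel

/-! ### Bessel functions -/

section Bessel

/-- The coefficients of the power series `∑ (-1)ⁿ zⁿ / (n! Γ(m+n+1))`. -/
noncomputable def besselCoeff (m : ℂ) (n : ℕ) : ℂ :=
  (-1) ^ n / ((n.factorial : ℂ) * Complex.Gamma (m + n + 1))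

/-- The entire function `∑ (-1)ⁿ yⁿ / (n! Γ(m+n+1))`, so that `J_m(x) = (x/2)^m B_m(x²/4)`. -/
noncomputable def besselB (m : ℂ) (y : ℝ) : ℂ := ∑' n, besselCoeff m n * (y : ℂ) ^ n

theorem add_natCast_ne_zero {m : ℂ} (hm : -1 < m.re) (n : ℕ) : m + n + 1 ≠ 0 := by
  intro h
  have := congrArg Complex.re h
  simp at this
  linarith [Nat.cast_nonneg (α := ℝ) n]

theorem Gamma_add_natCast_ne_zero {m : ℂ} (hm : -1 < m.re) (n : ℕ) :
    Complex.Gamma (m + n + 1) ≠ 0 :=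
  Complex.Gamma_ne_zero_of_re_pos (by simp; linarith [Nat.cast_nonneg (α := ℝ) n])

theorem Gamma_add_natCast_succ {m : ℂ} (hm : -1 < m.re) (n : ℕ) :
    Complex.Gamma (m + (n + 1 : ℕ) + 1) = (m + n + 1) * Complex.Gamma (m + n + 1) := by
  rw [← Complex.Gamma_add_one _ (add_natCast_ne_zero hm n)]
  congr 1
  push_cast
  ring

/-- At each step of the recursion the modulus `|m + n + 1|` dominates its real part. Integrating the
absolute Bessel series against a Gaussian produces `Γ(Re m + n + 1)`, which has to be controlled by
the denominator `|Γ(m + n + 1)|`. -/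
theorem Gamma_re_le {m : ℂ} (hm : -1 < m.re) (n : ℕ) :
    Real.Gamma (m.re + n + 1) * ‖Complex.Gamma (m + 1)‖
      ≤ Real.Gamma (m.re + 1) * ‖Complex.Gamma (m + n + 1)‖ := by
  induction n with
  | zero => simp
  | succ n ih =>
    have hpos : 0 < m.re + n + 1 := by linarith [Nat.cast_nonneg (α := ℝ) n]
    have h1 : Real.Gamma (m.re + (n + 1 : ℕ) + 1) = (m.re + n + 1) * Real.Gamma (m.re + n + 1) := by
      rw [← Real.Gamma_add_one hpos.ne']
      congr 1
      push_cast
      ring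
    have h2 : m.re + n + 1 ≤ ‖m + n + 1‖ := by
      have := Complex.re_le_norm (m + n + 1)
      simpa using this
    have h3 : 0 ≤ Real.Gamma (m.re + 1) := (Real.Gamma_pos_of_pos (by linarith)).le
    rw [Gamma_add_natCast_succ hm, norm_mul, h1, mul_assoc]
    calc (m.re + n + 1) * (Real.Gamma (m.re + n + 1) * ‖Complex.Gamma (m + 1)‖)
        ≤ ‖m + n + 1‖ * (Real.Gamma (m.re + 1) * ‖Complex.Gamma (m + n + 1)‖) :=
          mul_le_mul h2 ih (mul_nonneg (Real.Gamma_pos_of_pos hpos).le (norm_nonneg _))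
            (norm_nonneg _)
      _ = _ := by ring

theorem exists_norm_besselCoeff_mul_Gamma_le {m : ℂ} (hm : -1 < m.re) :
    ∃ C : ℝ, 0 ≤ C ∧ ∀ n : ℕ,
      ‖besselCoeff m n‖ * Real.Gamma (m.re + n + 1) ≤ C * (n.factorial : ℝ)⁻¹ := by
  have h0 : 0 < ‖Complex.Gamma (m + 1)‖ := by
    simpa using norm_pos_iff.2 (Gamma_add_natCast_ne_zero hm 0)
  refine ⟨Real.Gamma (m.re + 1) / ‖Complex.Gamma (m + 1)‖,
    div_nonneg (Real.Gamma_pos_of_pos (by linarith)).le h0.le, fun n => ?_⟩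
  have h1 := Gamma_re_le hm n
  have h2 : 0 < ‖Complex.Gamma (m + n + 1)‖ := norm_pos_iff.2 (Gamma_add_natCast_ne_zero hm n)
  have h3 : (0 : ℝ) < n.factorial := by exact_mod_cast n.factorial_pos
  rw [besselCoeff, norm_div, norm_mul, norm_pow, norm_neg, norm_one, one_pow, Complex.norm_natCast]
  calc 1 / (n.factorial * ‖Complex.Gamma (m + n + 1)‖) * Real.Gamma (m.re + n + 1)
      = Real.Gamma (m.re + n + 1) / ‖Complex.Gamma (m + n + 1)‖ * (n.factorial : ℝ)⁻¹ := by
        field_simp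
    _ ≤ _ := by
        gcongr ?_ * _
        rw [div_le_div_iff₀ h2 h0]
        exact h1

theorem exists_norm_besselCoeff_le {m : ℂ} (hm : -1 < m.re) :
    ∃ C : ℝ, 0 ≤ C ∧ ∀ n : ℕ, ‖besselCoeff m n‖ ≤ C * (n.factorial : ℝ)⁻¹ := by
  have h0 (n : ℕ) : 0 < ‖Complex.Gamma (m + n + 1)‖ :=
    norm_pos_iff.2 (Gamma_add_natCast_ne_zero hm n)
  have hmono (n : ℕ) : ‖Complex.Gamma (m + 1 + 1)‖ ≤ ‖Complex.Gamma (m + (n + 1 : ℕ) + 1)‖ := by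
    induction n with
    | zero => simp
    | succ n ih =>
      refine ih.trans ?_
      rw [Gamma_add_natCast_succ hm (n + 1), norm_mul]
      refine le_mul_of_one_le_left (norm_nonneg _) ?_
      have := Complex.re_le_norm (m + (n + 1 : ℕ) + 1)
      simp at this
      push_cast
      linarith [Nat.cast_nonneg (α := ℝ) n]
  -- The moduli `|Γ(m+n+1)|` are nondecreasing from `n = 1` on, where the recursion factor has real
  -- part at least `1`. The first factor `m + 1` may be small, so `n = 0` is kept apart.
  set c := min ‖Complex.Gamma (m + 1)‖ ‖Complex.Gamma (m + 1 + 1)‖ with hc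
  have hc0 : 0 < c := lt_min (by simpa using h0 0) (by simpa using h0 1)
  refine ⟨c⁻¹, by positivity, fun n => ?_⟩
  have hle : c ≤ ‖Complex.Gamma (m + n + 1)‖ := by
    cases n with
    | zero =>
      rw [Nat.cast_zero, add_zero]
      exact min_le_left _ _
    | succ n => exact (min_le_right _ _).trans (hmono n)
  have h3 : (0 : ℝ) < n.factorial := by exact_mod_cast n.factorial_pos
  rw [besselCoeff, norm_div, norm_mul, norm_pow, norm_neg, norm_one, one_pow, Complex.norm_natCast,
    one_div, mul_inv, mul_comm]
  gcongr

theorem summable_besselB {m : ℂ} (hm : -1 < m.re) (y : ℝ) :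
    Summable fun n => besselCoeff m n * (y : ℂ) ^ n := by
  obtain ⟨C, -, hC⟩ := exists_norm_besselCoeff_le hm
  refine Summable.of_norm_bounded ((Real.summable_pow_div_factorial |y|).mul_left C) fun n => ?_
  rw [norm_mul, norm_pow, Complex.norm_real, Real.norm_eq_abs]
  calc ‖besselCoeff m n‖ * |y| ^ n ≤ C * (n.factorial : ℝ)⁻¹ * |y| ^ n := by
        gcongr
        exact hC n
    _ = _ := by ring

theorem besselCoeff_succ {m : ℂ} (n : ℕ) :
    besselCoeff m (n + 1) * (n + 1 : ℕ) = -besselCoeff (m + 1) n := by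
  rw [besselCoeff, besselCoeff, Nat.factorial_succ]
  have e : m + (n + 1 : ℕ) + 1 = m + 1 + n + 1 := by push_cast; ring
  have h1 : ((n + 1 : ℕ) : ℂ) ≠ 0 := by exact_mod_cast n.succ_ne_zero
  rw [e, Nat.cast_mul, pow_succ, mul_assoc ((n + 1 : ℕ) : ℂ), ← div_div,
    div_mul_eq_mul_div, div_mul_cancel₀ _ h1]
  ring

theorem besselCoeff_add_one {m : ℂ} (hm : -1 < m.re) (n : ℕ) :
    besselCoeff m n = (m + n + 1) * besselCoeff (m + 1) n := by
  have e : m + 1 + n + 1 = m + (n + 1 : ℕ) + 1 := by push_cast; ring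
  rw [besselCoeff, besselCoeff, e, Gamma_add_natCast_succ hm]
  have h1 := add_natCast_ne_zero hm n
  have h2 := Gamma_add_natCast_ne_zero hm n
  have h3 : (n.factorial : ℂ) ≠ 0 := by exact_mod_cast n.factorial_ne_zero
  field_simp

theorem re_add_one {m : ℂ} (hm : -1 < m.re) : -1 < (m + 1).re := by
  simp; linarith

theorem hasDerivAt_besselB {m : ℂ} (hm : -1 < m.re) (y : ℝ) :
    HasDerivAt (besselB m) (-besselB (m + 1) y) y := by
  obtain ⟨C, hC0, hC⟩ := exists_norm_besselCoeff_le hm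
  set R := |y| + 1 with hR
  have hR0 : 0 ≤ R := by positivity
  have hu : Summable fun n : ℕ => ‖besselCoeff m n‖ * (n * R ^ (n - 1)) := by
    rw [← summable_nat_add_iff 1]
    refine Summable.of_nonneg_of_le (fun n => by positivity) (fun n => ?_)
      ((Real.summable_pow_div_factorial R).mul_left C)
    rw [Nat.add_sub_cancel]
    calc ‖besselCoeff m (n + 1)‖ * (((n + 1 : ℕ) : ℝ) * R ^ n)
        ≤ C * ((n + 1).factorial : ℝ)⁻¹ * (((n + 1 : ℕ) : ℝ) * R ^ n) := by
          gcongr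
          exact hC _
      _ = C * (R ^ n / n.factorial) := by
          have h1 : ((n + 1 : ℕ) : ℝ) ≠ 0 := by exact_mod_cast n.succ_ne_zero
          rw [Nat.factorial_succ, Nat.cast_mul]
          field_simp
  have h := hasDerivAt_tsum_of_isPreconnected (t := Set.Ioo (-R) R) (𝕜 := ℝ)
    (g := fun n (y : ℝ) => besselCoeff m n * (y : ℂ) ^ n)
    (g' := fun n (y : ℝ) => besselCoeff m n * (n * (y : ℂ) ^ (n - 1))) (y₀ := y) (y := y) hu
    isOpen_Ioo isPreconnected_Ioo (fun n y _ => by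
      have := ((hasDerivAt_id (y : ℂ)).comp_ofReal.pow n).const_mul (besselCoeff m n)
      simpa using this)
    (fun n z hz => by
      rw [norm_mul, norm_mul, norm_pow, Complex.norm_natCast, Complex.norm_real, Real.norm_eq_abs]
      have := (abs_lt.2 hz).le
      gcongr) (by constructor <;> linarith [neg_abs_le y, le_abs_self y]) (summable_besselB hm y)
    (by constructor <;> linarith [neg_abs_le y, le_abs_self y])
  refine h.congr_deriv ?_
  have hs : Summable fun n : ℕ => besselCoeff m n * (n * (y : ℂ) ^ (n - 1)) := by
    refine Summable.of_norm_bounded hu fun n => ?_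
    rw [norm_mul, norm_mul, norm_pow, Complex.norm_natCast, Complex.norm_real, Real.norm_eq_abs]
    have : |y| ≤ R := by linarith
    gcongr
  rw [hs.tsum_eq_zero_add, besselB, ← tsum_neg]
  simp only [CharP.cast_eq_zero, zero_mul, mul_zero, zero_add]
  refine tsum_congr fun n => ?_
  rw [Nat.add_sub_cancel, ← mul_assoc, besselCoeff_succ]
  ring

theorem continuous_besselB {m : ℂ} (hm : -1 < m.re) : Continuous (besselB m) :=
  continuous_iff_continuousAt.2 fun y => (hasDerivAt_besselB hm y).continuousAt

/-- Comparison of coefficients. Since the derivative of `besselB m` is `-besselB (m + 1)`, this is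
the Bessel equation in the variable `u²/4`. -/
theorem besselB_recurrence {m : ℂ} (hm : -1 < m.re) (y : ℝ) :
    y * besselB (m + 1 + 1) y = (m + 1) * besselB (m + 1) y - besselB m y := by
  have h1 := summable_besselB (re_add_one hm) y
  have h2 := summable_besselB hm y
  have h3 : Summable fun n : ℕ => besselCoeff (m + 1) n * n * (y : ℂ) ^ n := by
    refine ((h2.sub (h1.mul_left (m + 1)))).congr fun n => ?_
    rw [besselCoeff_add_one hm n]
    ring
  have e : (m + 1) * besselB (m + 1) y - besselB m y
      = -∑' n : ℕ, besselCoeff (m + 1) n * n * (y : ℂ) ^ n := by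
    rw [besselB, besselB, ← tsum_mul_left, ← (h1.mul_left (m + 1)).tsum_sub h2, ← tsum_neg]
    refine tsum_congr fun n => ?_
    rw [besselCoeff_add_one hm n]
    ring
  rw [e, h3.tsum_eq_zero_add, besselB, ← tsum_mul_left, CharP.cast_eq_zero, mul_zero, zero_mul,
    zero_add, ← tsum_neg]
  refine tsum_congr fun n => ?_
  rw [besselCoeff_succ]
  ring

theorem besselJ_eq (m : ℂ) {x : ℝ} (hx : 0 < x) :
    besselJ m x = ((x / 2 : ℝ) : ℂ) ^ m * besselB m (x ^ 2 / 4) := by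
  have h0 : ((x / 2 : ℝ) : ℂ) ≠ 0 := by exact_mod_cast (half_pos hx).ne'
  rw [besselJ, besselB, ← tsum_mul_left]
  refine tsum_congr fun n => ?_
  rw [besselCoeff, Complex.cpow_add _ _ h0, show (2 * (n : ℂ)) = ((2 * n : ℕ) : ℂ) by push_cast; rfl,
    Complex.cpow_natCast, pow_mul]
  have e : ((x / 2 : ℝ) : ℂ) ^ 2 = ((x ^ 2 / 4 : ℝ) : ℂ) := by
    push_cast
    ring
  rw [e]
  ring

end Bessel

/-! ### The kernel of the Hankel transformation -/

section Kernel

/-- Solutions of `v'' = (q/u² - 1) v` are bounded at infinity. -/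
theorem exists_norm_le_of_bessel_ode {v v' : ℝ → ℂ} {q : ℂ}
    (hv : ∀ u, 0 < u → HasDerivAt v (v' u) u)
    (hv' : ∀ u, 0 < u → HasDerivAt v' ((q * ((u ^ 2)⁻¹ : ℝ) - 1) * v u) u) :
    ∃ C : ℝ, ∀ u, 1 ≤ u → ‖v u‖ ≤ C := by
  -- This energy is conserved by the free equation `v'' = -v`; the term `q/u²` changes it at
  -- relative rate at most `‖q‖/u²`, which is integrable at infinity.
  set E : ℝ → ℝ := fun u => ‖v u‖ ^ 2 + ‖v' u‖ ^ 2 with hE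
  have hE0 (u) : 0 ≤ E u := by positivity
  set E' : ℝ → ℝ := fun u => 2 * inner ℝ (v u) (v' u) +
    2 * inner ℝ (v' u) ((q * ((u ^ 2)⁻¹ : ℝ) - 1) * v u) with hE'
  have hdE (u : ℝ) (hu : 0 < u) : HasDerivAt E (E' u) u := (hv u hu).norm_sq.add (hv' u hu).norm_sq
  have hle (u : ℝ) (hu : 0 < u) : E' u ≤ ‖q‖ * (u ^ 2)⁻¹ * E u := by
    have e : E' u = 2 * inner ℝ (v' u) (q * ((u ^ 2)⁻¹ : ℝ) * v u) := by
      rw [hE']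
      simp only
      rw [sub_mul, one_mul, inner_sub_right, real_inner_comm (v' u) (v u)]
      ring
    have h1 := real_inner_le_norm (v' u) (q * ((u ^ 2)⁻¹ : ℝ) * v u)
    rw [norm_mul, norm_mul, Complex.norm_real, Real.norm_eq_abs, abs_of_pos (by positivity)] at h1
    have h2 : 0 ≤ ‖q‖ * (u ^ 2)⁻¹ := by positivity
    rw [e, hE]
    simp only
    nlinarith [mul_nonneg h2 (sq_nonneg (‖v u‖ - ‖v' u‖))]
  -- Gronwall's argument: the integrating factor `e^{‖q‖/u}` makes the energy nonincreasing, and it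
  -- is at least `1`.
  set F : ℝ → ℝ := fun u => E u * Real.exp (‖q‖ * u⁻¹) with hF
  have hdF (u : ℝ) (hu : 0 < u) : HasDerivAt F (E' u * Real.exp (‖q‖ * u⁻¹) +
      E u * (Real.exp (‖q‖ * u⁻¹) * (‖q‖ * -(u ^ 2)⁻¹))) u :=
    (hdE u hu).mul (((hasDerivAt_inv hu.ne').const_mul ‖q‖).exp)
  have hanti : AntitoneOn F (Set.Ici 1) := by
    refine antitoneOn_of_deriv_nonpos (convex_Ici 1) (fun u hu => ?_) (fun u hu => ?_)
      (fun u hu => ?_)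
    · exact (hdF u (lt_of_lt_of_le one_pos hu)).continuousAt.continuousWithinAt
    · rw [interior_Ici] at hu
      exact (hdF u (one_pos.trans hu)).differentiableAt.differentiableWithinAt
    · rw [interior_Ici] at hu
      have hu0 : 0 < u := one_pos.trans hu
      rw [(hdF u hu0).deriv]
      nlinarith [mul_le_mul_of_nonneg_right (hle u hu0) (Real.exp_pos (‖q‖ * u⁻¹)).le]
  refine ⟨√(F 1), fun u hu => ?_⟩
  have h1 : F u ≤ F 1 := hanti (Set.mem_Ici.2 le_rfl) hu hu
  have h2 : E u ≤ F u := by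
    refine le_mul_of_one_le_right (hE0 u) (Real.one_le_exp ?_)
    positivity
  refine Real.le_sqrt_of_sq_le ?_
  have h3 : ‖v u‖ ^ 2 ≤ E u := le_add_of_nonneg_right (sq_nonneg _)
  linarith

/-- The kernel `√u J_m(u)`. -/
noncomputable def hankelKernel (m : ℂ) (u : ℝ) : ℂ :=
  (2 : ℂ) ^ (-m) * ((u : ℂ) ^ (1 / 2 + m) * besselB m (u ^ 2 / 4))

theorem measurable_hankelKernel {m : ℂ} (hm : -1 < m.re) : Measurable (hankelKernel m) := by
  have := (continuous_besselB hm).measurable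
  exact measurable_const.mul ((Complex.measurable_ofReal.pow_const _).mul (by fun_prop))

theorem besselJ_mul_sqrt (m : ℂ) {u : ℝ} (hu : 0 < u) :
    besselJ m u * (√u : ℂ) = hankelKernel m u := by
  have h2 : (2 : ℂ) = ((2 : ℝ) : ℂ) := by norm_num
  have e : ((u / 2 : ℝ) : ℂ) ^ m * (√u : ℂ) = (2 : ℂ) ^ (-m) * (u : ℂ) ^ (1 / 2 + m) := by
    rw [cpow_ofReal_pos (half_pos hu), cpow_ofReal_pos hu, h2, cpow_ofReal_pos two_pos,
      Real.log_div hu.ne' two_ne_zero, Real.sqrt_eq_rpow, Real.rpow_def_of_pos hu,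
      Complex.ofReal_exp, ← Complex.exp_add, ← Complex.exp_add]
    congr 1
    push_cast
    ring
  rw [besselJ_eq m hu, hankelKernel, ← mul_assoc, ← e]
  ring

theorem hasDerivAt_besselB_sq {m : ℂ} (hm : -1 < m.re) (u : ℝ) :
    HasDerivAt (fun u : ℝ => besselB m (u ^ 2 / 4)) (-(u / 2 * besselB (m + 1) (u ^ 2 / 4))) u := by
  have h1 : HasDerivAt (fun u : ℝ => u ^ 2 / 4) (u / 2) u := by
    have := ((hasDerivAt_id u).pow 2).div_const 4
    refine this.congr_deriv ?_
    simp
    ring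
  refine ((hasDerivAt_besselB hm _).scomp u h1).congr_deriv ?_
  rw [Complex.real_smul]
  push_cast
  ring

/-- The function `u^{1/2+m} B_m(u²/4)` solves `v'' = ((m² - 1/4)/u² - 1) v`, so the energy estimate
replaces the asymptotics of the Bessel function. -/
theorem exists_norm_hankelKernel_le_of_one_le {m : ℂ} (hm : -1 < m.re) :
    ∃ C : ℝ, ∀ u, 1 ≤ u → ‖hankelKernel m u‖ ≤ C := by
  obtain ⟨c, hc⟩ : ∃ c : ℂ, c = 1 / 2 + m := ⟨_, rfl⟩
  have hB (u : ℝ) := hasDerivAt_besselB_sq hm u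
  have hB1 (u : ℝ) := hasDerivAt_besselB_sq (re_add_one hm) u
  obtain ⟨C, hC⟩ := exists_norm_le_of_bessel_ode (q := m ^ 2 - 1 / 4)
    (v := fun u => (u : ℂ) ^ c * besselB m (u ^ 2 / 4))
    (v' := fun u => c * (u : ℂ) ^ (c - 1) * besselB m (u ^ 2 / 4) +
      -(1 / 2 * ((u : ℂ) ^ (c + 1) * besselB (m + 1) (u ^ 2 / 4)))) (fun u hu => by
      have hu0 : (u : ℂ) ≠ 0 := by exact_mod_cast hu.ne'
      refine ((hasDerivAt_ofReal_cpow c hu).mul (hB u)).congr_deriv ?_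
      rw [Complex.cpow_add _ _ hu0, Complex.cpow_one]
      ring) (fun u hu => by
      have hu0 : (u : ℂ) ≠ 0 := by exact_mod_cast hu.ne'
      refine ((((hasDerivAt_ofReal_cpow (c - 1) hu).const_mul c).mul (hB u)).add
        (((hasDerivAt_ofReal_cpow (c + 1) hu).mul (hB1 u)).const_mul (1 / 2)).neg).congr_deriv ?_
      have hr := besselB_recurrence hm (u ^ 2 / 4)
      push_cast at hr ⊢
      have e1 : (u : ℂ) ^ (c - 1) = (u : ℂ) ^ c * (u : ℂ)⁻¹ := by
        rw [Complex.cpow_sub _ _ hu0, Complex.cpow_one, div_eq_mul_inv]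
      have e2 : (u : ℂ) ^ (c - 1 - 1) = (u : ℂ) ^ c * (u : ℂ)⁻¹ ^ 2 := by
        rw [Complex.cpow_sub _ _ hu0, Complex.cpow_one, e1]
        ring
      have e3 : (u : ℂ) ^ (c + 1) = (u : ℂ) ^ c * u := by
        rw [Complex.cpow_add _ _ hu0, Complex.cpow_one]
      rw [e1, e2, e3, add_sub_cancel_right, ← inv_pow]
      have h1 : (u : ℂ) * (u : ℂ)⁻¹ = 1 := mul_inv_cancel₀ hu0
      have h2 : m = c - 1 / 2 := by rw [hc]; ring
      linear_combination (u : ℂ) ^ c * hr - (c * (u : ℂ) ^ c * besselB (m + 1) (u ^ 2 / 4) / 2) * h1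
        - ((u : ℂ) ^ c * (u : ℂ)⁻¹ ^ 2 * besselB m (u ^ 2 / 4) * (m + c - 1 / 2) -
          (u : ℂ) ^ c * besselB (m + 1) (u ^ 2 / 4)) * h2)
  refine ⟨‖(2 : ℂ) ^ (-m)‖ * C, fun u hu => ?_⟩
  rw [hankelKernel, norm_mul, ← hc]
  exact mul_le_mul_of_nonneg_left (hC u hu) (norm_nonneg _)

theorem exists_norm_hankelKernel_le {m : ℂ} (hm : -1 < m.re) :
    ∃ C β : ℝ, 0 ≤ C ∧ -1 / 2 < β ∧ β ≤ 0 ∧ β ≤ 1 / 2 + m.re ∧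
      ∀ u, 0 < u → ‖hankelKernel m u‖ ≤ C * (1 + u ^ β) := by
  obtain ⟨C₁, hC₁⟩ := exists_norm_hankelKernel_le_of_one_le hm
  obtain ⟨M, hM⟩ := (isCompact_Icc (a := (0 : ℝ)) (b := 1)).exists_bound_of_continuousOn
    (f := fun u : ℝ => besselB m (u ^ 2 / 4))
    ((continuous_besselB hm).comp (by fun_prop)).continuousOn
  have hM0 : 0 ≤ M := (norm_nonneg _).trans (hM 0 (by simp))
  set K := ‖(2 : ℂ) ^ (-m)‖ with hK
  -- Near `0` the kernel is of size `u^{1/2 + Re m}`. Capping the exponent at `0` makes `k^β ≤ 1`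
  -- for `k ≥ 1`, while `β > -1/2` keeps `k^β` square integrable near `0`.
  set β := min 0 (1 / 2 + m.re) with hβ
  have hC₁0 : 0 ≤ C₁ := (norm_nonneg _).trans (hC₁ 1 le_rfl)
  refine ⟨max C₁ (K * M), β, le_max_of_le_left hC₁0, ?_, min_le_left _ _, min_le_right _ _,
    fun u hu => ?_⟩
  · rw [hβ, lt_min_iff]
    constructor <;> linarith
  have hup : 0 ≤ u ^ β := Real.rpow_nonneg hu.le _
  rcases le_total 1 u with h | h
  · calc ‖hankelKernel m u‖ ≤ C₁ := hC₁ u h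
      _ ≤ max C₁ (K * M) * 1 := by rw [mul_one]; exact le_max_left _ _
      _ ≤ _ := mul_le_mul_of_nonneg_left (by linarith) (le_max_of_le_left hC₁0)
  · have h1 : u ^ (1 / 2 + m.re) ≤ u ^ β := Real.rpow_le_rpow_of_exponent_ge hu h (min_le_right _ _)
    have h2 : (1 / 2 + m).re = 1 / 2 + m.re := by simp
    calc ‖hankelKernel m u‖ = K * (u ^ (1 / 2 + m.re) * ‖besselB m (u ^ 2 / 4)‖) := by
          rw [hankelKernel, norm_mul, norm_mul, Complex.norm_cpow_eq_rpow_re_of_pos hu, h2]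
      _ ≤ K * (u ^ β * M) := by
          gcongr
          exact hM u ⟨hu.le, h⟩
      _ = K * M * u ^ β := by ring
      _ ≤ max C₁ (K * M) * (1 + u ^ β) := by
          have h5 := le_max_right C₁ (K * M)
          have h6 : 0 ≤ max C₁ (K * M) := le_max_of_le_left hC₁0
          nlinarith

/-- The Hankel transform of a Gaussian, as an integral. -/
theorem integral_hankelKernel_mul_gauss {m : ℂ} (hm : -1 < m.re) {s : ℝ} (hs : 0 < s) {x : ℝ}
    (hx : 0 < x) : ∫ k, hankelKernel m (k * x) * gauss m s k ∂halfLine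
      = (s : ℂ) ^ (-(m + 1)) * gauss m (s⁻¹ : ℝ) x := by
  obtain ⟨C, hC0, hC⟩ := exists_norm_besselCoeff_mul_Gamma_le hm
  obtain ⟨A, hA⟩ : ∃ A : ℂ, A = (2 : ℂ) ^ (-m) * (x : ℂ) ^ (1 / 2 + m) := ⟨_, rfl⟩
  -- The Bessel series is integrated term by term. The `n`-th Gaussian moment is a multiple of
  -- `Γ(m+n+1)`, which cancels the denominator of the coefficient and leaves the exponential series
  -- of `-x²/(2s)`.
  set F : ℕ → ℝ → ℂ := fun n k => (A * (besselCoeff m n * ((x ^ 2 / 4 : ℝ) : ℂ) ^ n)) *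
    ((k : ℂ) ^ (1 + 2 * m + 2 * n) * Complex.exp (-(s * k ^ 2 / 2))) with hF
  have hre (n : ℕ) : (1 + 2 * m + 2 * n).re = 1 + 2 * m.re + 2 * n := by simp
  have hre' (n : ℕ) : -1 < (1 + 2 * m + 2 * n).re := by
    rw [hre]
    linarith [Nat.cast_nonneg (α := ℝ) n]
  have hint (n : ℕ) : Integrable (F n) halfLine :=
    (integrable_cpow_mul_gaussian (hre' n) (by simpa using hs)).const_mul _
  have hnorm (n : ℕ) : ∫ k, ‖F n k‖ ∂halfLine = ‖A‖ * (‖besselCoeff m n‖ * (x ^ 2 / 4) ^ n) *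
      ((s / 2) ^ (-(m.re + n + 1)) * (1 / 2) * Real.Gamma (m.re + n + 1)) := by
    have h := integral_rpow_mul_exp_neg_mul_rpow (p := 2) (q := 1 + 2 * m.re + 2 * n) (b := s / 2)
      two_pos (by rw [← hre]; exact hre' n) (by positivity)
    have e1 : -(1 + 2 * m.re + 2 * (n : ℝ) + 1) / 2 = -(m.re + n + 1) := by ring
    have e2 : (1 + 2 * m.re + 2 * (n : ℝ) + 1) / 2 = m.re + n + 1 := by ring
    rw [e1, e2] at h
    rw [← h, ← integral_const_mul]
    refine setIntegral_congr_fun measurableSet_Ioi fun k hk => ?_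
    have hk' : 0 < k := hk
    simp only [hF]
    rw [norm_mul, norm_cpow_mul_gaussian _ _ hk', hre, norm_mul, norm_mul, norm_pow,
      Complex.norm_real, Real.norm_eq_abs, abs_of_pos (by positivity : 0 < x ^ 2 / 4),
      Complex.ofReal_re, Real.rpow_two]
    congr 3
    ring
  have hsum : Summable fun n => ∫ k, ‖F n k‖ ∂halfLine := by
    have h1 := (Real.summable_pow_div_factorial (x ^ 2 / 4 * (s / 2)⁻¹)).mul_left
      (‖A‖ * C * ((s / 2) ^ (-(m.re + 1)) * (1 / 2)))
    refine Summable.of_nonneg_of_le (fun n => integral_nonneg fun k => norm_nonneg _) (fun n => ?_) h1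
    have e : (s / 2) ^ (-(m.re + n + 1)) = (s / 2) ^ (-(m.re + 1)) * (s / 2)⁻¹ ^ n := by
      rw [show -(m.re + n + 1) = -(m.re + 1) - n by ring, Real.rpow_sub (by positivity),
        Real.rpow_natCast, inv_pow, div_eq_mul_inv]
    rw [hnorm, e]
    calc ‖A‖ * (‖besselCoeff m n‖ * (x ^ 2 / 4) ^ n) *
          ((s / 2) ^ (-(m.re + 1)) * (s / 2)⁻¹ ^ n * (1 / 2) * Real.Gamma (m.re + n + 1))
        = ‖A‖ * ((x ^ 2 / 4) ^ n) * ((s / 2) ^ (-(m.re + 1)) * (s / 2)⁻¹ ^ n * (1 / 2)) *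
          (‖besselCoeff m n‖ * Real.Gamma (m.re + n + 1)) := by ring
      _ ≤ ‖A‖ * ((x ^ 2 / 4) ^ n) * ((s / 2) ^ (-(m.re + 1)) * (s / 2)⁻¹ ^ n * (1 / 2)) *
          (C * (n.factorial : ℝ)⁻¹) :=
          mul_le_mul_of_nonneg_left (hC n) (by positivity)
      _ = _ := by
          rw [mul_pow]
          ring
  have h := hasSum_integral_of_summable_integral_norm hint hsum
  have hpt : ∫ k, ∑' n, F n k ∂halfLine = ∫ k, hankelKernel m (k * x) * gauss m s k ∂halfLine := by
    refine setIntegral_congr_fun measurableSet_Ioi fun k hk => ?_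
    have hk' : 0 < k := hk
    have hk0 : (k : ℂ) ≠ 0 := by exact_mod_cast hk'.ne'
    simp only [hF]
    rw [hankelKernel, gauss, besselB]
    have e1 : ((k * x : ℝ) : ℂ) ^ (1 / 2 + m) = (k : ℂ) ^ (1 / 2 + m) * (x : ℂ) ^ (1 / 2 + m) := by
      rw [Complex.ofReal_mul, Complex.mul_cpow_ofReal_nonneg hk'.le hx.le]
    rw [e1, ← tsum_mul_left, ← tsum_mul_left, ← tsum_mul_right]
    refine tsum_congr fun n => ?_
    have e2 : (k : ℂ) ^ (1 + 2 * m + 2 * n) = (k : ℂ) ^ (1 / 2 + m) * (k : ℂ) ^ (1 / 2 + m) *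
        (k : ℂ) ^ (2 * n) := by
      rw [← Complex.cpow_natCast, ← Complex.cpow_add _ _ hk0, ← Complex.cpow_add _ _ hk0]
      congr 1
      push_cast
      ring
    rw [e2, hA]
    push_cast
    ring
  have hval (n : ℕ) : ∫ k, F n k ∂halfLine = (s : ℂ) ^ (-(m + 1)) * (x : ℂ) ^ (1 / 2 + m) *
      ((-(((s⁻¹ : ℝ) : ℂ) * x ^ 2 / 2)) ^ n / n.factorial) := by
    have h1 := integral_cpow_mul_gaussian (a := 1 + 2 * m + 2 * n) (z := s) (hre' n)
      (by simpa using hs)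
    have e1 : (1 + 2 * m + 2 * (n : ℂ) + 1) / 2 = m + n + 1 := by ring
    rw [e1] at h1
    have hs0 : (s : ℂ) ≠ 0 := by exact_mod_cast hs.ne'
    have e2 : ((s : ℂ) / 2) ^ (-(m + n + 1)) = ((s : ℂ) / 2) ^ (-(m + 1)) * ((s : ℂ) / 2)⁻¹ ^ n := by
      have h2 : (s : ℂ) / 2 ≠ 0 := div_ne_zero hs0 two_ne_zero
      rw [show -(m + n + 1) = -(m + 1) - n by ring, Complex.cpow_sub _ _ h2, Complex.cpow_natCast,
        inv_pow, div_eq_mul_inv]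
    have e3 : (2 : ℂ) ^ (-m) * ((s : ℂ) / 2) ^ (-(m + 1)) = 2 * (s : ℂ) ^ (-(m + 1)) := by
      have h2 : (2 : ℂ) = ((2 : ℝ) : ℂ) := by norm_num
      have h3 : (2 : ℂ) = Complex.exp (Real.log 2 : ℂ) := by
        rw [← Complex.ofReal_exp, Real.exp_log two_pos, h2]
      rw [cpow_half_ofReal hs, cpow_ofReal_pos hs]
      conv_lhs => rw [h2, cpow_ofReal_pos two_pos]
      conv_rhs => rw [h3]
      rw [← Complex.exp_add, ← Complex.exp_add]
      congr 1
      ring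
    have hG := Gamma_add_natCast_ne_zero hm n
    have hf : (n.factorial : ℂ) ≠ 0 := by exact_mod_cast n.factorial_ne_zero
    simp only [hF]
    rw [integral_const_mul]
    rw [h1, e2, hA, besselCoeff]
    have e4 : (-(((s⁻¹ : ℝ) : ℂ) * x ^ 2 / 2)) ^ n
        = (-1) ^ n * ((x ^ 2 / 4 : ℝ) : ℂ) ^ n * ((s : ℂ) / 2)⁻¹ ^ n := by
      rw [← mul_pow, ← mul_pow]
      congr 1
      push_cast
      field_simp
      ring
    rw [e4]
    have hGG : (Complex.Gamma (m + n + 1))⁻¹ * Complex.Gamma (m + n + 1) = 1 := inv_mul_cancel₀ hG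
    rw [div_eq_mul_inv _ ((n.factorial : ℂ) * _), div_eq_mul_inv _ (n.factorial : ℂ), mul_inv]
    linear_combination ((x : ℂ) ^ (1 / 2 + m) * (-1) ^ n * (n.factorial : ℂ)⁻¹ *
      ((x ^ 2 / 4 : ℝ) : ℂ) ^ n * (1 / 2) * ((s : ℂ) / 2)⁻¹ ^ n) * e3 + ((x : ℂ) ^ (1 / 2 + m) *
      (-1) ^ n * (n.factorial : ℂ)⁻¹ * ((x ^ 2 / 4 : ℝ) : ℂ) ^ n * (1 / 2) * ((s : ℂ) / 2)⁻¹ ^ n *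
      ((2 : ℂ) ^ (-m) * ((s : ℂ) / 2) ^ (-(m + 1)))) * hGG
  rw [hpt] at h
  have h' : HasSum (fun n => ∫ k, F n k ∂halfLine) ((s : ℂ) ^ (-(m + 1)) * (x : ℂ) ^ (1 / 2 + m) *
      Complex.exp (-(((s⁻¹ : ℝ) : ℂ) * x ^ 2 / 2))) := by
    simp_rw [hval]
    rw [Complex.exp_eq_exp_ℂ]
    have h1 := NormedSpace.expSeries_div_hasSum_exp (-(((s⁻¹ : ℝ) : ℂ) * (x : ℂ) ^ 2 / 2))
    exact h1.mul_left _
  rw [h.unique h', gauss]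
  ring

end Kernel

/-! ### The Hankel transformation as an integral operator -/

section HankelIntegral

theorem integrable_rpow_mul_norm {β : ℝ} (h1 : -1 / 2 < β) (h2 : β ≤ 0) (f : L2)
    (hf : Integrable f halfLine) : Integrable (fun k => k ^ β * ‖f k‖) halfLine := by
  have h3 : Integrable (fun k : ℝ => k ^ β * Real.exp (-(1 * k ^ 2 / 2)) * ‖f k‖) halfLine :=
    MemLp.integrable_mul (p := 2) (q := 2) (memLp_rpow_mul_gaussian h1 one_pos) (Lp.memLp f).norm
  -- For `k ≥ 1` the integrability of `f` suffices; for `k ≤ 1` the square integrability of `k^β` is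
  -- used, with `e^{1/2}` compensating the factor `e^{-k²/2}`.
  refine Integrable.mono' (hf.norm.add (h3.const_mul (Real.exp (1 / 2)))) ?_ ?_
  · exact (measurable_id.pow_const β).aestronglyMeasurable.mul (Lp.aestronglyMeasurable f).norm
  · filter_upwards [ae_restrict_mem measurableSet_Ioi] with k hk
    have hk' : 0 < k := hk
    have hb : 0 ≤ k ^ β := Real.rpow_nonneg hk'.le _
    rw [Real.norm_eq_abs, abs_of_nonneg (by positivity), Pi.add_apply, ← mul_assoc, ← mul_assoc,
      ← one_add_mul]
    refine mul_le_mul_of_nonneg_right ?_ (norm_nonneg _)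
    rcases le_total k 1 with h | h
    · have h4 : 1 ≤ Real.exp (1 / 2) * Real.exp (-(1 * k ^ 2 / 2)) := by
        rw [← Real.exp_add]
        refine Real.one_le_exp ?_
        nlinarith
      nlinarith
    · have h4 : k ^ β ≤ 1 := Real.rpow_le_one_of_one_le_of_nonpos h h2
      have h5 : 0 ≤ Real.exp (1 / 2) * k ^ β * Real.exp (-(1 * k ^ 2 / 2)) := by positivity
      linarith

theorem integrable_hankelKernel_prod {m : ℂ} (hm : -1 < m.re) {s : ℝ} (hs : 0 < s) (f : L2)
    (hf : Integrable f halfLine) :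
    Integrable (fun p : ℝ × ℝ => hankelKernel m (p.2 * p.1) * f p.2 * gauss m s p.1)
      (halfLine.prod halfLine) := by
  obtain ⟨C, β, hC0, hβ1, hβ2, hβ3, hC⟩ := exists_norm_hankelKernel_le hm
  have hg1 : Integrable (fun x : ℝ => x ^ (1 / 2 + m.re) * Real.exp (-(s * x ^ 2 / 2))) halfLine :=
    integrable_rpow_mul_gaussian (by linarith) hs
  have hg2 : Integrable (fun x : ℝ => x ^ (β + (1 / 2 + m.re)) * Real.exp (-(s * x ^ 2 / 2)))
      halfLine := integrable_rpow_mul_gaussian (by linarith) hs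
  have hI := ((hg1.mul_prod hf.norm).add
    (hg2.mul_prod (integrable_rpow_mul_norm hβ1 hβ2 f hf))).const_mul C
  refine Integrable.mono' hI ?_ ?_
  · refine AEStronglyMeasurable.mul (AEStronglyMeasurable.mul ?_ ?_) ?_
    · exact ((measurable_hankelKernel hm).comp
        (measurable_snd.mul measurable_fst)).aestronglyMeasurable
    · exact (Lp.aestronglyMeasurable f).comp_snd
    · exact ((measurable_cpow_mul_gaussian (1 / 2 + m) s).comp measurable_fst).aestronglyMeasurable
  · rw [Measure.prod_restrict]
    filter_upwards [ae_restrict_mem (measurableSet_Ioi.prod measurableSet_Ioi)] with p hp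
    have hx : 0 < p.1 := hp.1
    have hk : 0 < p.2 := hp.2
    have h1 := hC (p.2 * p.1) (mul_pos hk hx)
    have h2 : (1 / 2 + m).re = 1 / 2 + m.re := by simp
    rw [norm_mul, norm_mul, gauss, norm_cpow_mul_gaussian _ _ hx, h2, Complex.ofReal_re]
    rw [Real.mul_rpow hk.le hx.le] at h1
    have h3 : 0 ≤ p.1 ^ (1 / 2 + m.re) := Real.rpow_nonneg hx.le _
    calc _ ≤ C * (1 + p.2 ^ β * p.1 ^ β) * ‖f p.2‖ *
          (p.1 ^ (1 / 2 + m.re) * Real.exp (-(s * p.1 ^ 2 / 2))) := by gcongr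
      _ = _ := by
          rw [Pi.add_apply, Real.rpow_add hx β (1 / 2 + m.re)]
          ring

/-- The Gaussian moments of `ℱ_m f` and of the integral agree: transposition moves `ℱ_m` onto the
Gaussian, where the integral formula is known, and Fubini moves the kernel back. Square
integrability of the integral is not needed beforehand, only integrability against Gaussians. -/
theorem isHankelTransform_hankel {m : ℂ} (hm : -1 < m.re) : IsHankelTransform m (hankel m) := by
  intro f hf
  set T : ℝ → ℂ := fun x => ∫ k, hankelKernel m (k * x) * f k ∂halfLine with hT
  have hTJ : ∀ᵐ x ∂halfLine, T x =
      ∫ k in Set.Ioi (0 : ℝ), besselJ m (k * x) * (Real.sqrt (k * x) : ℂ) * f k := by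
    filter_upwards [ae_restrict_mem measurableSet_Ioi] with x hx
    refine setIntegral_congr_fun measurableSet_Ioi fun k hk => ?_
    rw [besselJ_mul_sqrt m (mul_pos hk hx)]
  have hsplit (s x : ℝ) : hankel m f x * (x : ℂ) ^ (1 / 2 + m) * Complex.exp (-(s * x ^ 2 / 2))
      = hankel m f x * gauss m s x := by
    rw [gauss, mul_assoc]
  have hTg (s x : ℝ) : ∫ k, hankelKernel m (k * x) * f k * gauss m s x ∂halfLine
      = T x * gauss m s x := by
    rw [hT, integral_mul_const]
  have i1 (s : ℝ) (hs : 0 < s) : Integrable (fun x => hankel m f x * gauss m s x) halfLine :=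
    MemLp.integrable_mul (p := 2) (q := 2) (Lp.memLp _) (memLp_gauss hm (by simpa using hs))
  have i2 (s : ℝ) (hs : 0 < s) : Integrable (fun x => T x * gauss m s x) halfLine := by
    simp_rw [← hTg]
    exact (integrable_hankelKernel_prod hm hs f hf).integral_prod_left
  have hz := ae_eq_zero_of_integral_gaussian
    (h := fun x => (hankel m f x - T x) * (x : ℂ) ^ (1 / 2 + m)) (fun s hs => by
      refine ((i1 s hs).sub (i2 s hs)).congr (ae_of_all _ fun x => ?_)
      simp only [gauss, Pi.sub_apply]
      ring) (fun s hs => by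
      have e1 : ∫ x, T x * gauss m s x ∂halfLine = ∫ x, hankel m f x * gauss m s x ∂halfLine := by
        have hs' : 0 < (s : ℂ).re := by simpa using hs
        have hp := pairing_hankel hm f (gaussL2 m s)
        rw [pairing_eq_integral EventuallyEq.rfl (coeFn_gaussL2 hm hs'), hankel_gaussL2 hm hs,
          map_smul, pairing_eq_integral EventuallyEq.rfl
          (coeFn_gaussL2 hm (by simpa using inv_pos.2 hs)), smul_eq_mul,
          ← integral_const_mul] at hp
        rw [hp]
        simp_rw [← hTg]
        rw [integral_integral_swap (integrable_hankelKernel_prod hm hs f hf)]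
        refine setIntegral_congr_fun measurableSet_Ioi fun k hk => ?_
        have h := integral_hankelKernel_mul_gauss hm hs (x := k) hk
        rw [mul_left_comm, ← h, ← integral_const_mul]
        refine integral_congr_ae (ae_of_all _ fun x => ?_)
        simp only [mul_comm k x]
        ring
      have e2 : ∀ x : ℝ, (hankel m f x - T x) * (x : ℂ) ^ (1 / 2 + m) *
          Complex.exp (-(s * x ^ 2 / 2)) = hankel m f x * gauss m s x - T x * gauss m s x := by
        intro x
        rw [gauss]
        ring
      simp_rw [e2]
      rw [integral_sub (i1 s hs) (i2 s hs), e1, sub_self])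
  filter_upwards [hz, hTJ, ae_restrict_mem measurableSet_Ioi] with x h1 h2 hx
  have hx0 : (x : ℂ) ≠ 0 := by exact_mod_cast ne_of_gt hx
  rw [← h2]
  refine sub_eq_zero.1 ((mul_eq_zero.1 h1).resolve_right ?_)
  rw [Complex.cpow_def_of_ne_zero hx0]
  exact Complex.exp_ne_zero _

end HankelIntegral

/-! ### The group `e^{itH_m}` in the Hankel representation -/

section HankelGroup

/-- The group `ℱ_m e^{itx²} ℱ_m`. -/
noncomputable def hankelGroup (m : ℂ) (hm : -1 < m.re) : ℝ → L2 →L[ℂ] L2 :=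
  conjGroup (hankelEquiv m hm) (expMul halfLine fun x => x ^ 2)

theorem measurable_sq : Measurable fun x : ℝ => x ^ 2 := by fun_prop

theorem isOneParameterGroup_hankelGroup {m : ℂ} (hm : -1 < m.re) :
    IsOneParameterGroup (hankelGroup m hm) :=
  (isOneParameterGroup_expMul measurable_sq).conj _

theorem mem_hankelGroup_graph {m : ℂ} (hm : -1 < m.re) (f g : L2) :
    (f, g) ∈ generatorGraph (hankelGroup m hm) ↔
      hankel m g =ᵐ[halfLine] fun x => (x : ℂ) ^ 2 * hankel m f x := by
  rw [hankelGroup, mem_generatorGraph_conjGroup, mem_generatorGraph_expMul measurable_sq]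
  simp only [Complex.ofReal_pow]
  rfl

theorem gauss_add_two {m z : ℂ} {x : ℝ} (hx : 0 < x) :
    gauss (m + 2) z x = (x : ℂ) ^ 2 * gauss m z x := by
  have hx0 : (x : ℂ) ≠ 0 := by exact_mod_cast hx.ne'
  rw [gauss, gauss, ← add_assoc, Complex.cpow_add _ _ hx0, show (2 : ℂ) = ((2 : ℕ) : ℂ) by norm_num,
    Complex.cpow_natCast]
  ring

theorem coeFn_gaussL2_add_two {m : ℂ} (hm : -1 < m.re) {s : ℝ} (hs : 0 < s) :
    gaussL2 (m + 2) s =ᵐ[halfLine] fun x => (x : ℂ) ^ 2 * gauss m s x := by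
  filter_upwards [coeFn_gaussL2 (re_add_two hm) (z := s) (by simpa using hs),
    ae_restrict_mem measurableSet_Ioi] with x h1 hx
  rw [h1, gauss_add_two hx]

/-- The image of `x^{1/2+m} e^{-s x²/2}` under the differential expression. -/
noncomputable def lapGauss (m : ℂ) (s : ℝ) : L2 :=
  (2 * (m + 1) * s) • gaussL2 m s - ((s : ℂ) ^ 2) • gaussL2 (m + 2) s

theorem coeFn_lapGauss {m : ℂ} (hm : -1 < m.re) {s : ℝ} (hs : 0 < s) :
    lapGauss m s =ᵐ[halfLine] fun x => (2 * (m + 1) * s - (s : ℂ) ^ 2 * x ^ 2) * gauss m s x := by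
  filter_upwards [coeFn_gaussL2 hm (z := s) (by simpa using hs), coeFn_gaussL2_add_two hm hs,
    Lp.coeFn_sub ((2 * (m + 1) * s) • gaussL2 m s) (((s : ℂ) ^ 2) • gaussL2 (m + 2) s),
    Lp.coeFn_smul (2 * (m + 1) * s) (gaussL2 m s),
    Lp.coeFn_smul ((s : ℂ) ^ 2) (gaussL2 (m + 2) s)] with x h1 h2 h3 h4 h5
  rw [lapGauss, h3, Pi.sub_apply, h4, h5, Pi.smul_apply, Pi.smul_apply, h1, h2, smul_eq_mul,
    smul_eq_mul]
  ring

theorem hankel_gaussL2_add_two' {m : ℂ} (hm : -1 < m.re) {s : ℝ} (hs : 0 < s) :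
    hankel m (gaussL2 (m + 2) s) = (s : ℂ) ^ (-(m + 1)) • lapGauss m s⁻¹ := by
  rw [hankel_gaussL2_add_two hm hs, lapGauss, Complex.ofReal_inv]

theorem cpow_mul_cpow_inv {s : ℝ} (hs : 0 < s) (b : ℂ) :
    (s : ℂ) ^ b * ((s⁻¹ : ℝ) : ℂ) ^ b = 1 := by
  rw [cpow_ofReal_pos hs, cpow_ofReal_pos (inv_pos.2 hs), ← Complex.exp_add, Real.log_inv]
  simp

theorem hankel_lapGauss {m : ℂ} (hm : -1 < m.re) {s : ℝ} (hs : 0 < s) :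
    hankel m (lapGauss m s) = (s : ℂ) ^ (-(m + 1)) • gaussL2 (m + 2) (s⁻¹ : ℝ) := by
  have h := congrArg (hankel m) (hankel_gaussL2_add_two' hm (inv_pos.2 hs))
  rw [hankel_hankel hm, map_smul, inv_inv] at h
  rw [h, smul_smul, cpow_mul_cpow_inv hs, one_smul]

theorem pairing_hankel_hankel {m : ℂ} (hm : -1 < m.re) (f g : L2) :
    pairing (hankel m f) (hankel m g) = pairing f g := by
  rw [pairing_hankel hm, hankel_hankel hm]

theorem memLp_mul_gauss_integrable {m : ℂ} (hm : -1 < m.re) {s : ℝ} (hs : 0 < s) (f : L2) :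
    Integrable (fun x => f x * gauss m s x) halfLine :=
  MemLp.integrable_mul (p := 2) (q := 2) (Lp.memLp f) (memLp_gauss hm (by simpa using hs))

/-- The graph of the generator is characterized by its transpose on Gaussians. -/
theorem mem_hankelGroup_graph_of_pairing {m : ℂ} (hm : -1 < m.re) {a b : L2}
    (h : ∀ s : ℝ, 0 < s → pairing b (gaussL2 m s) = pairing a (lapGauss m s)) :
    (a, b) ∈ generatorGraph (hankelGroup m hm) := by
  rw [mem_hankelGroup_graph]
  -- Applying `ℱ_m` to both entries of the pairing turns the hypothesis at `1/s` into equality of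
  -- the moments of `ℱ_m b` and `x² ℱ_m a` at `s`.
  have key (s : ℝ) (hs : 0 < s) :
      ∫ x, hankel m b x * gauss m s x ∂halfLine
        = ∫ x, hankel m a x * gauss (m + 2) s x ∂halfLine := by
    have h1 := h s⁻¹ (inv_pos.2 hs)
    have hc : ((s⁻¹ : ℝ) : ℂ) ^ (-(m + 1)) ≠ 0 := by
      rw [cpow_ofReal_pos (inv_pos.2 hs)]
      exact Complex.exp_ne_zero _
    rw [← pairing_hankel_hankel hm b, ← pairing_hankel_hankel hm a,
      hankel_gaussL2 hm (inv_pos.2 hs), hankel_lapGauss hm (inv_pos.2 hs), map_smul, map_smul,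
      inv_inv] at h1
    have h2 := smul_right_injective ℂ hc h1
    rwa [pairing_eq_integral EventuallyEq.rfl (coeFn_gaussL2 hm (z := s) (by simpa using hs)),
      pairing_eq_integral EventuallyEq.rfl
        (coeFn_gaussL2 (re_add_two hm) (z := s) (by simpa using hs))] at h2
  have i1 (s : ℝ) (hs : 0 < s) := memLp_mul_gauss_integrable hm hs (hankel m b)
  have i2 (s : ℝ) (hs : 0 < s) := memLp_mul_gauss_integrable (re_add_two hm) hs (hankel m a)
  have e (s : ℝ) : (fun x => (hankel m b x - (x : ℂ) ^ 2 * hankel m a x) * (x : ℂ) ^ (1 / 2 + m) *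
      Complex.exp (-(s * x ^ 2 / 2))) =ᵐ[halfLine]
      fun x => hankel m b x * gauss m s x - hankel m a x * gauss (m + 2) s x := by
    filter_upwards [ae_restrict_mem measurableSet_Ioi] with x hx
    rw [gauss_add_two hx, gauss]
    ring
  have hz := ae_eq_zero_of_integral_gaussian
    (h := fun x => (hankel m b x - (x : ℂ) ^ 2 * hankel m a x) * (x : ℂ) ^ (1 / 2 + m))
    (fun s hs => ((i1 s hs).sub (i2 s hs)).congr (e s).symm)
    (fun s hs => by
      rw [integral_congr_ae (e s), integral_sub (i1 s hs) (i2 s hs), key s hs, sub_self])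
  filter_upwards [hz, ae_restrict_mem measurableSet_Ioi] with x h1 hx
  have hx0 : (x : ℂ) ≠ 0 := by exact_mod_cast ne_of_gt hx
  refine sub_eq_zero.1 ((mul_eq_zero.1 h1).resolve_right ?_)
  rw [Complex.cpow_def_of_ne_zero hx0]
  exact Complex.exp_ne_zero _

theorem im_sq_add_I (x : ℝ) : ((x : ℂ) ^ 2 + Complex.I).im = 1 := by
  rw [← Complex.ofReal_pow, Complex.add_im, Complex.ofReal_im, Complex.I_im, zero_add]

theorem sq_add_I_ne_zero (x : ℝ) : (x : ℂ) ^ 2 + Complex.I ≠ 0 := by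
  intro h
  have h1 := im_sq_add_I x
  rw [h, Complex.zero_im] at h1
  exact zero_ne_one h1

theorem one_le_norm_sq_add_I (x : ℝ) : 1 ≤ ‖(x : ℂ) ^ 2 + Complex.I‖ := by
  have h := Complex.abs_im_le_norm ((x : ℂ) ^ 2 + Complex.I)
  rwa [im_sq_add_I, abs_one] at h

theorem bddMeas_resolvent : BddMeas fun x : ℝ => ((x : ℂ) ^ 2 + Complex.I)⁻¹ := by
  refine ⟨by fun_prop, 1, fun x => ?_⟩
  rw [norm_inv]
  exact inv_le_one_of_one_le₀ (one_le_norm_sq_add_I x)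

theorem bddMeas_sq_mul_resolvent :
    BddMeas fun x : ℝ => (x : ℂ) ^ 2 * ((x : ℂ) ^ 2 + Complex.I)⁻¹ := by
  have h := (BddMeas.const (S := ℝ) 1).sub ((BddMeas.const Complex.I).mul bddMeas_resolvent)
  convert h using 2 with x
  have := sq_add_I_ne_zero x
  field_simp
  ring

/-- The Gaussians form a core of the generator. -/
theorem hankelGroup_graph_le_closure {m : ℂ} (hm : -1 < m.re) {P : Submodule ℂ (L2 × L2)}
    (hP : IsClosed (P : Set (L2 × L2))) (h : ∀ s : ℝ, 0 < s → (gaussL2 m s, lapGauss m s) ∈ P) :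
    generatorGraph (hankelGroup m hm) ≤ P := by
  set R₁ := mulL halfLine fun x : ℝ => ((x : ℂ) ^ 2 + Complex.I)⁻¹ with hR₁
  set R₂ := mulL halfLine fun x : ℝ => (x : ℂ) ^ 2 * ((x : ℂ) ^ 2 + Complex.I)⁻¹ with hR₂
  -- The resolvent parametrizes the whole graph: each of its points is `T u` with `u = ℱ_m g + i ℱ_m
  -- f`. As `T` is bounded, it is enough to treat a total set of `u`, chosen as `(x² + i)` times
  -- Gaussians so that `T u` is a multiple of a Gaussian pair.
  set T : L2 →L[ℂ] L2 × L2 := ((hankel m).comp R₁).prod ((hankel m).comp R₂) with hT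
  set D : ℝ → L2 := fun s => gaussL2 (m + 2) s + Complex.I • gaussL2 m s with hD
  have hDc (s : ℝ) (hs : 0 < s) :
      D s =ᵐ[halfLine] fun x => ((x : ℂ) ^ 2 + Complex.I) * gauss m s x := by
    filter_upwards [coeFn_gaussL2 hm (z := s) (by simpa using hs), coeFn_gaussL2_add_two hm hs,
      Lp.coeFn_add (gaussL2 (m + 2) s) (Complex.I • gaussL2 m s),
      Lp.coeFn_smul Complex.I (gaussL2 m s)] with x h1 h2 h3 h4
    rw [hD, h3, Pi.add_apply, h4, Pi.smul_apply, h1, h2, smul_eq_mul]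
    ring
  have hdense : Dense (Submodule.span ℂ (D '' Set.Ioi 0) : Set L2) := by
    refine dense_span_gaussian (q := fun x => ((x : ℂ) ^ 2 + Complex.I) * (x : ℂ) ^ (1 / 2 + m))
      (fun x hx => mul_ne_zero (sq_add_I_ne_zero x) ?_) fun s hs => ?_
    · rw [cpow_ofReal_pos hx]
      exact Complex.exp_ne_zero _
    · filter_upwards [hDc s hs] with x hx
      rw [hx, gauss, mul_assoc]
  have hTD (s : ℝ) (hs : 0 < s) : T (D s) ∈ P := by
    have e1 : R₁ (D s) = gaussL2 m s := by
      apply Lp.ext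
      filter_upwards [hDc s hs, coeFn_mulL bddMeas_resolvent (D s),
        coeFn_gaussL2 hm (z := s) (by simpa using hs)] with x h1 h2 h3
      rw [hR₁, h2, h1, h3, inv_mul_cancel_left₀ (sq_add_I_ne_zero x)]
    have e2 : R₂ (D s) = gaussL2 (m + 2) s := by
      apply Lp.ext
      filter_upwards [hDc s hs, coeFn_mulL bddMeas_sq_mul_resolvent (D s),
        coeFn_gaussL2_add_two hm hs] with x h1 h2 h3
      rw [hR₂, h2, h1, h3, mul_assoc, inv_mul_cancel_left₀ (sq_add_I_ne_zero x)]
    have e3 : T (D s) = (s : ℂ) ^ (-(m + 1)) • (gaussL2 m (s⁻¹ : ℝ), lapGauss m s⁻¹) := by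
      rw [hT, ContinuousLinearMap.prod_apply, ContinuousLinearMap.comp_apply,
        ContinuousLinearMap.comp_apply, e1, e2, hankel_gaussL2 hm hs,
        hankel_gaussL2_add_two' hm hs, Prod.smul_mk]
    rw [e3]
    exact P.smul_mem _ (h _ (inv_pos.2 hs))
  have hall : ∀ u, T u ∈ P := by
    have hcl : IsClosed {u | T u ∈ P} := hP.preimage T.continuous
    have hsub : Submodule.span ℂ (D '' Set.Ioi 0) ≤ P.comap (T : L2 →ₗ[ℂ] L2 × L2) := by
      rw [Submodule.span_le]
      rintro _ ⟨s, hs, rfl⟩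
      exact hTD s hs
    intro u
    exact (hcl.closure_subset_iff.2 fun y hy => hsub hy) (hdense u)
  rintro ⟨f, g⟩ hfg
  rw [mem_hankelGroup_graph] at hfg
  set u : L2 := hankel m g + Complex.I • hankel m f with hu
  have huc : u =ᵐ[halfLine] fun x => ((x : ℂ) ^ 2 + Complex.I) * hankel m f x := by
    filter_upwards [hfg, Lp.coeFn_add (hankel m g) (Complex.I • hankel m f),
      Lp.coeFn_smul Complex.I (hankel m f)] with x h1 h2 h3
    rw [hu, h2, Pi.add_apply, h3, Pi.smul_apply, h1, smul_eq_mul]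
    ring
  have e1 : R₁ u = hankel m f := by
    apply Lp.ext
    filter_upwards [huc, coeFn_mulL bddMeas_resolvent u] with x h1 h2
    rw [hR₁, h2, h1, inv_mul_cancel_left₀ (sq_add_I_ne_zero x)]
  have e2 : R₂ u = hankel m g := by
    apply Lp.ext
    filter_upwards [huc, coeFn_mulL bddMeas_sq_mul_resolvent u, hfg] with x h1 h2 h3
    rw [hR₂, h2, h1, h3, mul_assoc, inv_mul_cancel_left₀ (sq_add_I_ne_zero x)]
  have h3 := hall u
  rwa [hT, ContinuousLinearMap.prod_apply, ContinuousLinearMap.comp_apply,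
    ContinuousLinearMap.comp_apply, e1, e2, hankel_hankel hm, hankel_hankel hm] at h3

/-- The generator is closed. -/
theorem isClosed_hankelGroup_graph {m : ℂ} (hm : -1 < m.re) :
    IsClosed (generatorGraph (hankelGroup m hm) : Set (L2 × L2)) := by
  set R₁ := mulL halfLine fun x : ℝ => ((x : ℂ) ^ 2 + Complex.I)⁻¹ with hR₁
  -- The unbounded relation `ℱ_m g = x² ℱ_m f` is equivalent to `(x² + i)⁻¹ (ℱ_m g + i ℱ_m f) = ℱ_m
  -- f`, an equation between bounded operators.
  have e : (generatorGraph (hankelGroup m hm) : Set (L2 × L2))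
      = {p | R₁ (hankel m p.2 + Complex.I • hankel m p.1) = hankel m p.1} := by
    ext ⟨f, g⟩
    rw [SetLike.mem_coe, mem_hankelGroup_graph, Set.mem_ofPred_eq]
    set u : L2 := hankel m g + Complex.I • hankel m f with hu
    have huc : u =ᵐ[halfLine] fun x => hankel m g x + Complex.I * hankel m f x := by
      filter_upwards [Lp.coeFn_add (hankel m g) (Complex.I • hankel m f),
        Lp.coeFn_smul Complex.I (hankel m f)] with x h2 h3
      rw [hu, h2, Pi.add_apply, h3, Pi.smul_apply, smul_eq_mul]
    constructor
    · intro h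
      apply Lp.ext
      filter_upwards [huc, coeFn_mulL bddMeas_resolvent u, h] with x h1 h2 h3
      rw [hR₁, h2, h1, h3, ← add_mul, inv_mul_cancel_left₀ (sq_add_I_ne_zero x)]
    · intro h
      filter_upwards [huc, coeFn_mulL bddMeas_resolvent u] with x h1 h2
      have h4 : hankel m f x = ((x : ℂ) ^ 2 + Complex.I)⁻¹ *
          (hankel m g x + Complex.I * hankel m f x) := by
        conv_lhs => rw [← h]
        rw [hR₁, h2, h1]
      rw [eq_inv_mul_iff_mul_eq₀ (sq_add_I_ne_zero x)] at h4
      linear_combination -h4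
  rw [e]
  exact isClosed_eq (by fun_prop) (by fun_prop)

end HankelGroup

/-! ### Smooth functions with the boundary behaviour of `x^{1/2+m}` -/

section Admissible

/-- Smooth functions on `]0,∞[` that vanish near `∞` and are equal to `A x^{1/2+m}` near `0`. -/
structure Admissible (m A : ℂ) (φ : ℝ → ℂ) : Prop where
  smooth : ContDiffOn ℝ ∞ φ (Set.Ioi 0)
  eventually_atTop : ∀ᶠ x in atTop, φ x = 0
  eventually_zero : ∀ᶠ x in 𝓝[>] (0 : ℝ), φ x = A * (x : ℂ) ^ (1 / 2 + m)

variable {m A : ℂ} {φ : ℝ → ℂ}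

theorem gauss_ne_zero (m z : ℂ) {x : ℝ} (hx : 0 < x) : gauss m z x ≠ 0 := by
  rw [gauss, cpow_ofReal_pos hx]
  exact mul_ne_zero (Complex.exp_ne_zero _) (Complex.exp_ne_zero _)

theorem hasDerivAt_gauss (m z : ℂ) {x : ℝ} (hx : 0 < x) :
    HasDerivAt (gauss m z) (((1 / 2 + m) / x - z * x) * gauss m z x) x := by
  have hx0 : (x : ℂ) ≠ 0 := by exact_mod_cast hx.ne'
  have h1 := hasDerivAt_ofReal_cpow (1 / 2 + m) hx
  have h2 : HasDerivAt (fun x : ℝ => -(z * (x : ℂ) ^ 2 / 2)) (-(z * x)) x := by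
    have := (((hasDerivAt_id x).ofReal_comp.pow 2).const_mul z).div_const 2 |>.neg
    refine this.congr_deriv ?_
    simp only [id_eq, Complex.ofReal_one]
    ring
  have h3 := h1.mul h2.cexp
  refine h3.congr_deriv ?_
  rw [gauss, Complex.cpow_sub _ _ hx0, Complex.cpow_one]
  field_simp
  ring

theorem continuousOn_gauss (m z : ℂ) : ContinuousOn (gauss m z) (Set.Ioi 0) := fun _ hx =>
  (hasDerivAt_gauss m z hx).continuousAt.continuousWithinAt

theorem hasDerivAt_deriv_gauss (m z : ℂ) {x : ℝ} (hx : 0 < x) :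
    HasDerivAt (fun x : ℝ => ((1 / 2 + m) / x - z * x) * gauss m z x)
      (((-1 / 4 + m ^ 2) * ((x : ℂ) ^ 2)⁻¹ - (2 * (m + 1) * z - z ^ 2 * x ^ 2)) * gauss m z x)
      x := by
  have hx0 : (x : ℂ) ≠ 0 := by exact_mod_cast hx.ne'
  have h1 : HasDerivAt (fun x : ℝ => (1 / 2 + m) / (x : ℂ) - z * x)
      ((1 / 2 + m) * (-1 / (x : ℂ) ^ 2) - z) x := by
    have := (((hasDerivAt_id x).ofReal_comp.inv hx0).const_mul (1 / 2 + m)).sub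
      ((hasDerivAt_id x).ofReal_comp.const_mul z)
    refine (this.congr_deriv ?_).congr_of_eventuallyEq (Eventually.of_forall fun y => ?_)
    · simp only [id_eq, Complex.ofReal_one, mul_one]
    · simp only [Pi.sub_apply, Pi.inv_apply, id_eq, div_eq_mul_inv]
  refine (h1.mul (hasDerivAt_gauss m z hx)).congr_deriv ?_
  field_simp
  ring

/-- Continuous functions with the boundary behaviour of `x^{1/2+m}` are square integrable. -/
theorem memLp_of_eventually (hm : -1 < m.re) {ψ : ℝ → ℂ} (hc : ContinuousOn ψ (Set.Ioi 0))
    (h1 : ∀ᶠ x in atTop, ψ x = 0) (h0 : ∀ᶠ x in 𝓝[>] (0 : ℝ), ψ x = A * (x : ℂ) ^ (1 / 2 + m)) :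
    MemLp ψ 2 halfLine := by
  obtain ⟨R, hR⟩ := eventually_atTop.1 h1
  obtain ⟨δ, hδ, hδ'⟩ := mem_nhdsGT_iff_exists_Ioo_subset.1 h0
  have hδ0 : 0 < δ := hδ
  -- Comparison with a Gaussian of the same order: the quotient is bounded near `0` by the assumed
  -- form, on a compact interval by continuity, and vanishes beyond `R`.
  have hq : ContinuousOn (fun x => ψ x / gauss m 1 x) (Set.Icc (δ / 2) R) := by
    refine (hc.div (continuousOn_gauss m 1) fun x hx => gauss_ne_zero m 1 hx).mono fun x hx => ?_
    exact lt_of_lt_of_le (half_pos hδ0) hx.1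
  obtain ⟨K, hK⟩ := isCompact_Icc.exists_bound_of_continuousOn hq
  refine (memLp_gauss hm (z := 1) (by simp)).of_le_mul (c := max K (‖A‖ * Real.exp (δ ^ 2 / 2)))
    (hc.aestronglyMeasurable measurableSet_Ioi) ?_
  filter_upwards [ae_restrict_mem measurableSet_Ioi] with x hx
  have hx' : 0 < x := hx
  have hg : 0 < ‖gauss m 1 x‖ := norm_pos_iff.2 (gauss_ne_zero m 1 hx)
  rw [← div_le_iff₀ hg, ← norm_div]
  rcases lt_or_ge x δ with h | h
  · refine le_max_of_le_right ?_
    have e : ψ x / gauss m 1 x = A * Complex.exp ((x ^ 2 / 2 : ℝ)) := by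
      have h2 : ψ x = A * (x : ℂ) ^ (1 / 2 + m) := hδ' ⟨hx, h⟩
      rw [div_eq_iff (gauss_ne_zero m 1 hx), h2, gauss, mul_assoc, mul_left_comm (Complex.exp _),
        ← Complex.exp_add]
      push_cast
      simp
    rw [e, norm_mul, Complex.norm_exp_ofReal]
    gcongr
  · rcases lt_or_ge R x with h' | h'
    · rw [hR x h'.le, zero_div, norm_zero]
      exact le_max_of_le_right (by positivity)
    · exact le_max_of_le_left (hK x ⟨by linarith, h'⟩)

theorem Admissible.memLp (hm : -1 < m.re) (h : Admissible m A φ) : MemLp φ 2 halfLine :=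
  memLp_of_eventually hm h.smooth.continuousOn h.eventually_atTop h.eventually_zero

theorem Admissible.hasDerivAt (h : Admissible m A φ) {x : ℝ} (hx : 0 < x) :
    HasDerivAt φ (deriv φ x) x :=
  ((h.smooth.contDiffAt (Ioi_mem_nhds hx)).differentiableAt (by simp)).hasDerivAt

theorem Admissible.contDiffOn_deriv (h : Admissible m A φ) :
    ContDiffOn ℝ ∞ (deriv φ) (Set.Ioi 0) :=
  ((contDiffOn_infty_iff_deriv_of_isOpen isOpen_Ioi).1 h.smooth).2

theorem Admissible.contDiffOn_deriv_deriv (h : Admissible m A φ) :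
    ContDiffOn ℝ ∞ (deriv (deriv φ)) (Set.Ioi 0) :=
  ((contDiffOn_infty_iff_deriv_of_isOpen isOpen_Ioi).1 h.contDiffOn_deriv).2

theorem Admissible.hasDerivAt_deriv (h : Admissible m A φ) {x : ℝ} (hx : 0 < x) :
    HasDerivAt (deriv φ) (deriv (deriv φ) x) x :=
  ((h.contDiffOn_deriv.contDiffAt (Ioi_mem_nhds hx)).differentiableAt (by simp)).hasDerivAt

theorem eventually_eventually_nhdsGT {p : ℝ → Prop} (h : ∀ᶠ x in 𝓝[>] (0 : ℝ), p x) :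
    ∀ᶠ x in 𝓝[>] (0 : ℝ), 0 < x ∧ ∀ᶠ y in 𝓝 x, p y := by
  obtain ⟨δ, hδ, hδ'⟩ := mem_nhdsGT_iff_exists_Ioo_subset.1 h
  filter_upwards [Ioo_mem_nhdsGT hδ] with x hx
  exact ⟨hx.1, Filter.mem_of_superset (Ioo_mem_nhds hx.1 hx.2) hδ'⟩

theorem eventually_eventually_atTop {p : ℝ → Prop} (h : ∀ᶠ x in atTop, p x) :
    ∀ᶠ x in atTop, ∀ᶠ y in 𝓝 x, p y := by
  obtain ⟨R, hR⟩ := eventually_atTop.1 h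
  filter_upwards [eventually_gt_atTop R] with x hx
  filter_upwards [Ioi_mem_nhds hx] with y hy using hR y (le_of_lt hy)

theorem Admissible.deriv_eventually_zero (h : Admissible m A φ) :
    ∀ᶠ x in 𝓝[>] (0 : ℝ), deriv φ x = A * ((1 / 2 + m) * (x : ℂ) ^ (1 / 2 + m - 1)) := by
  filter_upwards [eventually_eventually_nhdsGT h.eventually_zero] with x hx
  rw [EventuallyEq.deriv_eq hx.2]
  exact ((hasDerivAt_ofReal_cpow (1 / 2 + m) hx.1).const_mul A).deriv

/-- The power `x^{1/2+m}` solves the homogeneous equation, since `(1/2+m)(m-1/2) = m² - 1/4`. -/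
theorem Admissible.diffExpr_eventually_zero (h : Admissible m A φ) :
    ∀ᶠ x in 𝓝[>] (0 : ℝ), diffExpr (m ^ 2) φ x = 0 := by
  filter_upwards [h.eventually_zero, eventually_eventually_nhdsGT h.deriv_eventually_zero]
    with x h1 hx
  have hx0 : (x : ℂ) ≠ 0 := by exact_mod_cast hx.1.ne'
  rw [diffExpr, h1, EventuallyEq.deriv_eq hx.2,
    (((hasDerivAt_ofReal_cpow (1 / 2 + m - 1) hx.1).const_mul (1 / 2 + m)).const_mul A).deriv,
    Complex.cpow_sub _ _ hx0, Complex.cpow_sub _ _ hx0, Complex.cpow_one]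
  field_simp
  ring

theorem Admissible.diffExpr_eventually_atTop (h : Admissible m A φ) :
    ∀ᶠ x in atTop, diffExpr (m ^ 2) φ x = 0 := by
  filter_upwards [h.eventually_atTop, eventually_eventually_atTop
    (eventually_eventually_atTop h.eventually_atTop)] with x h1 h2
  have h3 : deriv φ =ᶠ[𝓝 x] fun _ => 0 := by
    filter_upwards [h2] with y hy
    rw [EventuallyEq.deriv_eq (f := fun _ => 0) hy]
    simp
  rw [diffExpr, h1, h3.deriv_eq]
  simp

theorem Admissible.continuousOn_diffExpr (h : Admissible m A φ) :
    ContinuousOn (diffExpr (m ^ 2) φ) (Set.Ioi 0) := by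
  refine h.contDiffOn_deriv_deriv.continuousOn.neg.add
    (ContinuousOn.mul (continuousOn_const.mul ?_) h.smooth.continuousOn)
  refine ContinuousOn.inv₀ (by fun_prop) fun x hx => ?_
  have hx0 : x ≠ 0 := ne_of_gt hx
  simpa using hx0

theorem Admissible.memLp_diffExpr (hm : -1 < m.re) (h : Admissible m A φ) :
    MemLp (diffExpr (m ^ 2) φ) 2 halfLine := by
  refine memLp_of_eventually (A := 0) hm h.continuousOn_diffExpr h.diffExpr_eventually_atTop ?_
  filter_upwards [h.diffExpr_eventually_zero] with x hx
  rw [hx, zero_mul]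

/-- Integration by parts against a Gaussian. -/
theorem Admissible.integral_diffExpr_mul_gauss (hm : -1 < m.re) (h : Admissible m A φ) {s : ℝ}
    (hs : 0 < s) : ∫ x, diffExpr (m ^ 2) φ x * gauss m s x ∂halfLine
      = ∫ x, φ x * ((2 * (m + 1) * s - (s : ℂ) ^ 2 * x ^ 2) * gauss m s x) ∂halfLine := by
  have hL : MemLp (fun x : ℝ => (2 * (m + 1) * s - (s : ℂ) ^ 2 * x ^ 2) * gauss m s x) 2 halfLine :=
    (memLp_congr_ae (coeFn_lapGauss hm hs)).1 (Lp.memLp _)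
  have i1 : Integrable (fun x => diffExpr (m ^ 2) φ x * gauss m s x) halfLine :=
    MemLp.integrable_mul (p := 2) (q := 2) (h.memLp_diffExpr hm) (memLp_gauss hm (by simpa using hs))
  have i2 : Integrable (fun x : ℝ => φ x *
      ((2 * (m + 1) * s - (s : ℂ) ^ 2 * x ^ 2) * gauss m s x)) halfLine :=
    MemLp.integrable_mul (p := 2) (q := 2) (h.memLp hm) hL
  rw [← sub_eq_zero, ← integral_sub i1 i2]
  -- The primitive is the Wronskian `φ g' - φ' g` with `g` the Gaussian; its derivative is `(Lφ) g -
  -- φ (L g)`.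
  refine integral_halfLine_eq_zero_of_hasDerivAt
    (f := fun x : ℝ => φ x * (((1 / 2 + m) / x - s * x) * gauss m s x) - deriv φ x * gauss m s x)
    (fun x hx => ?_) (i1.sub i2) ?_ ?_
  · refine (((h.hasDerivAt hx).mul (hasDerivAt_deriv_gauss m s hx)).sub
      ((h.hasDerivAt_deriv hx).mul (hasDerivAt_gauss m s hx))).congr_deriv ?_
    rw [diffExpr]
    ring
  -- Near `0` both functions have the same leading power, so the leading terms of the Wronskian
  -- cancel and `-A s x^{2m+2} e^{-sx²/2}` remains. It tends to `0` exactly because `Re m > -1`.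
  · have e : (fun x : ℝ => -(A * s) * ((x : ℂ) ^ (2 * m + 2) * Complex.exp (-(s * x ^ 2 / 2))))
        =ᶠ[𝓝[>] 0] fun x : ℝ => φ x * (((1 / 2 + m) / x - s * x) * gauss m s x)
          - deriv φ x * gauss m s x := by
      filter_upwards [h.eventually_zero, h.deriv_eventually_zero, self_mem_nhdsWithin]
        with x h1 h2 hx
      have hx0 : (x : ℂ) ≠ 0 := by exact_mod_cast (ne_of_gt hx)
      rw [h1, h2, gauss, Complex.cpow_sub _ _ hx0, Complex.cpow_one,
        show (2 * m + 2) = (1 / 2 + m) + (1 / 2 + m) + 1 by ring, Complex.cpow_add _ _ hx0,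
        Complex.cpow_add _ _ hx0, Complex.cpow_one]
      field_simp
      ring
    refine Tendsto.congr' e ?_
    rw [← mul_zero (-(A * (s : ℂ)))]
    refine Tendsto.const_mul _ (tendsto_zero_iff_norm_tendsto_zero.2 ?_)
    have hr : Tendsto (fun x : ℝ => x ^ (2 * m + 2).re * Real.exp (-(s * x ^ 2 / 2))) (𝓝[>] 0)
        (𝓝 (0 ^ (2 * m + 2).re * Real.exp (-(s * 0 ^ 2 / 2)))) := by
      refine ContinuousAt.continuousWithinAt (ContinuousAt.mul ?_ (by fun_prop))
      refine Real.continuousAt_rpow_const 0 _ (Or.inr ?_)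
      simp
      linarith
    rw [Real.zero_rpow (by simp; linarith), zero_mul] at hr
    refine hr.congr' ?_
    filter_upwards [self_mem_nhdsWithin] with x hx
    rw [norm_cpow_mul_gaussian _ _ hx, Complex.ofReal_re]
  · refine tendsto_const_nhds.congr' ?_
    filter_upwards [h.eventually_atTop, eventually_eventually_atTop h.eventually_atTop]
      with x h1 h2
    rw [h1, EventuallyEq.deriv_eq (f := fun _ => 0) h2]
    simp

/-- Admissible functions belong to the domain of the generator of the Hankel group. -/
theorem Admissible.mem_hankelGroup_graph (hm : -1 < m.re) (h : Admissible m A φ) {a b : L2}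
    (ha : a =ᵐ[halfLine] φ) (hb : b =ᵐ[halfLine] diffExpr (m ^ 2) φ) :
    (a, b) ∈ generatorGraph (hankelGroup m hm) := by
  refine mem_hankelGroup_graph_of_pairing hm fun s hs => ?_
  rw [pairing_eq_integral hb (coeFn_gaussL2 hm (z := s) (by simpa using hs)),
    pairing_eq_integral ha (coeFn_lapGauss hm hs)]
  exact h.integral_diffExpr_mul_gauss hm hs

theorem IsTest.admissible (h : IsTest φ) (m : ℂ) : Admissible m 0 φ where
  smooth := h.1.contDiffOn
  eventually_atTop := by
    have h1 := hasCompactSupport_iff_eventuallyEq.1 h.2.1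
    rw [coclosedCompact_eq_cocompact] at h1
    exact h1.filter_mono atTop_le_cocompact
  eventually_zero := by
    have h1 : φ =ᶠ[𝓝 0] 0 :=
      notMem_tsupport_iff_eventuallyEq.1 fun h0 => lt_irrefl (0 : ℝ) (h.2.2 h0)
    filter_upwards [h1.filter_mono nhdsWithin_le_nhds] with x hx
    rw [hx, Pi.zero_apply, zero_mul]

theorem diffExpr_congr {α : ℂ} {φ ψ : ℝ → ℂ} {x : ℝ} (h : φ =ᶠ[𝓝 x] ψ) :
    diffExpr α φ x = diffExpr α ψ x := by
  rw [diffExpr, diffExpr, h.eq_of_nhds, h.deriv.deriv_eq]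

/-- With `A = 0` the function vanishes near `0` and near `∞`. Its values on `]-∞,0]` are
unconstrained, so the test function is its extension by zero from the half-line. -/
theorem Admissible.mem_testGraph (h : Admissible m 0 φ) {a b : L2}
    (ha : a =ᵐ[halfLine] φ) (hb : b =ᵐ[halfLine] diffExpr (m ^ 2) φ) :
    (a, b) ∈ testGraph (m ^ 2) := by
  have hφ (x : ℝ) (hx : 0 < x) : (Set.Ioi 0).indicator φ =ᶠ[𝓝 x] φ := by
    filter_upwards [Ioi_mem_nhds hx] with y hy
    rw [Set.indicator_of_mem hy]
  refine ⟨(Set.Ioi 0).indicator φ, ?_, ?_, ?_⟩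
  · obtain ⟨R, hR⟩ := Filter.eventually_atTop.1 h.eventually_atTop
    obtain ⟨δ, hδ, hδ'⟩ := mem_nhdsGT_iff_exists_Ioo_subset.1 h.eventually_zero
    have hz (x : ℝ) (hx : x < δ) : (Set.Ioi 0).indicator φ x = 0 := by
      rcases le_or_gt x 0 with h0 | h0
      · exact Set.indicator_of_notMem (not_lt.2 h0) _
      · rw [Set.indicator_of_mem (show x ∈ Set.Ioi 0 from h0)]
        have h2 : φ x = 0 * (x : ℂ) ^ (1 / 2 + m) := hδ' ⟨h0, hx⟩
        rw [h2, zero_mul]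
    have hsupp : Function.support ((Set.Ioi 0).indicator φ) ⊆ Set.Icc δ R := by
      intro x hx
      refine ⟨not_lt.1 fun h1 => hx (hz x h1), not_lt.1 fun h1 => hx ?_⟩
      rw [Set.indicator_apply_eq_zero]
      exact fun _ => hR x h1.le
    have hts := closure_minimal hsupp isClosed_Icc
    refine ⟨contDiff_iff_contDiffAt.2 fun x => ?_, HasCompactSupport.intro' isCompact_Icc
      isClosed_Icc fun x hx => Function.notMem_support.1 fun h1 => hx (hsupp h1), fun x hx =>
      lt_of_lt_of_le hδ (hts hx).1⟩
    rcases lt_or_ge x δ with h1 | h1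
    · refine (contDiffAt_const (c := (0 : ℂ))).congr_of_eventuallyEq ?_
      filter_upwards [Iio_mem_nhds h1] with y hy using hz y hy
    · have hx : 0 < x := lt_of_lt_of_le hδ h1
      exact (h.smooth.contDiffAt (Ioi_mem_nhds hx)).congr_of_eventuallyEq (hφ x hx)
  · filter_upwards [ha, ae_restrict_mem measurableSet_Ioi] with x h1 hx
    rw [h1, Set.indicator_of_mem hx]
  · filter_upwards [hb, ae_restrict_mem measurableSet_Ioi] with x h1 hx
    rw [h1, diffExpr_congr (hφ x hx)]

theorem Admissible.sub_const_mul {B : ℂ} {ψ : ℝ → ℂ} (h : Admissible m A φ)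
    (h' : Admissible m 1 ψ) (hB : B = A) : Admissible m 0 (fun x => φ x - B * ψ x) where
  smooth := h.smooth.sub (contDiffOn_const.mul h'.smooth)
  eventually_atTop := by
    filter_upwards [h.eventually_atTop, h'.eventually_atTop] with x h1 h2
    rw [h1, h2, mul_zero, sub_zero]
  eventually_zero := by
    filter_upwards [h.eventually_zero, h'.eventually_zero] with x h1 h2
    rw [h1, h2, hB]
    ring

theorem Admissible.diffExpr_sub_const_mul {B : ℂ} {ψ : ℝ → ℂ} (h : Admissible m A φ)
    (h' : Admissible m 1 ψ) {x : ℝ} (hx : 0 < x) :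
    diffExpr (m ^ 2) (fun x => φ x - B * ψ x) x
      = diffExpr (m ^ 2) φ x - B * diffExpr (m ^ 2) ψ x := by
  have h1 : deriv (fun x => φ x - B * ψ x) =ᶠ[𝓝 x] fun x => deriv φ x - B * deriv ψ x := by
    filter_upwards [Ioi_mem_nhds hx] with y hy
    exact ((h.hasDerivAt hy).sub ((h'.hasDerivAt hy).const_mul B)).deriv
  have h2 : deriv (fun x => deriv φ x - B * deriv ψ x) x
      = deriv (deriv φ) x - B * deriv (deriv ψ) x :=
    ((h.hasDerivAt_deriv hx).sub ((h'.hasDerivAt_deriv hx).const_mul B)).deriv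
  rw [diffExpr, h1.deriv_eq, h2, diffExpr, diffExpr]
  ring

theorem contDiffOn_ofReal_cpow (a : ℂ) : ContDiffOn ℝ ∞ (fun x : ℝ => (x : ℂ) ^ a) (Set.Ioi 0) := by
  have h : ContDiffOn ℝ ∞ (fun x : ℝ => Complex.exp (Real.log x * a)) (Set.Ioi 0) := by
    refine Complex.contDiff_exp.comp_contDiffOn (ContDiffOn.mul ?_ contDiffOn_const)
    refine Complex.ofRealCLM.contDiff.comp_contDiffOn ?_
    exact Real.contDiffOn_log.mono fun x hx => ne_of_gt hx
  exact h.congr fun x hx => cpow_ofReal_pos hx a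

theorem admissible_cutoff {ξ : ℝ → ℝ} (hξ : IsCutoff ξ) (m : ℂ) :
    Admissible m 1 fun x => (x : ℂ) ^ (1 / 2 + m) * (ξ x : ℂ) where
  smooth := (contDiffOn_ofReal_cpow _).mul
    (Complex.ofRealCLM.contDiff.comp_contDiffOn hξ.smooth.contDiffOn)
  eventually_atTop := by
    have h1 := hasCompactSupport_iff_eventuallyEq.1 hξ.compact
    rw [coclosedCompact_eq_cocompact] at h1
    filter_upwards [h1.filter_mono atTop_le_cocompact] with x hx
    rw [hx, Pi.zero_apply, Complex.ofReal_zero, mul_zero]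
  eventually_zero := by
    filter_upwards [hξ.one_near_zero.filter_mono nhdsWithin_le_nhds] with x hx
    rw [hx, Complex.ofReal_one, mul_one, one_mul]

end Admissible

/-! ### Logarithmic cutoffs of Gaussians -/

section LogCutoff

/-- A smooth bump function on `ℝ`, equal to `1` on `[-1, 1]` and vanishing outside `]-2, 2[`. -/
noncomputable def bump : ContDiffBump (0 : ℝ) := ⟨1, 2, one_pos, one_lt_two⟩

/-- A cutoff of the half-line at a logarithmic scale. -/
noncomputable def logCut (n : ℕ) (x : ℝ) : ℝ := bump (Real.log x / (n + 1))

theorem logCut_nonneg (n : ℕ) (x : ℝ) : 0 ≤ logCut n x := bump.nonneg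

theorem logCut_le_one (n : ℕ) (x : ℝ) : logCut n x ≤ 1 := bump.le_one

theorem tendsto_log_div (x : ℝ) : Tendsto (fun n : ℕ => Real.log x / ((n : ℝ) + 1)) atTop (𝓝 0) :=
  tendsto_const_nhds.div_atTop (tendsto_atTop_add_const_right _ _ tendsto_natCast_atTop_atTop)

theorem tendsto_logCut (x : ℝ) : Tendsto (fun n => logCut n x) atTop (𝓝 1) := by
  have h := (bump.continuous.tendsto 0).comp (tendsto_log_div x)
  rwa [bump.one_of_mem_closedBall (Metric.mem_closedBall_self bump.rIn_pos.le)] at h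

theorem logCut_eventually_atTop (n : ℕ) : ∀ᶠ x in atTop, logCut n x = 0 := by
  filter_upwards [Real.tendsto_log_atTop.eventually_ge_atTop (2 * ((n : ℝ) + 1))] with x hx
  refine bump.zero_of_le_dist ?_
  have hn : (0 : ℝ) < n + 1 := by positivity
  rw [Real.dist_eq, sub_zero]
  exact ((le_div_iff₀ hn).2 hx).trans (le_abs_self _)

theorem logCut_eventually_zero (n : ℕ) : ∀ᶠ x in 𝓝[>] (0 : ℝ), logCut n x = 0 := by
  filter_upwards [Real.tendsto_log_nhdsGT_zero.eventually_le_atBot (-(2 * ((n : ℝ) + 1)))] with x hx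
  refine bump.zero_of_le_dist ?_
  have hn : (0 : ℝ) < n + 1 := by positivity
  rw [Real.dist_eq, sub_zero]
  refine le_trans ?_ (neg_le_abs _)
  rw [← neg_div]
  exact (le_div_iff₀ hn).2 (by change (2 : ℝ) * _ ≤ _; linarith)

theorem measurable_logCut (n : ℕ) : Measurable (logCut n) :=
  bump.continuous.measurable.comp (Real.measurable_log.div_const _)

theorem contDiffOn_logCut (n : ℕ) : ContDiffOn ℝ ∞ (logCut n) (Set.Ioi 0) :=
  bump.contDiff.comp_contDiffOn
    ((Real.contDiffOn_log.mono fun _ hx => ne_of_gt hx).div_const _)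

theorem hasDerivAt_logCut (n : ℕ) {x : ℝ} (hx : 0 < x) :
    HasDerivAt (logCut n) (deriv bump (Real.log x / (n + 1)) * (x⁻¹ / (n + 1))) x :=
  HasDerivAt.comp x
    ((bump.contDiff (n := 1)).differentiable (by simp) _).hasDerivAt
    ((Real.hasDerivAt_log hx.ne').div_const _)

theorem exists_bound_deriv_bump : ∃ C : ℝ, ∀ x, |deriv bump x| ≤ C :=
  bump.hasCompactSupport.deriv.exists_bound_of_continuous
    ((bump.contDiff (n := 1)).continuous_deriv le_rfl)

/-- The negative derivative of `e^{-su²/2}`, cut off near `0` and `∞`. -/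
noncomputable def cutWeight (s : ℝ) (n : ℕ) (u : ℝ) : ℝ :=
  s * u * Real.exp (-(s * u ^ 2 / 2)) * logCut n u

/-- A primitive of `-cutWeight s n`, which approximates `e^{-sx²/2}`. -/
noncomputable def cutExp (s : ℝ) (n : ℕ) (x : ℝ) : ℝ := ∫ u in Set.Ioi x, cutWeight s n u

variable {s : ℝ}

theorem hasDerivAt_exp_sq (s x : ℝ) :
    HasDerivAt (fun x => Real.exp (-(s * x ^ 2 / 2))) (-(s * x * Real.exp (-(s * x ^ 2 / 2)))) x := by
  have h : HasDerivAt (fun x => -(s * x ^ 2 / 2)) (-(s * x)) x := by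
    refine ((((hasDerivAt_pow 2 x).const_mul s).div_const 2).neg).congr_deriv ?_
    simp only [Nat.cast_ofNat]
    ring
  exact h.exp.congr_deriv (by ring)

theorem tendsto_exp_sq (hs : 0 < s) :
    Tendsto (fun x : ℝ => -Real.exp (-(s * x ^ 2 / 2))) atTop (𝓝 0) := by
  have h : Tendsto (fun x : ℝ => s * x ^ 2 / 2) atTop atTop :=
    ((tendsto_pow_atTop two_ne_zero).const_mul_atTop hs).atTop_div_const two_pos
  simpa using (Real.tendsto_exp_neg_atTop_nhds_zero.comp h).neg

theorem integrableOn_exp_sq (hs : 0 < s) {x : ℝ} (hx : 0 ≤ x) :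
    IntegrableOn (fun u => s * u * Real.exp (-(s * u ^ 2 / 2))) (Set.Ioi x) :=
  integrableOn_Ioi_deriv_of_nonneg'
    (fun u _ => (hasDerivAt_exp_sq s u).neg.congr_deriv (neg_neg _))
    (fun u hu => by have := hx.trans_lt hu; positivity) (tendsto_exp_sq hs)

theorem integral_exp_sq (hs : 0 < s) {x : ℝ} (hx : 0 ≤ x) :
    ∫ u in Set.Ioi x, s * u * Real.exp (-(s * u ^ 2 / 2)) = Real.exp (-(s * x ^ 2 / 2)) := by
  rw [integral_Ioi_of_hasDerivAt_of_nonneg'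
    (fun u _ => (hasDerivAt_exp_sq s u).neg.congr_deriv (neg_neg _))
    (fun u hu => by have := hx.trans_lt hu; positivity) (tendsto_exp_sq hs)]
  simp

theorem measurable_cutWeight (s : ℝ) (n : ℕ) : Measurable (cutWeight s n) :=
  Measurable.mul (by fun_prop) (measurable_logCut n)

theorem cutWeight_nonneg (hs : 0 < s) (n : ℕ) {u : ℝ} (hu : 0 < u) : 0 ≤ cutWeight s n u := by
  have := logCut_nonneg n u
  rw [cutWeight]
  positivity

theorem cutWeight_le (hs : 0 < s) (n : ℕ) {u : ℝ} (hu : 0 < u) :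
    cutWeight s n u ≤ s * u * Real.exp (-(s * u ^ 2 / 2)) :=
  mul_le_of_le_one_right (by positivity) (logCut_le_one n u)

theorem ae_norm_cutWeight_le (hs : 0 < s) (n : ℕ) {x : ℝ} (hx : 0 ≤ x) :
    ∀ᵐ u ∂volume.restrict (Set.Ioi x),
      ‖cutWeight s n u‖ ≤ s * u * Real.exp (-(s * u ^ 2 / 2)) := by
  filter_upwards [ae_restrict_mem measurableSet_Ioi] with u hu
  have hu0 : 0 < u := hx.trans_lt hu
  rw [Real.norm_of_nonneg (cutWeight_nonneg hs n hu0)]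
  exact cutWeight_le hs n hu0

theorem integrableOn_cutWeight (hs : 0 < s) (n : ℕ) {x : ℝ} (hx : 0 ≤ x) :
    IntegrableOn (cutWeight s n) (Set.Ioi x) :=
  (integrableOn_exp_sq hs hx).mono' (measurable_cutWeight s n).aestronglyMeasurable
    (ae_norm_cutWeight_le hs n hx)

theorem cutExp_nonneg (hs : 0 < s) (n : ℕ) {x : ℝ} (hx : 0 ≤ x) : 0 ≤ cutExp s n x :=
  setIntegral_nonneg measurableSet_Ioi fun _ hu => cutWeight_nonneg hs n (hx.trans_lt hu)

theorem cutExp_le (hs : 0 < s) (n : ℕ) {x : ℝ} (hx : 0 ≤ x) :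
    cutExp s n x ≤ Real.exp (-(s * x ^ 2 / 2)) := by
  rw [← integral_exp_sq hs hx]
  exact setIntegral_mono_on (integrableOn_cutWeight hs n hx) (integrableOn_exp_sq hs hx)
    measurableSet_Ioi fun _ hu => cutWeight_le hs n (hx.trans_lt hu)

theorem tendsto_cutExp (hs : 0 < s) {x : ℝ} (hx : 0 ≤ x) :
    Tendsto (fun n => cutExp s n x) atTop (𝓝 (Real.exp (-(s * x ^ 2 / 2)))) := by
  rw [← integral_exp_sq hs hx]
  refine tendsto_integral_of_dominated_convergence _
    (fun n => (measurable_cutWeight s n).aestronglyMeasurable) (integrableOn_exp_sq hs hx)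
    (fun n => ae_norm_cutWeight_le hs n hx) (ae_of_all _ fun u => ?_)
  have h := (tendsto_logCut u).const_mul (s * u * Real.exp (-(s * u ^ 2 / 2)))
  rwa [mul_one] at h

theorem contDiffOn_cutWeight (s : ℝ) (n : ℕ) : ContDiffOn ℝ ∞ (cutWeight s n) (Set.Ioi 0) :=
  ContDiffOn.mul (by fun_prop) (contDiffOn_logCut n)

theorem hasDerivAt_cutExp (hs : 0 < s) (n : ℕ) {x : ℝ} (hx : 0 < x) :
    HasDerivAt (cutExp s n) (-cutWeight s n x) x := by
  have hI (y : ℝ) (hy : 0 < y) : IntervalIntegrable (cutWeight s n) volume (x / 2) y := by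
    rw [intervalIntegrable_iff]
    exact (integrableOn_cutWeight hs n le_rfl).mono_set fun u hu =>
      (lt_min (half_pos hx) hy).trans hu.1
  have h1 : HasDerivAt (fun y => ∫ u in (x / 2)..y, cutWeight s n u) (cutWeight s n x) x :=
    intervalIntegral.integral_hasDerivAt_right (hI x hx)
      (measurable_cutWeight s n).stronglyMeasurable.stronglyMeasurableAtFilter
      ((contDiffOn_cutWeight s n).continuousOn.continuousAt (Ioi_mem_nhds hx))
  refine (h1.const_sub (∫ u in Set.Ioi (x / 2), cutWeight s n u)).congr_of_eventuallyEq ?_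
  filter_upwards [Ioi_mem_nhds hx] with y hy
  rw [cutExp, ← intervalIntegral.integral_interval_add_Ioi
    (integrableOn_cutWeight hs n (half_pos hx).le) (integrableOn_cutWeight hs n (le_of_lt hy))]
  ring

theorem contDiffOn_cutExp (hs : 0 < s) (n : ℕ) : ContDiffOn ℝ ∞ (cutExp s n) (Set.Ioi 0) := by
  rw [contDiffOn_infty_iff_deriv_of_isOpen isOpen_Ioi]
  exact ⟨fun x hx => (hasDerivAt_cutExp hs n hx).differentiableAt.differentiableWithinAt,
    (contDiffOn_cutWeight s n).neg.congr fun x hx => (hasDerivAt_cutExp hs n hx).deriv⟩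

theorem cutExp_eventually_atTop (s : ℝ) (n : ℕ) : ∀ᶠ x in atTop, cutExp s n x = 0 := by
  obtain ⟨R, hR⟩ := eventually_atTop.1 (logCut_eventually_atTop n)
  filter_upwards [eventually_ge_atTop R] with x hx
  refine setIntegral_eq_zero_of_forall_eq_zero fun u hu => ?_
  rw [cutWeight, hR u (hx.trans (le_of_lt hu)), mul_zero]

theorem cutExp_eventually_zero (hs : 0 < s) (n : ℕ) :
    ∀ᶠ x in 𝓝[>] (0 : ℝ), cutExp s n x = cutExp s n 0 := by
  obtain ⟨δ, hδ, hδ'⟩ := mem_nhdsGT_iff_exists_Ioo_subset.1 (logCut_eventually_zero n)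
  filter_upwards [Ioo_mem_nhdsGT hδ] with x hx
  have hz : ∫ u in Set.Ioc 0 x, cutWeight s n u = 0 := by
    refine setIntegral_eq_zero_of_forall_eq_zero fun u hu => ?_
    have h : logCut n u = 0 := hδ' ⟨hu.1, hu.2.trans_lt hx.2⟩
    rw [cutWeight, h, mul_zero]
  rw [cutExp, cutExp, ← intervalIntegral.integral_interval_add_Ioi
    (integrableOn_cutWeight hs n le_rfl) (integrableOn_cutWeight hs n hx.1.le),
    intervalIntegral.integral_of_le hx.1.le, hz, zero_add]

/-- The approximation `x^{1/2+m} cutExp s n` of a Gaussian. -/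
noncomputable def cutGauss (m : ℂ) (s : ℝ) (n : ℕ) (x : ℝ) : ℂ :=
  (x : ℂ) ^ (1 / 2 + m) * (cutExp s n x : ℂ)

/-- Cutting off the derivative of the Gaussian factor rather than the factor itself makes `cutExp`
constant near `0`, so the boundary behaviour stays an exact multiple of `x^{1/2+m}`. -/
theorem admissible_cutGauss (m : ℂ) (hs : 0 < s) (n : ℕ) :
    Admissible m (cutExp s n 0) (cutGauss m s n) where
  smooth := (contDiffOn_ofReal_cpow _).mul
    (Complex.ofRealCLM.contDiff.comp_contDiffOn (contDiffOn_cutExp hs n))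
  eventually_atTop := by
    filter_upwards [cutExp_eventually_atTop s n] with x hx
    rw [cutGauss, hx, Complex.ofReal_zero, mul_zero]
  eventually_zero := by
    filter_upwards [cutExp_eventually_zero hs n] with x hx
    rw [cutGauss, hx, mul_comm]

theorem gauss_ofReal (m : ℂ) (s x : ℝ) :
    gauss m s x = (x : ℂ) ^ (1 / 2 + m) * (Real.exp (-(s * x ^ 2 / 2)) : ℂ) := by
  rw [gauss]
  push_cast
  rfl

/-- The power `x^{1/2+m}` being a homogeneous solution, only derivatives of `cutExp` enter. At a
logarithmic scale `x · logCut'` is of size `1/(n+1)` uniformly in `x`, so the last term is a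
vanishing multiple of the Gaussian itself. -/
theorem diffExpr_cutGauss (m : ℂ) (hs : 0 < s) (n : ℕ) {x : ℝ} (hx : 0 < x) :
    diffExpr (m ^ 2) (cutGauss m s n) x
      = (logCut n x : ℂ) * ((2 * (m + 1) * s - (s : ℂ) ^ 2 * x ^ 2) * gauss m s x)
        + ((s * deriv bump (Real.log x / (n + 1)) / (n + 1) : ℝ) : ℂ) * gauss m s x := by
  have hx0 : (x : ℂ) ≠ 0 := by exact_mod_cast hx.ne'
  have hn : ((n : ℂ) + 1) ≠ 0 := by exact_mod_cast Nat.succ_ne_zero n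
  have d1 (y : ℝ) (hy : 0 < y) : HasDerivAt (cutGauss m s n)
      ((1 / 2 + m) * (y : ℂ) ^ (1 / 2 + m - 1) * (cutExp s n y : ℂ)
        + (y : ℂ) ^ (1 / 2 + m) * (-cutWeight s n y : ℝ)) y :=
    (hasDerivAt_ofReal_cpow (1 / 2 + m) hy).mul (hasDerivAt_cutExp hs n hy).ofReal_comp
  have dw : HasDerivAt (cutWeight s n) ((s * Real.exp (-(s * x ^ 2 / 2))
      - (s * x) ^ 2 * Real.exp (-(s * x ^ 2 / 2))) * logCut n x + s * Real.exp (-(s * x ^ 2 / 2)) *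
        (deriv bump (Real.log x / (n + 1)) / (n + 1))) x := by
    refine ((((hasDerivAt_id x).const_mul s).mul (hasDerivAt_exp_sq s x)).mul
      (hasDerivAt_logCut n hx)).congr_deriv ?_
    have := hx.ne'
    simp only [id_eq, Pi.mul_apply]
    field_simp
    ring
  have d2 : HasDerivAt (fun y : ℝ => (1 / 2 + m) * (y : ℂ) ^ (1 / 2 + m - 1) * (cutExp s n y : ℂ)
        + (y : ℂ) ^ (1 / 2 + m) * (-cutWeight s n y : ℝ)) _ x :=
    (((hasDerivAt_ofReal_cpow (1 / 2 + m - 1) hx).const_mul (1 / 2 + m)).mul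
      (hasDerivAt_cutExp hs n hx).ofReal_comp).add
      ((hasDerivAt_ofReal_cpow (1 / 2 + m) hx).mul dw.neg.ofReal_comp)
  have e : deriv (cutGauss m s n) =ᶠ[𝓝 x]
      fun y : ℝ => (1 / 2 + m) * (y : ℂ) ^ (1 / 2 + m - 1) * (cutExp s n y : ℂ)
        + (y : ℂ) ^ (1 / 2 + m) * (-cutWeight s n y : ℝ) := by
    filter_upwards [Ioi_mem_nhds hx] with y hy using (d1 y hy).deriv
  rw [diffExpr, e.deriv_eq, d2.deriv, gauss_ofReal, cutGauss, cutWeight]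
  rw [Complex.cpow_sub _ _ hx0, Complex.cpow_sub _ _ hx0, Complex.cpow_one]
  generalize (x : ℂ) ^ (1 / 2 + m) = X
  generalize deriv bump (Real.log x / (n + 1)) = D
  generalize Real.exp (-(s * x ^ 2 / 2)) = ε
  push_cast
  field_simp
  ring

/-- The Gaussians belong to the closure of the operator on admissible functions. -/
theorem gaussL2_mem_of_admissible {m : ℂ} (hm : -1 < m.re) {P : Submodule ℂ (L2 × L2)}
    (hP : IsClosed (P : Set (L2 × L2)))
    (h : ∀ (A : ℂ) (φ : ℝ → ℂ), Admissible m A φ → ∀ a b : L2, a =ᵐ[halfLine] φ →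
      b =ᵐ[halfLine] diffExpr (m ^ 2) φ → (a, b) ∈ P) (hs : 0 < s) :
    (gaussL2 m s, lapGauss m s) ∈ P := by
  have hadm := admissible_cutGauss m hs
  set a : ℕ → L2 := fun n => ((hadm n).memLp hm).toLp with ha
  set b : ℕ → L2 := fun n => ((hadm n).memLp_diffExpr hm).toLp with hb
  have hmem (n : ℕ) : (a n, b n) ∈ P :=
    h _ _ (hadm n) _ _ (MemLp.coeFn_toLp _) (MemLp.coeFn_toLp _)
  have hg := memLp_gauss hm (z := s) (by simpa using hs)
  have hL : MemLp (fun x : ℝ => (2 * (m + 1) * s - (s : ℂ) ^ 2 * x ^ 2) * gauss m s x) 2 halfLine :=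
    (memLp_congr_ae (coeFn_lapGauss hm hs)).1 (Lp.memLp _)
  have ta : Tendsto a atTop (𝓝 (gaussL2 m s)) := by
    refine tendsto_L2_of_dominated (F' := fun n => cutGauss m s n) (g := fun x => ‖gauss m s x‖)
      (fun n => MemLp.coeFn_toLp _) (coeFn_gaussL2 hm (by simpa using hs)) hg.norm
      (Eventually.of_forall fun n => ?_) ?_
    · filter_upwards [ae_restrict_mem measurableSet_Ioi] with x hx
      have hx' : 0 ≤ x := le_of_lt hx
      rw [gauss_ofReal, cutGauss, ← mul_sub, norm_mul, norm_mul, ← Complex.ofReal_sub,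
        Complex.norm_real, Complex.norm_real]
      refine mul_le_mul_of_nonneg_left ?_ (norm_nonneg _)
      rw [Real.norm_eq_abs, Real.norm_eq_abs, abs_sub_comm,
        abs_of_nonneg (sub_nonneg.2 (cutExp_le hs n hx')), abs_of_pos (Real.exp_pos _)]
      exact sub_le_self _ (cutExp_nonneg hs n hx')
    · filter_upwards [ae_restrict_mem measurableSet_Ioi] with x hx
      rw [gauss_ofReal]
      exact ((Complex.continuous_ofReal.tendsto _).comp
        (tendsto_cutExp hs (le_of_lt hx))).const_mul _
  have tb : Tendsto b atTop (𝓝 (lapGauss m s)) := by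
    obtain ⟨C, hC⟩ := exists_bound_deriv_bump
    refine tendsto_L2_of_dominated
      (F' := fun n (x : ℝ) => (logCut n x : ℂ) *
        ((2 * (m + 1) * s - (s : ℂ) ^ 2 * x ^ 2) * gauss m s x)
        + ((s * deriv bump (Real.log x / (n + 1)) / (n + 1) : ℝ) : ℂ) * gauss m s x)
      (g := fun x : ℝ => ‖(2 * (m + 1) * s - (s : ℂ) ^ 2 * x ^ 2) * gauss m s x‖
        + s * C * ‖gauss m s x‖) (fun n => ?_) (coeFn_lapGauss hm hs)
      (hL.norm.add (hg.norm.const_mul (s * C))) (Eventually.of_forall fun n => ?_) ?_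
    · filter_upwards [((hadm n).memLp_diffExpr hm).coeFn_toLp, ae_restrict_mem measurableSet_Ioi]
        with x h1 hx
      rw [hb, h1, diffExpr_cutGauss m hs n hx]
    · refine ae_of_all _ fun x => ?_
      have h1 : ‖((logCut n x : ℂ) - 1)‖ ≤ 1 := by
        rw [← Complex.ofReal_one, ← Complex.ofReal_sub, Complex.norm_real, Real.norm_eq_abs,
          abs_le]
        have := logCut_nonneg n x
        have := logCut_le_one n x
        constructor <;> linarith
      have h2 : ‖((s * deriv bump (Real.log x / (n + 1)) / (n + 1) : ℝ) : ℂ)‖ ≤ s * C := by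
        rw [Complex.norm_real, Real.norm_eq_abs, abs_div, abs_mul, abs_of_pos hs]
        have hn : (1 : ℝ) ≤ |(n : ℝ) + 1| := by
          rw [abs_of_pos (by positivity)]
          simp
        exact (div_le_self (by positivity) hn).trans (mul_le_mul_of_nonneg_left (hC _) hs.le)
      rw [add_sub_right_comm, ← sub_one_mul]
      refine (norm_add_le _ _).trans (add_le_add ?_ ?_)
      · rw [norm_mul]
        exact mul_le_of_le_one_left (norm_nonneg _) h1
      · rw [norm_mul]
        exact mul_le_mul_of_nonneg_right h2 (norm_nonneg _)
    · refine ae_of_all _ fun x => ?_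
      have h1 := ((Complex.continuous_ofReal.tendsto _).comp (tendsto_logCut x)).mul_const
        ((2 * (m + 1) * s - (s : ℂ) ^ 2 * x ^ 2) * gauss m s x)
      have hd : Tendsto (fun n : ℕ => s * deriv bump (Real.log x / ((n : ℝ) + 1)) / ((n : ℝ) + 1))
          atTop (𝓝 0) := by
        refine Tendsto.div_atTop (a := s * deriv bump 0) ?_
          (tendsto_atTop_add_const_right _ _ tendsto_natCast_atTop_atTop)
        exact ((((bump.contDiff (n := 1)).continuous_deriv le_rfl).tendsto 0).comp
          (tendsto_log_div x)).const_mul s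
      have h2 := ((Complex.continuous_ofReal.tendsto _).comp hd).mul_const (gauss m s x)
      have h3 := h1.add h2
      rwa [Complex.ofReal_one, one_mul, Complex.ofReal_zero, zero_mul, add_zero] at h3
  exact hP.mem_of_tendsto (ta.prodMk_nhds tb) (Eventually.of_forall hmem)

end LogCutoff

/-! ### Identification of the generator with `H_m` -/

section Generator

variable {m : ℂ}

theorem testGraph_le_hankelGroup_graph (hm : -1 < m.re) :
    testGraph (m ^ 2) ≤ generatorGraph (hankelGroup m hm) := by
  rintro ⟨a, b⟩ ⟨φ, hφ, h1, h2⟩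
  exact (hφ.admissible m).mem_hankelGroup_graph hm h1 h2

/-- A test function lies in the domain of the generator, `ℱ_m` preserves the bilinear pairing, and
multiplication by `x²` is symmetric for it. This is the distributional identity. -/
theorem hankelGroup_graph_le_maxGraph (hm : -1 < m.re) :
    generatorGraph (hankelGroup m hm) ≤ maxGraph (m ^ 2) := by
  rintro ⟨f, g⟩ h φ hφ
  have hadm := hφ.admissible m
  set a : L2 := (hadm.memLp hm).toLp with ha
  set b : L2 := (hadm.memLp_diffExpr hm).toLp with hb
  have hac : a =ᵐ[halfLine] φ := MemLp.coeFn_toLp _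
  have hbc : b =ᵐ[halfLine] diffExpr (m ^ 2) φ := MemLp.coeFn_toLp _
  have h1 := hadm.mem_hankelGroup_graph hm hac hbc
  rw [mem_hankelGroup_graph] at h h1
  change ∫ x, g x * φ x ∂halfLine = ∫ x, f x * diffExpr (m ^ 2) φ x ∂halfLine
  rw [← pairing_eq_integral EventuallyEq.rfl hac, ← pairing_eq_integral EventuallyEq.rfl hbc,
    ← pairing_hankel_hankel hm, ← pairing_hankel_hankel hm f b,
    pairing_eq_integral EventuallyEq.rfl EventuallyEq.rfl,
    pairing_eq_integral EventuallyEq.rfl EventuallyEq.rfl]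
  refine integral_congr_ae ?_
  filter_upwards [h, h1] with x hx hx1
  rw [hx, hx1]
  ring

/-- The closure of the graph is again a graph because it lies inside the graph of the maximal
operator. -/
theorem Lmin_graph {α : ℂ} (h : (testGraph α).topologicalClosure ≤ maxGraph α) :
    (Lmin α).graph = (testGraph α).topologicalClosure := by
  apply Submodule.toLinearPMap_graph_eq
  rintro ⟨f, g⟩ hp (rfl : f = 0)
  have h1 := h hp
  rw [← Lmax_graph] at h1
  exact LinearPMap.graph_fst_eq_zero_snd _ h1 rfl

/-- The generator of the Hankel group is `H_m`. -/
theorem generator_hankelGroup (hm : -1 < m.re) {ξ : ℝ → ℝ} (hξ : IsCutoff ξ) :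
    generator (hankelGroup m hm) = schrodinger ξ m := by
  set G := generatorGraph (hankelGroup m hm) with hG
  have hadm := admissible_cutoff hξ m
  set v : L2 := (hadm.memLp hm).toLp with hv
  set w : L2 := (hadm.memLp_diffExpr hm).toLp with hw
  have hvc : v =ᵐ[halfLine] fun x => (x : ℂ) ^ (1 / 2 + m) * (ξ x : ℂ) := MemLp.coeFn_toLp _
  have hwc : w =ᵐ[halfLine] _ := MemLp.coeFn_toLp (hadm.memLp_diffExpr hm)
  have hvw : (v, w) ∈ G := hadm.mem_hankelGroup_graph hm hvc hwc
  have hmin : (testGraph (m ^ 2)).topologicalClosure ≤ G :=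
    Submodule.topologicalClosure_minimal _ (testGraph_le_hankelGroup_graph hm)
      (isClosed_hankelGroup_graph hm)
  have hmax : G ≤ maxGraph (m ^ 2) := hankelGroup_graph_le_maxGraph hm
  have hG' : G = (testGraph (m ^ 2)).topologicalClosure ⊔ Submodule.span ℂ {(v, w)} := by
    refine le_antisymm ?_ (sup_le hmin ((Submodule.span_singleton_le_iff_mem _ _).2 hvw))
    -- A closed subspace plus a line is closed, so by the core property it suffices to find the
    -- Gaussian pairs in it.
    have hP : IsClosed (((testGraph (m ^ 2)).topologicalClosure ⊔ Submodule.span ℂ {(v, w)} :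
        Submodule ℂ (L2 × L2)) : Set (L2 × L2)) :=
      Submodule.isClosed_sup_finiteDimensional _ _
        (Submodule.isClosed_topologicalClosure _)
    refine hankelGroup_graph_le_closure hm hP fun s hs => ?_
    refine gaussL2_mem_of_admissible hm hP (fun A φ h a b ha hb => ?_) hs
    -- Subtracting `A` times the cutoff `x^{1/2+m} ξ` removes the boundary behaviour and leaves a
    -- test function.
    have h1 : (a - A • v, b - A • w) ∈ testGraph (m ^ 2) := by
      refine (h.sub_const_mul hadm rfl).mem_testGraph ?_ ?_
      · filter_upwards [Lp.coeFn_sub a (A • v), Lp.coeFn_smul A v, ha, hvc] with x h1 h2 h3 h4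
        rw [h1, Pi.sub_apply, h2, Pi.smul_apply, h3, h4, smul_eq_mul]
      · filter_upwards [Lp.coeFn_sub b (A • w), Lp.coeFn_smul A w, hb, hwc,
          ae_restrict_mem measurableSet_Ioi] with x h1 h2 h3 h4 hx
        rw [h1, Pi.sub_apply, h2, Pi.smul_apply, h3, h4, smul_eq_mul,
          h.diffExpr_sub_const_mul hadm hx]
    have h2 : (a, b) = (a - A • v, b - A • w) + A • (v, w) := by
      rw [Prod.smul_mk, Prod.mk_add_mk, sub_add_cancel, sub_add_cancel]
    rw [h2]
    exact Submodule.add_mem_sup ((testGraph (m ^ 2)).le_topologicalClosure h1)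
      (Submodule.smul_mem _ _ (Submodule.mem_span_singleton_self _))
  have hset : {f : L2 | f =ᵐ[halfLine] fun x => (x : ℂ) ^ (1 / 2 + m) * (ξ x : ℂ)} = {v} := by
    ext f
    rw [Set.mem_ofPred_eq, Set.mem_singleton_iff]
    exact ⟨fun h => Lp.ext (h.trans hvc.symm), fun h => h ▸ hvc⟩
  have hdom : (generator (hankelGroup m hm)).domain
      = (Lmin (m ^ 2)).domain ⊔ Submodule.span ℂ {v} := by
    ext f
    rw [LinearPMap.mem_domain_iff, generator_graph, ← hG, hG', Submodule.mem_sup]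
    simp only [Submodule.mem_sup, Submodule.mem_span_singleton, LinearPMap.mem_domain_iff,
      Lmin_graph (hmin.trans hmax)]
    constructor
    · rintro ⟨y, ⟨p, hp, _, ⟨c, rfl⟩, h⟩⟩
      exact ⟨p.1, ⟨p.2, hp⟩, _, ⟨c, rfl⟩, congrArg Prod.fst h⟩
    · rintro ⟨a, ⟨b, hab⟩, _, ⟨c, rfl⟩, rfl⟩
      exact ⟨b + c • w, (a, b), hab, _, ⟨c, rfl⟩, rfl⟩
  have hle : generator (hankelGroup m hm) ≤ Lmax (m ^ 2) := by
    rw [← LinearPMap.le_graph_iff, generator_graph, Lmax_graph]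
    exact hmax
  rw [schrodinger, hset, ← hdom]
  refine LinearPMap.ext ?_ ?_
  · rw [LinearPMap.domRestrict_domain]
    exact (inf_eq_left.2 hle.1).symm
  · intro x hx hx'
    have h1 : generator (hankelGroup m hm) ⟨x, hx⟩ = Lmax (m ^ 2) ⟨x, hle.1 hx⟩ := hle.2 rfl
    rw [h1]
    exact (LinearPMap.domRestrict_apply (x := ⟨x, hx'⟩) rfl).symm

end Generator

/-! ### The Møller operators -/

section MollerOperators

theorem Lp_norm_le_add {S : Type*} [MeasurableSpace S] {μ : Measure S} {f g h : Lp ℂ 2 μ} {a b : ℝ}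
    (ha : 0 ≤ a) (hb : 0 ≤ b) (H : ∀ᵐ s ∂μ, ‖f s‖ ≤ a * ‖g s‖ + b * ‖h s‖) :
    ‖f‖ ≤ a * ‖g‖ + b * ‖h‖ := by
  have e (g : Lp ℂ 2 μ) : ‖(Lp.memLp g).norm.toLp‖ = ‖g‖ := by
    rw [Lp.norm_toLp, eLpNorm_norm, Lp.norm_def]
  calc ‖f‖ ≤ ‖a • (Lp.memLp g).norm.toLp + b • (Lp.memLp h).norm.toLp‖ := by
        apply Lp.norm_le_norm_of_ae_le
        filter_upwards [H, (Lp.memLp g).norm.coeFn_toLp, (Lp.memLp h).norm.coeFn_toLp,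
          Lp.coeFn_add (a • (Lp.memLp g).norm.toLp) (b • (Lp.memLp h).norm.toLp),
          Lp.coeFn_smul a (Lp.memLp g).norm.toLp, Lp.coeFn_smul b (Lp.memLp h).norm.toLp]
          with s h1 h2 h3 h4 h5 h6
        rw [h4, Pi.add_apply, h5, h6, Pi.smul_apply, Pi.smul_apply, h2, h3]
        exact h1.trans (le_abs_self _)
    _ ≤ a * ‖g‖ + b * ‖h‖ := by
        refine (norm_add_le _ _).trans ?_
        rw [norm_smul, norm_smul, e, e, Real.norm_of_nonneg ha, Real.norm_of_nonneg hb]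

theorem norm_expMul_le {S : Type*} [MeasurableSpace S] {μ : Measure S} {a : S → ℝ}
    (ha : Measurable a) (t : ℝ) (f : Lp ℂ 2 μ) : ‖expMul μ a t f‖ ≤ ‖f‖ := by
  apply Lp.norm_le_norm_of_ae_le
  filter_upwards [coeFn_mulL (bddMeas_exp ha t) f] with s hs
  rw [expMul, hs, norm_mul, norm_exp_I_mul, one_mul]

/-- Strong convergence to zero of a bounded family can be checked on a set with dense span. -/
theorem tendsto_zero_of_dense_span {E F ι : Type*} [NormedAddCommGroup E] [NormedSpace ℂ E]
    [NormedAddCommGroup F] [NormedSpace ℂ F] {l : Filter ι} {V : ι → E →L[ℂ] F} {C : ℝ}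
    (hV : ∀ i x, ‖V i x‖ ≤ C * ‖x‖) {D : Set E} (hD : Dense (Submodule.span ℂ D : Set E))
    (h : ∀ x ∈ D, Tendsto (fun i => V i x) l (𝓝 0)) (x : E) :
    Tendsto (fun i => V i x) l (𝓝 0) := by
  have hspan (y : E) (hy : y ∈ Submodule.span ℂ D) : Tendsto (fun i => V i y) l (𝓝 0) := by
    induction hy using Submodule.span_induction with
    | mem y hy => exact h y hy
    | zero => simpa using tendsto_const_nhds
    | add y z _ _ hy hz => simpa using hy.add hz
    | smul c y _ hy => simpa using hy.const_smul c
  rw [Metric.tendsto_nhds]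
  intro ε hε
  have hC : 0 < |C| + 1 := by positivity
  obtain ⟨y, hy, hxy⟩ := Metric.dense_iff.1 hD x (ε / 2 / (|C| + 1)) (by positivity)
  filter_upwards [Metric.tendsto_nhds.1 (hspan y hxy) (ε / 2) (half_pos hε)] with i hi
  rw [dist_zero_right] at hi ⊢
  have h1 : ‖V i (x - y)‖ ≤ ε / 2 := by
    refine (hV i _).trans ?_
    rw [Metric.mem_ball, dist_comm, dist_eq_norm, lt_div_iff₀ hC] at hy
    nlinarith [le_abs_self C, norm_nonneg (x - y)]
  calc ‖V i x‖ = ‖V i (x - y) + V i y‖ := by rw [map_sub, sub_add_cancel]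
    _ ≤ ‖V i (x - y)‖ + ‖V i y‖ := norm_add_le _ _
    _ < ε := by linarith

/-! ### Gaussians of order zero under `e^{-itx²}` in the Mellin representation -/

theorem norm_gaussHat_zero {z : ℂ} (hz : z ≠ 0) (τ : ℝ) :
    ‖gaussHat 0 z τ‖ = ‖z / 2‖ ^ (-1 / 2 : ℝ) * Real.exp (-((z / 2).arg * τ / 2))
      * ‖(1 / 2 * Complex.Gamma ((0 + 1 - Complex.I * τ) / 2))‖ := by
  have h2 : z / 2 ≠ 0 := div_ne_zero hz two_ne_zero
  have hre : (-((0 + 1 - Complex.I * τ) / 2) : ℂ).re = -1 / 2 := by simp; norm_num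
  have him : (-((0 + 1 - Complex.I * τ) / 2) : ℂ).im = τ / 2 := by simp; ring
  rw [gaussHat, norm_mul, norm_mul, norm_mul, Complex.norm_cpow_of_ne_zero h2, hre, him,
    Real.exp_neg, mul_div_assoc]
  ring

/-- The Gamma factor does not depend on the parameter, so comparison with a real parameter
eliminates it. What remains is a constant and the exponential in `τ` governed by the argument of
`z`. -/
theorem norm_gaussHat_zero_eq {z : ℂ} (hz : z ≠ 0) {s : ℝ} (hs : 0 < s) (τ : ℝ) :
    ‖gaussHat 0 z τ‖ = (‖z / 2‖ ^ (-1 / 2 : ℝ) * (s / 2) ^ (1 / 2 : ℝ))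
      * Real.exp (-((z / 2).arg * τ / 2)) * ‖gaussHat 0 s τ‖ := by
  have hs0 : (s : ℂ) ≠ 0 := by exact_mod_cast hs.ne'
  have e1 : (s : ℂ) / 2 = ((s / 2 : ℝ) : ℂ) := by push_cast; rfl
  have e2 : (s / 2) ^ (1 / 2 : ℝ) * (s / 2) ^ (-1 / 2 : ℝ) = 1 := by
    rw [← Real.rpow_add (by positivity)]
    norm_num
  rw [norm_gaussHat_zero hz, norm_gaussHat_zero hs0, e1, Complex.arg_ofReal_of_nonneg (by positivity),
    Complex.norm_real, Real.norm_of_nonneg (by positivity)]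
  simp only [zero_mul, zero_div, neg_zero, Real.exp_zero, mul_one]
  linear_combination (-(‖z / 2‖ ^ (-1 / 2 : ℝ) * Real.exp (-((z / 2).arg * τ / 2))
    * ‖(1 / 2 * Complex.Gamma ((0 + 1 - Complex.I * τ) / 2))‖)) * e2

theorem expMul_gaussL2 {s : ℝ} (hs : 0 < s) (t : ℝ) :
    expMul halfLine (fun x => x ^ 2) (-t) (gaussL2 0 s) = gaussL2 0 (s + 2 * t * Complex.I) := by
  apply Lp.ext
  filter_upwards [coeFn_mulL (bddMeas_exp measurable_sq (-t)) (gaussL2 0 s),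
    coeFn_gaussL2 (m := 0) (z := s) (by simp) (by simpa using hs),
    coeFn_gaussL2 (m := 0) (z := s + 2 * t * Complex.I) (by simp) (by simpa using hs)]
    with x h1 h2 h3
  rw [expMul, h1, h2, h3, gauss, gauss, mul_left_comm, ← Complex.exp_add]
  congr 2
  push_cast
  ring

theorem tendsto_norm_gaussian_parameter (s : ℝ) {l : Filter ℝ}
    (hl : Tendsto (fun t : ℝ => |t|) l atTop) :
    Tendsto (fun t : ℝ => ‖((s + 2 * t * Complex.I : ℂ) / 2)‖ ^ (-1 / 2 : ℝ)) l (𝓝 0) := by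
  have h1 : Tendsto (fun t : ℝ => ‖((s + 2 * t * Complex.I : ℂ) / 2)‖) l atTop := by
    refine tendsto_atTop_mono (fun t => ?_) hl
    have h := Complex.abs_im_le_norm ((s + 2 * t * Complex.I : ℂ) / 2)
    simpa using h
  have h2 := (tendsto_rpow_neg_atTop (y := 1 / 2) (by norm_num)).comp h1
  refine h2.congr fun t => ?_
  simp only [Function.comp_apply]
  norm_num

/-- Propagation of Gaussians in the spectral representation of the dilation generator: `ψ(A)` is
negligible if `ψ` is small on the part of the spectrum where the mass concentrates. -/
theorem tendsto_norm_funcA_expMul {ψ : ℝ → ℂ} (hψ : BddMeas ψ) {l : Filter ℝ}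
    (hl : Tendsto (fun t : ℝ => |t|) l atTop)
    (h : ∀ ε > 0, ∃ S : Set ℝ, (∀ τ ∈ S, ‖ψ τ‖ ≤ ε) ∧ ∃ K : ℝ, ∀ s : ℝ, ∀ᶠ t : ℝ in l, ∀ τ ∉ S,
      -(((s + 2 * t * Complex.I : ℂ) / 2).arg * τ / 2) ≤ K) {s : ℝ} (hs : 0 < s) :
    Tendsto (fun t => ‖funcA ψ (expMul halfLine (fun x => x ^ 2) (-t) (gaussL2 0 s))‖) l
      (𝓝 0) := by
  obtain ⟨hψm, C, hC⟩ := hψ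
  have hC0 : 0 ≤ C := (norm_nonneg _).trans (hC 0)
  set N := ‖gaussL2 0 s‖ with hN
  have hnorm (f : L2) : ‖mellinEquiv f‖ = ‖f‖ := mellinL2.norm_map f
  have hpos (t : ℝ) : 0 < (s + 2 * t * Complex.I : ℂ).re := by simpa using hs
  rw [Metric.tendsto_nhds]
  intro ε hε
  -- On `S` the symbol is small and the norm of the propagated Gaussian is at most `N`. Off `S` the
  -- Mellin transform is at most `q e^K` times a fixed profile, with `q → 0`.
  obtain ⟨S, hS, K, hK⟩ := h (ε / 2 / (N + 1)) (by positivity)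
  have hlim := ((tendsto_norm_gaussian_parameter s hl).mul_const ((s / 2) ^ (1 / 2 : ℝ))).mul_const
    (C * Real.exp K * N)
  rw [zero_mul, zero_mul] at hlim
  filter_upwards [hK s, hlim.eventually_lt_const (half_pos hε)] with t h1 h2
  set z : ℂ := s + 2 * t * Complex.I with hz
  have hz0 : z ≠ 0 := by
    intro h0
    have := hpos t
    rw [← hz, h0] at this
    simp at this
  set q := ‖z / 2‖ ^ (-1 / 2 : ℝ) * (s / 2) ^ (1 / 2 : ℝ) with hq
  have hq0 : 0 ≤ q := by positivity
  set u := expMul halfLine (fun x => x ^ 2) (-t) (gaussL2 0 s) with hu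
  have hle : ‖u‖ ≤ N := norm_expMul_le measurable_sq _ _
  have key : ‖mellinEquiv (funcA ψ u)‖ ≤ ε / 2 / (N + 1) * ‖mellinEquiv u‖
      + q * (C * Real.exp K) * ‖mellinEquiv (gaussL2 0 s)‖ := by
    refine Lp_norm_le_add (by positivity) (by positivity) ?_
    rw [hu, expMul_gaussL2 hs, ← hz]
    filter_upwards [coeFn_mellinEquiv_funcA ⟨hψm, C, hC⟩ (gaussL2 0 z),
      mellinEquiv_gaussL2 (m := 0) (z := z) (by simp) (hpos t),
      mellinEquiv_gaussL2_ofReal (m := 0) (by simp) hs] with ξ e1 e2 e3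
    rw [e1, e2, e3, norm_mul]
    by_cases hξ : specVar ξ ∈ S
    · have := mul_le_mul_of_nonneg_right (hS _ hξ) (norm_nonneg (gaussHat 0 z (specVar ξ)))
      have h3 : 0 ≤ q * (C * Real.exp K) * ‖gaussHat 0 s (specVar ξ)‖ := by positivity
      linarith
    · have h3 : ‖gaussHat 0 z (specVar ξ)‖ ≤ q * Real.exp K * ‖gaussHat 0 s (specVar ξ)‖ := by
        rw [norm_gaussHat_zero_eq hz0 hs]
        gcongr
        exact h1 _ hξ
      have h4 : ‖ψ (specVar ξ)‖ * ‖gaussHat 0 z (specVar ξ)‖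
          ≤ C * (q * Real.exp K * ‖gaussHat 0 s (specVar ξ)‖) :=
        mul_le_mul (hC _) h3 (norm_nonneg _) hC0
      have h5 : 0 ≤ ε / 2 / (N + 1) * ‖gaussHat 0 z (specVar ξ)‖ := by positivity
      linarith
  rw [hnorm, hnorm, hnorm, ← hN] at key
  rw [dist_zero_right, norm_norm]
  have h6 : ε / 2 / (N + 1) * ‖u‖ ≤ ε / 2 := by
    rw [div_mul_eq_mul_div, div_le_iff₀ (by positivity)]
    gcongr
    linarith
  linarith

theorem funcA_sub_const {φ : ℝ → ℂ} (hφ : BddMeas φ) (c : ℂ) (f : L2) :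
    funcA (fun t => φ t - c) f = funcA φ f - c • f := by
  apply mellinEquiv.injective
  rw [mellinEquiv_funcA, mulL_sub hφ.comp_specVar (BddMeas.const c), sub_apply, mulL_const, map_sub,
    map_smul, mellinEquiv_funcA]

theorem expMul_expMul_neg {S : Type*} [MeasurableSpace S] {μ : Measure S} {a : S → ℝ}
    (ha : Measurable a) (t : ℝ) (f : Lp ℂ 2 μ) : expMul μ a t (expMul μ a (-t) f) = f := by
  have hU := isOneParameterGroup_expMul (μ := μ) ha
  rw [← ContinuousLinearMap.comp_apply, ← hU.add, add_neg_cancel, hU.zero]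
  rfl

/-- A function of the dilation generator, propagated by `e^{itx²}`, converges strongly to its limit
at the end of the spectrum towards which Gaussians are transported. -/
theorem tendsto_expMul_funcA {φ : ℝ → ℂ} (hφ : BddMeas φ) {c : ℂ} {l : Filter ℝ}
    (hl : Tendsto (fun t : ℝ => |t|) l atTop)
    (h : ∀ ε > 0, ∃ S : Set ℝ, (∀ τ ∈ S, ‖φ τ - c‖ ≤ ε) ∧ ∃ K : ℝ, ∀ s : ℝ, ∀ᶠ t : ℝ in l, ∀ τ ∉ S,
      -(((s + 2 * t * Complex.I : ℂ) / 2).arg * τ / 2) ≤ K) (f : L2) :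
    Tendsto (fun t => expMul halfLine (fun x => x ^ 2) t
      (funcA φ (expMul halfLine (fun x => x ^ 2) (-t) f))) l (𝓝 (c • f)) := by
  -- Constants commute with the propagation, so the claim reduces to limit `0`. The operators `V t`
  -- are uniformly bounded, so order-zero Gaussians suffice.
  set ψ : ℝ → ℂ := fun t => φ t - c with hψ
  set V : ℝ → L2 →L[ℂ] L2 := fun t => (expMul halfLine (fun x => x ^ 2) t).comp
    ((funcA ψ).comp (expMul halfLine (fun x => x ^ 2) (-t))) with hVdef
  have hV (t : ℝ) (f : L2) : ‖V t f‖ ≤ ‖funcA ψ (expMul halfLine (fun x => x ^ 2) (-t) f)‖ :=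
    norm_expMul_le measurable_sq t _
  have hV2 (t : ℝ) (f : L2) : ‖V t f‖ ≤ ‖funcA ψ‖ * ‖f‖ :=
    (hV t f).trans (((funcA ψ).le_opNorm _).trans
      (mul_le_mul_of_nonneg_left (norm_expMul_le measurable_sq _ _) (norm_nonneg _)))
  have h0 : Tendsto (fun t => V t f) l (𝓝 0) := by
    refine tendsto_zero_of_dense_span hV2 (dense_span_gaussL2 (m := 0) (by simp)) ?_ f
    rintro _ ⟨s, hs, rfl⟩
    refine squeeze_zero_norm (fun t => hV t _)
      (tendsto_norm_funcA_expMul (hφ.sub (BddMeas.const c)) hl h hs)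
  have h1 := h0.add_const (c • f)
  rw [zero_add] at h1
  refine h1.congr fun t => ?_
  simp only [hVdef, ContinuousLinearMap.comp_apply]
  rw [hψ, funcA_sub_const hφ, map_sub, map_smul, expMul_expMul_neg measurable_sq, sub_add_cancel]

theorem neg_arg_mul_le {a τ R : ℝ} (hR : 0 ≤ R) (ha : |a| ≤ Real.pi) (h : -(a * τ) ≤ |a| * R) :
    -(a * τ / 2) ≤ Real.pi * R / 2 := by
  have := mul_le_mul_of_nonneg_right ha hR
  linarith

theorem gaussian_parameter_div_two_im (s t : ℝ) : ((s + 2 * t * Complex.I : ℂ) / 2).im = t := by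
  simp

/-- For `t ≥ 0` the argument of `s/2 + it` is nonnegative, so `e^{-arg · τ/2}` stays bounded on `τ >
R`. That part of the spectrum is lost by the decay in `t`, and only the limit of `φ` at `-∞`
remains. -/
theorem tendsto_expMul_funcA_atTop {φ : ℝ → ℂ} (hφ : BddMeas φ) {c : ℂ}
    (hc : Tendsto φ atBot (𝓝 c)) (f : L2) :
    Tendsto (fun t => expMul halfLine (fun x => x ^ 2) t
      (funcA φ (expMul halfLine (fun x => x ^ 2) (-t) f))) atTop (𝓝 (c • f)) := by
  refine tendsto_expMul_funcA hφ tendsto_abs_atTop_atTop (fun ε hε => ?_) f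
  obtain ⟨R, hR⟩ := eventually_atBot.1 (Metric.tendsto_nhds.1 hc ε hε)
  refine ⟨Set.Iic R, fun τ hτ => ?_, Real.pi * |R| / 2, fun s => ?_⟩
  · rw [← dist_eq_norm]
    exact (hR τ hτ).le
  · filter_upwards [eventually_ge_atTop 0] with t ht τ hτ
    have h0 : 0 ≤ ((s + 2 * t * Complex.I : ℂ) / 2).arg := by
      rwa [Complex.arg_nonneg_iff, gaussian_parameter_div_two_im]
    refine neg_arg_mul_le (abs_nonneg R) (Complex.abs_arg_le_pi _) ?_
    rw [abs_of_nonneg h0, ← mul_neg]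
    refine mul_le_mul_of_nonneg_left ?_ h0
    rw [Set.mem_Iic, not_le] at hτ
    linarith [neg_le_abs R]

/-- For `t < 0` the argument changes sign and the mass moves to `+∞` instead. -/
theorem tendsto_expMul_funcA_atBot {φ : ℝ → ℂ} (hφ : BddMeas φ) {c : ℂ}
    (hc : Tendsto φ atTop (𝓝 c)) (f : L2) :
    Tendsto (fun t => expMul halfLine (fun x => x ^ 2) t
      (funcA φ (expMul halfLine (fun x => x ^ 2) (-t) f))) atBot (𝓝 (c • f)) := by
  refine tendsto_expMul_funcA hφ tendsto_abs_atBot_atTop (fun ε hε => ?_) f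
  obtain ⟨R, hR⟩ := eventually_atTop.1 (Metric.tendsto_nhds.1 hc ε hε)
  refine ⟨Set.Ici R, fun τ hτ => ?_, Real.pi * |R| / 2, fun s => ?_⟩
  · rw [← dist_eq_norm]
    exact (hR τ hτ).le
  · filter_upwards [eventually_lt_atBot 0] with t ht τ hτ
    have h0 : ((s + 2 * t * Complex.I : ℂ) / 2).arg < 0 := by
      rwa [Complex.arg_neg_iff, gaussian_parameter_div_two_im]
    refine neg_arg_mul_le (abs_nonneg R) (Complex.abs_arg_le_pi _) ?_
    rw [abs_of_neg h0, ← neg_mul]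
    refine mul_le_mul_of_nonneg_left ?_ (neg_nonneg.2 h0.le)
    rw [Set.mem_Ici, not_le] at hτ
    linarith [le_abs_self R]

/-- The inner factors of the two conjugated groups combine to `ℱ_m ℱ_k`, a function of `A`. Its
propagation by `e^{itx²}` tends to the scalar `c`, leaving `ℱ_m c ℱ_k`. -/
theorem isMollerOperator_hankelGroup {m k : ℂ} (hm : -1 < m.re) (hk : -1 < k.re) {l : Filter ℝ}
    {c : ℂ} (h : ∀ f, Tendsto (fun t => expMul halfLine (fun x => x ^ 2) t
      (funcA (fun t => Xi k t / Xi m t) (expMul halfLine (fun x => x ^ 2) (-t) f))) l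
      (𝓝 (c • f))) :
    IsMollerOperator l (hankelGroup m hm) (hankelGroup k hk) (c • (hankel m * hankel k)) := by
  intro f
  have h1 := ((hankel m).continuous.tendsto _).comp (h (hankel k f))
  rw [← hankel_mul_hankel hm hk] at h1
  rw [map_smul] at h1
  exact h1

/-- The operator `Ξ_m(A)` as an invertible operator. -/
noncomputable def funcXi (m : ℂ) (hm : -1 < m.re) : (L2 →L[ℂ] L2)ˣ where
  val := funcA (Xi m)
  inv := funcA fun t => (Xi m t)⁻¹
  val_inv := by
    rw [← funcA_mul (bddMeas_Xi hm) (bddMeas_Xi_inv hm), ← funcA_one]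
    congr 1
    ext t
    exact mul_inv_cancel₀ (Xi_ne_zero hm t)
  inv_val := by
    rw [← funcA_mul (bddMeas_Xi_inv hm) (bddMeas_Xi hm), ← funcA_one]
    congr 1
    ext t
    exact inv_mul_cancel₀ (Xi_ne_zero hm t)

theorem funcXi_mul_inv {m k : ℂ} (hm : -1 < m.re) (hk : -1 < k.re) :
    (funcXi k hk).val * (funcXi m hm)⁻¹.val = hankel m * hankel k := by
  rw [hankel_mul_hankel hm hk]
  exact (funcA_mul (bddMeas_Xi hk) (bddMeas_Xi_inv hm)).symm

end MollerOperators

end Moller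

/-! ### The main theorem -/

theorem mainTheorem9 (ξ : ℝ → ℝ) (hξ : Moller.IsCutoff ξ) (m k : ℂ)
    (hm : -1 < m.re) (hk : -1 < k.re) :
    ∃ (Um Uk : ℝ → Moller.L2 →L[ℂ] Moller.L2) (Fm Fk : Moller.L2 →L[ℂ] Moller.L2)
      (Xm Xk : (Moller.L2 →L[ℂ] Moller.L2)ˣ) (Ωp Ωm : Moller.L2 →L[ℂ] Moller.L2),
      -- `Um t = e^{itH_m}` and `Uk t = e^{itH_k}`
      Moller.IsExpGroup (Moller.schrodinger ξ m) Um ∧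
      Moller.IsExpGroup (Moller.schrodinger ξ k) Uk ∧
      -- `Fm` and `Fk` are the Hankel transformations
      Moller.IsHankelTransform m Fm ∧ Moller.IsHankelTransform k Fk ∧
      -- `Xm = Ξ_m(A)` and `Xk = Ξ_k(A)`
      Moller.IsFunctionOf Moller.dilationGenerator (Moller.Xi m) Xm.val ∧
      Moller.IsFunctionOf Moller.dilationGenerator (Moller.Xi k) Xk.val ∧
      -- the two Møller operators exist and are given by the formulas
      Moller.IsMollerOperator Filter.atTop Um Uk Ωp ∧
      Moller.IsMollerOperator Filter.atBot Um Uk Ωm ∧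
      Ωp = Complex.exp (Complex.I * (m - k) * Real.pi / 2) • (Fm * Fk) ∧
      Ωp = Complex.exp (Complex.I * (m - k) * Real.pi / 2) • (Xk.val * Xm⁻¹.val) ∧
      Ωm = Complex.exp (-(Complex.I * (m - k) * Real.pi / 2)) • (Fm * Fk) ∧
      Ωm = Complex.exp (-(Complex.I * (m - k) * Real.pi / 2)) • (Xk.val * Xm⁻¹.val) := by
  -- The limit `t → +∞` sees the symbol at `-∞`, hence the phase with `m - k` in place of `k - m`.
  have e : Complex.I * (m - k) * Real.pi / 2 = -((k - m) / 2 * (Complex.I * Real.pi)) := by ring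
  refine ⟨Moller.hankelGroup m hm, Moller.hankelGroup k hk, Moller.hankel m, Moller.hankel k,
    Moller.funcXi m hm, Moller.funcXi k hk, _, _,
    ⟨Moller.isOneParameterGroup_hankelGroup hm, Moller.generator_hankelGroup hm hξ⟩,
    ⟨Moller.isOneParameterGroup_hankelGroup hk, Moller.generator_hankelGroup hk hξ⟩,
    Moller.isHankelTransform_hankel hm, Moller.isHankelTransform_hankel hk,
    Moller.isFunctionOf_funcA (Moller.bddMeas_Xi hm),
    Moller.isFunctionOf_funcA (Moller.bddMeas_Xi hk),
    Moller.isMollerOperator_hankelGroup hm hk (Moller.tendsto_expMul_funcA_atTop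
      (Moller.bddMeas_Xi_div_Xi hm hk) (Moller.tendsto_Xi_div_Xi_atBot hm hk)),
    Moller.isMollerOperator_hankelGroup hm hk (Moller.tendsto_expMul_funcA_atBot
      (Moller.bddMeas_Xi_div_Xi hm hk) (Moller.tendsto_Xi_div_Xi_atTop hm hk)),
    ?_, ?_, ?_, ?_⟩ <;> simp only [Moller.funcXi_mul_inv hm hk, e, neg_neg]
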